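/- Let $\mathcal H$ be a complex Hilbert space, let $T$ be a self-adjoint (possibly unbounded) operator in $\mathcal H$ with $T^{-1}\in\mathcal B(\mathcal H)$, and let $S$ be a closed operator in $\mathcal H$ with $\operatorname{dom}(S)\cap\operatorname{dom}(S^*)\supseteq\operatorname{dom}(T)$. Products of operators are taken on their maximal domains. For a self-adjoint operator $A$ with spectral measure $E_A$ put $A^z=\int\lambda^z\,dE_A(\lambda)$, where $\lambda^z=e^{z\ln\lambda}$ for $\lambda>0$, $\lambda^z=e^{z(\ln|\lambda|+i\pi)}$ for $\lambda<0$, and $0^0=1$. Let $|S|=(S^*S)^{1/2}$, $|S^*|=(SS^*)^{1/2}$, and let $U_S$ be the partial isometry with $\ker U_S=\ker S$ in the polar decomposition $S=U_S|S|$. Then $ST^{-1},\,S^*T^{-1}\in\mathcal B(\mathcal H)$, and for every $z\in\mathbb C$ with $0\le\operatorname{Re}z\le1$ the operator $T^{-z}ST^{-1+z}$ is defined on $\operatorname{dom}(T)$ and, with domain $\operatorname{dom}(T)$, is closable, with closure $$\overline{T^{-z}ST^{-1+z}}=T^{-i\operatorname{Im}z}\big[|S^*|^{\operatorname{Re}z}\,(T^{-\operatorname{Re}z})^*\big]^*\,U_S\,|S|^{1-\operatorname{Re}z}\,T^{-1+\operatorname{Re}z}\,T^{i\operatorname{Im}z}\in\mathcal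 B(\mathcal H).$$ If $T\ge0$, then $(T^{-\operatorname{Re}z})^*$ can be replaced by $T^{-\operatorname{Re}z}$ in this formula. Moreover, for every $k\in(0,\infty)$ and every such $z$, $$\big\|\overline{T^{-z}ST^{-1+z}}\big\|\le\|ST^{-1}\|^{1-\operatorname{Re}z}\,\|S^*T^{-1}\|^{\operatorname{Re}z}\,e^{k|\operatorname{Im}z|^2+k\operatorname{Re}z(1-\operatorname{Re}z)+k^{-1}\pi^2},$$ and if $T\ge0$ the exponential factor can be replaced by $1$. Finally, for every $x\in[0,1]$, $$\big\|\overline{T^{-x}ST^{-1+x}}\big\|\le\|ST^{-1}\|^{1-x}\,\|S^*T^{-1}\|^{x}\,e^{2\pi\sqrt{x(1-x)}},$$ and if $T\ge0$ the exponential factor can be replaced by $1$. -/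

import Mathlib

open MeasureTheory Filter Topology
open scoped ENNReal LinearPMap

noncomputable section

variable {H : Type*} [NormedAddCommGroup H] [InnerProductSpace ℂ H] [CompleteSpace H]

/-! ### Operator products, bounded operators -/

/-- A bounded operator, regarded as an everywhere defined partial operator. -/
def ofCLM (B : H →L[ℂ] H) : H →ₗ.[ℂ] H := (B : H →ₗ[ℂ] H).toPMap ⊤

/-- The maximally defined product `A B`, with domain `{f ∈ dom B | B f ∈ dom A}`. -/
def opMul (A B : H →ₗ.[ℂ] H) : H →ₗ.[ℂ] H where
  domain :=
    { carrier := {f | ∃ h : f ∈ B.domain, B ⟨f, h⟩ ∈ A.domain}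
      zero_mem' := ⟨B.domain.zero_mem, by
        have : B ⟨0, B.domain.zero_mem⟩ = 0 := B.map_zero
        rw [this]; exact A.domain.zero_mem⟩
      add_mem' := by
        rintro f g ⟨hf, hf'⟩ ⟨hg, hg'⟩
        refine ⟨B.domain.add_mem hf hg, ?_⟩
        have : B ⟨f + g, B.domain.add_mem hf hg⟩ = B ⟨f, hf⟩ + B ⟨g, hg⟩ :=
          B.map_add ⟨f, hf⟩ ⟨g, hg⟩
        rw [this]; exact A.domain.add_mem hf' hg'
      smul_mem' := by
        rintro c f ⟨hf, hf'⟩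
        refine ⟨B.domain.smul_mem c hf, ?_⟩
        have : B ⟨c • f, B.domain.smul_mem c hf⟩ = c • B ⟨f, hf⟩ := B.map_smul c ⟨f, hf⟩
        rw [this]; exact A.domain.smul_mem c hf' }
  toFun :=
    { toFun := fun f => A ⟨B ⟨f.1, f.2.1⟩, f.2.2⟩
      map_add' := by
        rintro ⟨f, hf, hf'⟩ ⟨g, hg, hg'⟩
        rw [← A.map_add]
        congr 1
        exact Subtype.ext (B.map_add ⟨f, hf⟩ ⟨g, hg⟩)
      map_smul' := by
        rintro c ⟨f, hf, hf'⟩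
        rw [RingHom.id_apply, ← A.map_smul]
        congr 1
        exact Subtype.ext (B.map_smul c ⟨f, hf⟩) }

/-- `T⁻¹ ∈ B(H)`: the operator `T` is injective and its inverse (defined on the range of `T`)
is an everywhere defined bounded operator. -/
def HasBoundedInverse (T : H →ₗ.[ℂ] H) : Prop :=
  LinearMap.ker T.toFun = ⊥ ∧ ∃ R : H →L[ℂ] H, T.inverse = ofCLM R

/-- `T ≥ 0` in the sense of quadratic forms. -/
def IsNonneg (T : H →ₗ.[ℂ] H) : Prop :=
  ∀ f : T.domain, 0 ≤ (inner ℂ (f : H) (T f)).re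

/-! ### Projection-valued measures and spectral integrals -/

/-- A projection-valued measure (resolution of the identity) on the Borel sets of `ℝ`. The values
on sets that are not Borel play no role. -/
structure ProjMeasure (H : Type*) [NormedAddCommGroup H] [InnerProductSpace ℂ H]
    [CompleteSpace H] where
  proj : Set ℝ → H →L[ℂ] H
  isStarProjection : ∀ s, MeasurableSet s → IsStarProjection (proj s)
  proj_univ : proj Set.univ = 1
  hasSum_iUnion : ∀ s : ℕ → Set ℝ, (∀ n, MeasurableSet (s n)) →
    Pairwise (Function.onFun Disjoint s) →
    ∀ f : H, HasSum (fun n => proj (s n) f) (proj (⋃ n, s n) f)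

namespace ProjMeasure

variable (E : ProjMeasure H)

theorem proj_empty (f : H) : E.proj ∅ f = 0 := by
  have h := E.hasSum_iUnion (fun _ => ∅) (fun _ => MeasurableSet.empty)
    (fun _ _ _ => by simp [Function.onFun]) f
  have h' := h.summable.tendsto_atTop_zero
  exact tendsto_nhds_unique tendsto_const_nhds h'

open scoped Classical in
/-- The vector measure `s ↦ E(s) f`. -/
def vec (f : H) : VectorMeasure ℝ H where
  measureOf' s := if MeasurableSet s then E.proj s f else 0
  empty' := by simp [E.proj_empty]
  not_measurable' s hs := by simp [hs]
  m_iUnion' s hs hd := by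
    simpa [hs, MeasurableSet.iUnion hs] using E.hasSum_iUnion s hs hd f

theorem vec_apply (f : H) {s : Set ℝ} (hs : MeasurableSet s) : E.vec f s = E.proj s f :=
  if_pos hs

theorem inner_proj (f : H) {s : Set ℝ} (hs : MeasurableSet s) :
    inner ℂ f (E.proj s f) = ((‖E.proj s f‖ ^ 2 : ℝ) : ℂ) := by
  have h := E.isStarProjection s hs
  have h1 : E.proj s (E.proj s f) = E.proj s f := congrArg (fun A => A f) h.isIdempotentElem
  have h2 : ContinuousLinearMap.adjoint (E.proj s) = E.proj s := h.isSelfAdjoint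
  calc inner ℂ f (E.proj s f) = inner ℂ f (E.proj s (E.proj s f)) := by rw [h1]
    _ = inner ℂ (ContinuousLinearMap.adjoint (E.proj s) f) (E.proj s f) := by
        rw [ContinuousLinearMap.adjoint_inner_left]
    _ = _ := by rw [h2, inner_self_eq_norm_sq_to_K]; norm_cast

/-- The finite Borel measure `s ↦ ‖E(s) f‖²` on `ℝ`. -/
def scalar (f : H) : Measure ℝ :=
  Measure.ofMeasurable (fun s _ => ENNReal.ofReal (‖E.proj s f‖ ^ 2))
    (by simp [E.proj_empty])
    (by
      intro s hs hd
      have h := (E.hasSum_iUnion s hs hd f).mapL (innerSL ℂ f)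
      simp only [innerSL_apply_apply] at h
      rw [E.inner_proj f (MeasurableSet.iUnion hs)] at h
      simp only [E.inner_proj f (hs _)] at h
      have h' := Complex.hasSum_ofReal.mp h
      rw [← h'.tsum_eq, ENNReal.ofReal_tsum_of_nonneg (fun _ => by positivity) h'.summable])

theorem scalar_apply (f : H) {s : Set ℝ} (hs : MeasurableSet s) :
    E.scalar f s = ENNReal.ofReal (‖E.proj s f‖ ^ 2) :=
  Measure.ofMeasurable_apply s hs

instance (f : H) : IsFiniteMeasure (E.scalar f) :=
  ⟨by rw [E.scalar_apply f MeasurableSet.univ]; exact ENNReal.ofReal_lt_top⟩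

theorem scalar_add_le (f g : H) :
    E.scalar (f + g) ≤ (2 : ℝ≥0∞) • (E.scalar f + E.scalar g) := by
  refine Measure.le_iff.mpr fun s hs => ?_
  simp only [Measure.smul_apply, Measure.add_apply, E.scalar_apply _ hs, smul_eq_mul]
  rw [← ENNReal.ofReal_add (by positivity) (by positivity),
    show (2 : ℝ≥0∞) = ENNReal.ofReal 2 by simp, ← ENNReal.ofReal_mul (by norm_num)]
  refine ENNReal.ofReal_le_ofReal ?_
  rw [map_add]
  have := norm_add_le (E.proj s f) (E.proj s g)
  nlinarith [norm_nonneg (E.proj s f + E.proj s g), sq_nonneg (‖E.proj s f‖ - ‖E.proj s g‖)]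

theorem scalar_smul (c : ℂ) (f : H) :
    E.scalar (c • f) = ENNReal.ofReal (‖c‖ ^ 2) • E.scalar f := by
  refine Measure.ext fun s hs => ?_
  rw [Measure.smul_apply, E.scalar_apply _ hs, E.scalar_apply _ hs, map_smul, norm_smul, mul_pow,
    ENNReal.ofReal_mul (by positivity), smul_eq_mul]

/-- The spectral integral `∫ φ dE = ∑_c c E(φ⁻¹{c})` of a simple function `φ`. -/
def simple (φ : SimpleFunc ℝ ℂ) : H →L[ℂ] H :=
  ∑ c ∈ φ.range, c • E.proj (φ ⁻¹' {c})

/-- The set function `s ↦ (c ↦ c • E(s) f)`, used for the additivity of `simple`. -/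
def setFun (f : H) (s : Set ℝ) : ℂ →L[ℝ] H :=
  ((ContinuousLinearMap.id ℂ ℂ).smulRight (E.vec f s)).restrictScalars ℝ

theorem setFun_additive (f : H) : FinMeasAdditive (E.scalar f) (E.setFun f) := by
  intro s t hs ht _ _ hd
  ext
  simp [setFun, VectorMeasure.of_union hd hs ht]

theorem simple_apply (φ : SimpleFunc ℝ ℂ) (f : H) :
    E.simple φ f = φ.setToSimpleFunc (E.setFun f) := by
  simp [simple, SimpleFunc.setToSimpleFunc, setFun,
    E.vec_apply f (φ.measurableSet_fiber _)]

theorem simple_sub (φ ψ : SimpleFunc ℝ ℂ) (f : H) :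
    E.simple (φ - ψ) f = E.simple φ f - E.simple ψ f := by
  simp only [simple_apply]
  exact SimpleFunc.setToSimpleFunc_sub _ (E.setFun_additive f)
    (SimpleFunc.integrable_of_isFiniteMeasure _) (SimpleFunc.integrable_of_isFiniteMeasure _)

theorem inner_proj_of_disjoint (f : H) {s t : Set ℝ} (hs : MeasurableSet s) (ht : MeasurableSet t)
    (hd : Disjoint s t) : inner ℂ (E.proj s f) (E.proj t f) = 0 := by
  have hadd : E.proj (s ∪ t) = E.proj s + E.proj t := by
    ext g
    have := VectorMeasure.of_union (v := E.vec g) hd hs ht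
    simpa [E.vec_apply g hs, E.vec_apply g ht, E.vec_apply g (hs.union ht)] using this
  have h0 := E.isStarProjection _ (hs.union ht)
  have h1 := E.isStarProjection s hs
  have h2 := E.isStarProjection t ht
  have hmul : E.proj s * E.proj t = 0 := by
    rw [hadd] at h0
    have hi := h0.isIdempotentElem
    have := (IsIdempotentElem.add_iff h1.isIdempotentElem h2.isIdempotentElem).mp hi
    have is := h1.isIdempotentElem.eq
    have hanti := eq_neg_of_add_eq_zero_left this
    have e2 : E.proj s * E.proj t = E.proj s * E.proj t * (-1 : H →L[ℂ] H) * E.proj s := by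
      calc E.proj s * E.proj t = E.proj s * (E.proj s * E.proj t) := by
            rw [← mul_assoc, is]
        _ = E.proj s * (-(E.proj t * E.proj s)) := by rw [hanti]
        _ = _ := by noncomm_ring
    have e3 : E.proj s * E.proj t * E.proj s = -(E.proj s * E.proj t * E.proj s) := by
      conv_lhs => rw [e2]
      simp [mul_assoc, is]
    have e4 : E.proj s * E.proj t * E.proj s = 0 := by
      have := add_eq_zero_iff_eq_neg.mpr e3
      rw [← two_smul ℂ] at this
      exact (smul_eq_zero.mp this).resolve_left two_ne_zero
    rw [e2]
    simpa using e4
  rw [← ContinuousLinearMap.adjoint_inner_right]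
  have h1' : ContinuousLinearMap.adjoint (E.proj s) = E.proj s := h1.isSelfAdjoint
  rw [h1']
  have : E.proj s (E.proj t f) = 0 := congrArg (fun A : H →L[ℂ] H => A f) hmul
  rw [this, inner_zero_right]

/-- The isometry property `‖(∫ φ dE) f‖ = ‖φ‖_{L²(‖E f‖²)}` for simple functions. -/
theorem norm_simple (φ : SimpleFunc ℝ ℂ) (f : H) :
    ENNReal.ofReal ‖E.simple φ f‖ = eLpNorm φ 2 (E.scalar f) := by
  have h1 : ‖E.simple φ f‖ ^ 2 = ∑ c ∈ φ.range, ‖c‖ ^ 2 * ‖E.proj (φ ⁻¹' {c}) f‖ ^ 2 := by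
    have : inner ℂ (E.simple φ f) (E.simple φ f)
        = ((∑ c ∈ φ.range, ‖c‖ ^ 2 * ‖E.proj (φ ⁻¹' {c}) f‖ ^ 2 : ℝ) : ℂ) := by
      simp only [simple, sum_apply, smul_apply,
        sum_inner, inner_sum, inner_smul_left, inner_smul_right]
      push_cast
      refine Finset.sum_congr rfl fun c hc => ?_
      rw [Finset.sum_eq_single c]
      · rw [inner_self_eq_norm_sq_to_K, ← mul_assoc, Complex.mul_conj']
        rfl
      · intro d _ hd
        rw [E.inner_proj_of_disjoint f (φ.measurableSet_fiber _) (φ.measurableSet_fiber _)]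
        · simp
        · exact (Set.disjoint_singleton.mpr hd).preimage φ
      · exact fun h => absurd hc h
    rw [inner_self_eq_norm_sq_to_K] at this
    exact Complex.ofReal_injective (by rw [← this]; norm_cast)
  have h2 : eLpNorm φ 2 (E.scalar f) ^ 2 = ENNReal.ofReal (‖E.simple φ f‖ ^ 2) := by
    have : eLpNorm φ 2 (E.scalar f) ^ 2 = ∫⁻ t, ‖φ t‖ₑ ^ 2 ∂(E.scalar f) := by
      have := eLpNorm_nnreal_pow_eq_lintegral (f := φ) (μ := E.scalar f) (p := 2) (by norm_num)
      simpa using this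
    rw [this]
    have hm : ∀ t, ‖φ t‖ₑ ^ 2 = (φ.map (fun c => ‖c‖ₑ ^ 2)) t := fun t => rfl
    simp_rw [hm]
    rw [SimpleFunc.lintegral_eq_lintegral, SimpleFunc.map_lintegral, h1,
      ENNReal.ofReal_sum_of_nonneg (fun _ _ => by positivity)]
    refine Finset.sum_congr rfl fun c _ => ?_
    rw [E.scalar_apply f (φ.measurableSet_fiber _), ENNReal.ofReal_mul (by positivity),
      ENNReal.ofReal_pow (norm_nonneg c), ofReal_norm]
  rw [ENNReal.ofReal_pow (norm_nonneg _)] at h2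
  exact ((ENNReal.pow_right_strictMono two_ne_zero).injective h2).symm

/-- A sequence of simple functions that converges pointwise to the Borel function `g`, and also
in `L²(μ)` for every finite measure `μ` with `g ∈ L²(μ)`. -/
def approx (g : ℝ → ℂ) (hg : Measurable g) (n : ℕ) : SimpleFunc ℝ ℂ :=
  SimpleFunc.approxOn g hg Set.univ 0 (Set.mem_univ _) n

theorem tendsto_approx {g : ℝ → ℂ} (hg : Measurable g) {f : H} (hf : MemLp g 2 (E.scalar f)) :
    Tendsto (fun n => E.simple (approx g hg n) f) atTop
      (𝓝 (limUnder atTop fun n => E.simple (approx g hg n) f)) := by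
  have hlim : Tendsto (fun n => eLpNorm (⇑(approx g hg n) - g) 2 (E.scalar f)) atTop (𝓝 0) := by
    refine SimpleFunc.tendsto_approxOn_Lp_eLpNorm hg (Set.mem_univ _) (by norm_num) (by simp) ?_
    simpa using hf.2
  refine CauchySeq.tendsto_limUnder ?_
  rw [EMetric.cauchySeq_iff]
  intro ε hε
  have hε2 : 0 < ε / 2 := ENNReal.half_pos hε.ne'
  obtain ⟨N, hN⟩ := eventually_atTop.mp (hlim.eventually (gt_mem_nhds hε2))
  refine ⟨N, fun m hm n hn => ?_⟩
  have e : edist (E.simple (approx g hg m) f) (E.simple (approx g hg n) f)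
      = eLpNorm ((⇑(approx g hg m) - g) - (⇑(approx g hg n) - g)) 2 (E.scalar f) := by
    rw [edist_dist, dist_eq_norm, ← E.simple_sub, E.norm_simple]
    congr 1
    ext t
    simp
  rw [e]
  calc _ ≤ eLpNorm (⇑(approx g hg m) - g) 2 (E.scalar f)
        + eLpNorm (⇑(approx g hg n) - g) 2 (E.scalar f) :=
        eLpNorm_sub_le ((SimpleFunc.aestronglyMeasurable _).sub hg.aestronglyMeasurable)
          ((SimpleFunc.aestronglyMeasurable _).sub hg.aestronglyMeasurable) (by norm_num)
    _ < ε / 2 + ε / 2 := ENNReal.add_lt_add (hN m hm) (hN n hn)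
    _ = ε := ENNReal.add_halves ε

theorem memLp_add_measure {g : ℝ → ℂ} (hg : Measurable g) {μ ν : Measure ℝ}
    (hμ : MemLp g 2 μ) (hν : MemLp g 2 ν) : MemLp g 2 (μ + ν) := by
  refine ⟨hg.aestronglyMeasurable, ?_⟩
  have h1 := hμ.2
  have h2 := hν.2
  rw [eLpNorm_lt_top_iff_lintegral_rpow_enorm_lt_top two_ne_zero ENNReal.ofNat_ne_top] at *
  rw [lintegral_add_measure]
  exact ENNReal.add_lt_top.mpr ⟨h1, h2⟩

/-- The spectral integral `∫ g(λ) dE(λ)` of a Borel function `g`: its domain consists of the `f`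
with `∫ |g(λ)|² d‖E(λ) f‖² < ∞`, and its value at `f` is the limit of the integrals of simple
functions converging to `g` in `L²(d‖E(λ) f‖²)`. -/
def integral (g : ℝ → ℂ) (hg : Measurable g) : H →ₗ.[ℂ] H where
  domain :=
    { carrier := {f | MemLp g 2 (E.scalar f)}
      zero_mem' := by
        have : E.scalar 0 = 0 := by simpa using E.scalar_smul 0 0
        simp [this]
      add_mem' := fun {f f'} hf hf' =>
        ((memLp_add_measure hg hf hf').smul_measure (by norm_num)).mono_measure
          (E.scalar_add_le f f')
      smul_mem' := fun c f hf => by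
        change MemLp g 2 (E.scalar (c • f))
        rw [E.scalar_smul]
        exact hf.smul_measure ENNReal.ofReal_ne_top }
  toFun :=
    { toFun := fun f => limUnder atTop fun n => E.simple (approx g hg n) f
      map_add' := fun f f' => by
        have h := (E.tendsto_approx hg f.2).add (E.tendsto_approx hg f'.2)
        refine tendsto_nhds_unique (E.tendsto_approx hg (f + f').2) (h.congr fun n => ?_)
        simp
      map_smul' := fun c f => by
        have h := (E.tendsto_approx hg f.2).const_smul c
        refine tendsto_nhds_unique (E.tendsto_approx hg (c • f).2) (h.congr fun n => ?_)
        simp }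

open scoped Classical in
/-- The projection-valued measure concentrated at the point `0`. -/
def diracZero : ProjMeasure H where
  proj s := if (0 : ℝ) ∈ s then 1 else 0
  isStarProjection s _ := by
    split_ifs
    · exact IsStarProjection.one _
    · exact IsStarProjection.zero _
  proj_univ := by simp
  hasSum_iUnion s _ hd f := by
    by_cases h : ∃ n, (0 : ℝ) ∈ s n
    · obtain ⟨n, hn⟩ := h
      have hU : (0 : ℝ) ∈ ⋃ n, s n := Set.mem_iUnion.mpr ⟨n, hn⟩
      have hne : ∀ m, m ≠ n → (0 : ℝ) ∉ s m := fun m hm h0 =>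
        Set.disjoint_left.mp (hd hm) h0 hn
      have := hasSum_single (f := fun m => (if (0 : ℝ) ∈ s m then (1 : H →L[ℂ] H) else 0) f) n
        (fun m hm => by simp [hne m hm])
      simpa [hU, hn] using this
    · have hU : (0 : ℝ) ∉ ⋃ n, s n := by simpa using h
      push Not at h
      simp [h]

end ProjMeasure

/-! ### Powers of self-adjoint operators -/

open scoped Classical in
/-- The spectral measure `E_A` of a self-adjoint operator `A`, i.e. the projection-valued measure
with `A = ∫ λ dE_A(λ)`, including equality of domains. (If there is none, which does not occur
for self-adjoint `A`, an arbitrary value is taken.) -/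
def spectralMeasure (A : H →ₗ.[ℂ] H) : ProjMeasure H :=
  if h : ∃ E : ProjMeasure H, E.integral (fun t => (t : ℂ)) Complex.measurable_ofReal = A
  then h.choose else ProjMeasure.diracZero

theorem measurable_cpow_ofReal (z : ℂ) : Measurable fun t : ℝ => (t : ℂ) ^ z :=
  Complex.measurable_ofReal.pow_const z

/-- The power `A^z = ∫ λ^z dE_A(λ)` of a self-adjoint operator `A`. Here `λ^z` is the principal
value: `λ^z = e^{z ln λ}` for `λ > 0` and `λ^z = e^{z (ln |λ| + iπ)}` for `λ < 0`,
moreover `0^0 = 1`. -/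
def opPow (A : H →ₗ.[ℂ] H) (z : ℂ) : H →ₗ.[ℂ] H :=
  (spectralMeasure A).integral (fun t => (t : ℂ) ^ z) (measurable_cpow_ofReal z)

/-- `|S| = (S^* S)^{1/2}`. -/
def absOp (S : H →ₗ.[ℂ] H) : H →ₗ.[ℂ] H := opPow (opMul S† S) (1 / 2)

/-- `U` is the partial isometry of the polar decomposition of `S`: `S = U |S|`,
`U` is isometric on `(ker U)ᗮ`, and `ker U = ker S`. -/
structure IsPolarFactor (S : H →ₗ.[ℂ] H) (U : H →L[ℂ] H) : Prop where
  mul_abs : opMul (ofCLM U) (absOp S) = S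
  isometric : ∀ f ∈ (LinearMap.ker (U : H →ₗ[ℂ] H))ᗮ, ‖U f‖ = ‖f‖
  ker_eq : ∀ f : H, U f = 0 ↔ ∃ h : f ∈ S.domain, S ⟨f, h⟩ = 0

open scoped Classical in
/-- The partial isometry `U_S` of the polar decomposition `S = U_S |S|` of a closed, densely
defined operator `S` (an arbitrary value is taken if there is no polar decomposition). -/
def polarFactor (S : H →ₗ.[ℂ] H) : H →L[ℂ] H :=
  if h : ∃ U : H →L[ℂ] H, IsPolarFactor S U then h.choose else 0

/-! ### The interpolated operators -/

/-- The product `T^{-z} S T^{-1+z}` on its maximal domain. -/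
def sandwichMax (S T : H →ₗ.[ℂ] H) (z : ℂ) : H →ₗ.[ℂ] H :=
  opMul (opPow T (-z)) (opMul S (opPow T (-1 + z)))

/-- The product `T^{-z} S T^{-1+z}` defined on `dom T`. -/
def sandwich (S T : H →ₗ.[ℂ] H) (z : ℂ) : H →ₗ.[ℂ] H :=
  (sandwichMax S T z).domRestrict T.domain

/-- The product `T^{-i Im z} [|S^*|^{Re z} P]^* U_S |S|^{1 - Re z} T^{-1 + Re z} T^{i Im z}`. -/
def factorized (S T P : H →ₗ.[ℂ] H) (z : ℂ) : H →ₗ.[ℂ] H :=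
  opMul (opPow T (-(Complex.I * z.im))) <|
  opMul (opMul (opPow (absOp S†) z.re) P)† <|
  opMul (ofCLM (polarFactor S)) <|
  opMul (opPow (absOp S) (1 - z.re)) <|
  opMul (opPow T (-1 + z.re)) (opPow T (Complex.I * z.im))

end

/-!
Let `R = T⁻¹`, `A = S T⁻¹` and `B = S* T⁻¹`, so that `R A = B* R`. The spectrum of `T` has a gap
around the origin, so `T ^ w` is bounded for `Re w ≤ 0`. If `T_n` is the part of `T` in the spectral
band `1 / (n + 1) ≤ |t| ≤ n + 1`, then `z ↦ T_n ^ (-z) A T_n ^ z` is entire. On `Re z = 0` its norm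
is at most `‖A‖ e ^ (π |Im z|)`; on `Re z = 1` it equals `T_n ^ (1 - z) B* T_n ^ (z - 1)`, of norm
at most `‖B‖ e ^ (π |Im z|)`. Multiplying by `e ^ (k (z² - z))` makes it bounded on the strip, and
the three lines theorem followed by `n → ∞` gives the first bound. The growth in `Im z` comes from
`arg t ≤ π`; for `T ≥ 0` one has `arg t = 0` and may let `k → 0`. The bound on the real axis is the
choice `k = π / √(x (1 - x))`.

The same interpolation shows that `T ^ (-x)` maps into the domain of `|S| ^ x` (Heinz), and
`U_S |S| ^ x ⊆ |S*| ^ x U_S` gives `S ⊆ |S*| ^ x U_S |S| ^ (1 - x)`; taking adjoints of the bounded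
operator `|S*| ^ x (T ^ (-x))*` yields the factorization. The spectral theorem for an unbounded
operator is deduced from the continuous functional calculus of a bounded resolvent.
-/

noncomputable section

variable {H : Type*} [NormedAddCommGroup H] [InnerProductSpace ℂ H]

section Graph

variable {R X Y : Type*} [Ring R] [AddCommGroup X] [Module R X] [AddCommGroup Y] [Module R Y]

theorem mem_graph_iff_exists {A : X →ₗ.[R] Y} {f : X} {h : Y} :
    (f, h) ∈ A.graph ↔ ∃ hf : f ∈ A.domain, A ⟨f, hf⟩ = h := by
  constructor
  · intro hfh
    obtain ⟨g, hg⟩ := A.mem_graph_iff'.mp hfh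
    obtain ⟨rfl, rfl⟩ := Prod.mk.inj hg
    exact ⟨g.2, rfl⟩
  · rintro ⟨hf, rfl⟩
    exact A.mem_graph ⟨f, hf⟩

theorem ext_graph {A B : X →ₗ.[R] Y} (hAB : ∀ f h, (f, h) ∈ A.graph ↔ (f, h) ∈ B.graph) : A = B :=
  LinearPMap.eq_of_eq_graph (Submodule.ext fun ⟨f, h⟩ => hAB f h)

end Graph

theorem mem_graph_ofCLM {B : H →L[ℂ] H} {f h : H} : (f, h) ∈ (ofCLM B).graph ↔ B f = h :=
  mem_graph_iff_exists.trans ⟨fun ⟨_, hf⟩ => hf, fun hf => ⟨trivial, hf⟩⟩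

theorem mem_graph_opMul {A B : H →ₗ.[ℂ] H} {f h : H} :
    (f, h) ∈ (opMul A B).graph ↔ ∃ k, (f, k) ∈ B.graph ∧ (k, h) ∈ A.graph := by
  simp only [mem_graph_iff_exists]
  constructor
  · rintro ⟨⟨hf, hBf⟩, hh⟩
    exact ⟨B ⟨f, hf⟩, ⟨hf, rfl⟩, hBf, hh⟩
  · rintro ⟨_, ⟨hf, rfl⟩, hBf, hh⟩
    exact ⟨⟨hf, hBf⟩, hh⟩

theorem inner_self_apply_ext {A B : H →L[ℂ] H} (h : ∀ f, inner ℂ f (A f) = inner ℂ f (B f)) :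
    A = B := by
  have hlin : (A : H →ₗ[ℂ] H) = B := by
    rw [← ext_inner_map]
    intro f
    rw [← inner_conj_symm, ContinuousLinearMap.coe_coe, h f, inner_conj_symm,
      ContinuousLinearMap.coe_coe]
  ext f
  exact congr($hlin f)

theorem opMul_ofCLM (A B : H →L[ℂ] H) : opMul (ofCLM A) (ofCLM B) = ofCLM (A * B) :=
  ext_graph fun f h => by
    simp only [mem_graph_opMul, mem_graph_ofCLM, exists_eq_left', mul_apply_eq_comp]

theorem opMul_assoc (A B C : H →ₗ.[ℂ] H) : opMul A (opMul B C) = opMul (opMul A B) C :=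
  ext_graph fun f h => by
    simp only [mem_graph_opMul]
    exact ⟨fun ⟨k, ⟨l, hl, hk⟩, hh⟩ => ⟨l, hl, k, hk, hh⟩,
      fun ⟨l, hl, k, hk, hh⟩ => ⟨k, ⟨l, hl, hk⟩, hh⟩⟩

theorem isClosed_ofCLM (K : H →L[ℂ] H) : (ofCLM K).IsClosed := by
  have hgraph : ((ofCLM K).graph : Set (H × H)) = {p | K p.1 = p.2} :=
    Set.ext fun _ => mem_graph_ofCLM
  change IsClosed ((ofCLM K).graph : Set (H × H))
  rw [hgraph]
  exact isClosed_eq (by fun_prop) continuous_snd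

theorem mem_graph_of_opMul_ofCLM {A : H →ₗ.[ℂ] H} {V W : H →L[ℂ] H}
    (h : opMul A (ofCLM V) = ofCLM W) (f : H) : (V f, W f) ∈ A.graph := by
  have hf : (f, W f) ∈ (opMul A (ofCLM V)).graph := by rw [h, mem_graph_ofCLM]
  obtain ⟨k, hk, hkf⟩ := mem_graph_opMul.mp hf
  rwa [mem_graph_ofCLM.mp hk]

theorem mem_graph_iff_of_inverse {T : H →ₗ.[ℂ] H} (hker : LinearMap.ker T.toFun = ⊥)
    {R : H →L[ℂ] H} (hR : T.inverse = ofCLM R) (f h : H) : (f, h) ∈ T.graph ↔ R h = f := by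
  rw [← mem_graph_ofCLM, ← hR, LinearPMap.inverse_graph hker, Submodule.mem_map]
  refine ⟨fun hp => ⟨(f, h), hp, rfl⟩, ?_⟩
  rintro ⟨⟨a, b⟩, hp, hab⟩
  obtain ⟨rfl, rfl⟩ := Prod.mk.inj hab
  exact hp

section Closure

variable {D : H →ₗ.[ℂ] H} {M : Submodule ℂ H} {K : H →L[ℂ] H}
  (hK : ∀ f ∈ M, (f, K f) ∈ D.graph)
include hK

theorem domRestrict_le_ofCLM : D.domRestrict M ≤ ofCLM K :=
  LinearPMap.le_of_le_graph fun ⟨f, h⟩ hfh => by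
    have hf : f ∈ M := (LinearPMap.mem_domain_of_mem_graph hfh).1
    exact mem_graph_ofCLM.mpr <| D.mem_graph_snd_inj (hK f hf)
      (LinearPMap.le_graph_of_le LinearPMap.domRestrict_le hfh) rfl

theorem isClosable_domRestrict : (D.domRestrict M).IsClosable :=
  (isClosed_ofCLM K).isClosable.leIsClosable (domRestrict_le_ofCLM hK)

theorem closure_domRestrict (hM : Dense (M : Set H)) : (D.domRestrict M).closure = ofCLM K := by
  refine LinearPMap.eq_of_eq_graph ?_
  rw [← (isClosable_domRestrict hK).graph_closure_eq_closure_graph]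
  refine le_antisymm (Submodule.topologicalClosure_minimal _
    (LinearPMap.le_graph_of_le (domRestrict_le_ofCLM hK)) (isClosed_ofCLM K)) ?_
  rintro ⟨f, h⟩ hfh
  obtain rfl := mem_graph_ofCLM.mp hfh
  obtain ⟨u, hu, hlim⟩ := mem_closure_iff_seq_limit.mp (hM f)
  refine mem_closure_of_tendsto (hlim.prodMk_nhds ((K.continuous.tendsto f).comp hlim))
    (.of_forall fun n => ?_)
  obtain ⟨hdom, happ⟩ := mem_graph_iff_exists.mp (hK _ (hu n))
  exact mem_graph_iff_exists.mpr ⟨⟨hu n, hdom⟩, happ⟩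

end Closure

variable [CompleteSpace H]

theorem mem_graph_adjoint_iff {A : H →ₗ.[ℂ] H} (hA : Dense (A.domain : Set H)) {u w : H} :
    (u, w) ∈ A†.graph ↔ ∀ x : A.domain, inner ℂ w (x : H) = inner ℂ u (A x) := by
  rw [mem_graph_iff_exists]
  constructor
  · rintro ⟨hu, rfl⟩ x
    exact LinearPMap.adjoint_isFormalAdjoint hA ⟨u, hu⟩ x
  · intro h
    have hu : u ∈ A†.domain := LinearPMap.mem_adjoint_domain_of_exists _ ⟨w, h⟩
    exact ⟨hu, LinearPMap.adjoint_apply_eq hA ⟨u, hu⟩ h⟩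

/-- `B A ⊆ A' B`, for a bounded operator `B`. -/
def Intertwines (B : H →L[ℂ] H) (A A' : H →ₗ.[ℂ] H) : Prop :=
  ∀ f h, (f, h) ∈ A.graph → (B f, B h) ∈ A'.graph

theorem Intertwines.adjoint {B : H →L[ℂ] H} {A A' : H →ₗ.[ℂ] H} (h : Intertwines B A A')
    (hA : Dense (A.domain : Set H)) (hA' : Dense (A'.domain : Set H)) :
    Intertwines (ContinuousLinearMap.adjoint B) A'† A† := by
  intro u w huw
  rw [mem_graph_adjoint_iff hA'] at huw
  rw [mem_graph_adjoint_iff hA]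
  intro x
  obtain ⟨hBx, hAx⟩ := mem_graph_iff_exists.mp (h _ _ (A.mem_graph x))
  rw [ContinuousLinearMap.adjoint_inner_left, ContinuousLinearMap.adjoint_inner_left, ← hAx,
    huw ⟨B x, hBx⟩]

section Lp

variable {α F : Type*} {mα : MeasurableSpace α} {μ : Measure α} [NormedAddCommGroup F]

theorem eLpNorm_two_sq (g : α → F) : eLpNorm g 2 μ ^ 2 = ∫⁻ t, ‖g t‖ₑ ^ 2 ∂μ := by
  simpa using eLpNorm_nnreal_pow_eq_lintegral (f := g) (μ := μ) two_ne_zero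

theorem tendsto_eLpNorm_of_tendsto_eLpNorm_sub {ι : Type*} {l : Filter ι} {p : ℝ≥0∞}
    [Fact (1 ≤ p)] {u : ι → α → F} {v : α → F} (hu : ∀ i, MemLp (u i) p μ) (hv : MemLp v p μ)
    (h : Tendsto (fun i => eLpNorm (u i - v) p μ) l (𝓝 0)) :
    Tendsto (fun i => eLpNorm (u i) p μ) l (𝓝 (eLpNorm v p μ)) := by
  simpa only [Lp.enorm_toLp] using
    ((Lp.tendsto_Lp_iff_tendsto_eLpNorm'' u hu v hv).mpr h).enorm

theorem tendsto_integral_of_tendsto_eLpNorm_sub [NormedSpace ℝ F] [IsFiniteMeasure μ] {ι : Type*}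
    {l : Filter ι} {p : ℝ≥0∞} (hp : 1 ≤ p) {u : ι → α → F} {v : α → F}
    (hu : ∀ i, MemLp (u i) p μ) (hv : MemLp v p μ)
    (h : Tendsto (fun i => eLpNorm (u i - v) p μ) l (𝓝 0)) :
    Tendsto (fun i => ∫ t, u i t ∂μ) l (𝓝 (∫ t, v t ∂μ)) := by
  refine tendsto_integral_of_L1' _ hv.1 (.of_forall fun i => (hu i).integrable hp) ?_
  have hC : μ Set.univ ^ (1 / (1 : ℝ≥0∞).toReal - 1 / p.toReal) ≠ ∞ := by
    have hp' : p.toReal⁻¹ ≤ 1 := by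
      simpa using ENNReal.toReal_mono ENNReal.one_ne_top (ENNReal.inv_le_one.mpr hp)
    exact ENNReal.rpow_ne_top_of_nonneg (by simpa using hp') (measure_ne_top _ _)
  refine tendsto_of_tendsto_of_tendsto_of_le_of_le tendsto_const_nhds
    (by simpa using ENNReal.Tendsto.mul_const h (Or.inr hC)) (fun _ => zero_le) fun i =>
    eLpNorm_le_eLpNorm_mul_rpow_measure_univ hp ((hu i).1.sub hv.1)

theorem tendsto_eLpNorm_two_sub_of_dominated {u : ℕ → α → F} {v G : α → F}
    (hu : ∀ n, AEStronglyMeasurable (u n) μ) (hG : MemLp G 2 μ)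
    (hle : ∀ n, ∀ᵐ t ∂μ, ‖u n t‖ ≤ ‖G t‖)
    (hlim : ∀ᵐ t ∂μ, Tendsto (fun n => u n t) atTop (𝓝 (v t))) :
    Tendsto (fun n => eLpNorm (u n - v) 2 μ) atTop (𝓝 0) := by
  have hv : AEStronglyMeasurable v μ := aestronglyMeasurable_of_tendsto_ae _ hu hlim
  have hv_le : ∀ᵐ t ∂μ, ‖v t‖ ≤ ‖G t‖ := by
    filter_upwards [hlim, ae_all_iff.mpr hle] with t ht hGt
    exact le_of_tendsto ht.norm (.of_forall hGt)
  have hsq : Tendsto (fun n => eLpNorm (u n - v) 2 μ ^ 2) atTop (𝓝 0) := by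
    simp only [eLpNorm_two_sq]
    rw [← lintegral_zero (μ := μ)]
    refine tendsto_lintegral_of_dominated_convergence' (fun t => (‖G t‖ₑ + ‖G t‖ₑ) ^ 2)
      (fun n => ((hu n).sub hv).enorm.pow_const 2) (fun n => ?_) ?_ ?_
    · filter_upwards [hle n, hv_le] with t hut hvt
      gcongr
      exact enorm_sub_le.trans
        (add_le_add (enorm_le_iff_norm_le.mpr hut) (enorm_le_iff_norm_le.mpr hvt))
    · simp only [← two_mul, mul_pow]
      rw [lintegral_const_mul' _ _ (by simp), ← eLpNorm_two_sq]
      exact ENNReal.mul_ne_top (by simp) (ENNReal.pow_ne_top hG.2.ne)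
    · filter_upwards [hlim] with t ht
      have := (ENNReal.continuous_pow 2).tendsto _ |>.comp (ht.sub_const (v t)).enorm
      simpa [Function.comp_def] using this
  have hsqrt (x : ℝ≥0∞) : (x ^ 2) ^ (2⁻¹ : ℝ) = x :=
    mod_cast ENNReal.pow_rpow_inv_natCast two_ne_zero x
  simpa [hsqrt] using hsq.ennrpow_const (2⁻¹ : ℝ)

end Lp

/-- A bounded Borel function on the line, i.e. one whose spectral integrals are bounded. -/
structure IsBoundedBorel (g : ℝ → ℂ) : Prop where
  measurable : Measurable g
  exists_norm_le : ∃ C, ∀ t, ‖g t‖ ≤ C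

theorem measurable_conj {g : ℝ → ℂ} (hg : Measurable g) :
    Measurable fun t => starRingEnd ℂ (g t) :=
  Complex.continuous_conj.measurable.comp hg

theorem measurableSet_norm_le {g : ℝ → ℂ} (hg : Measurable g) (C : ℝ) :
    MeasurableSet {t | ‖g t‖ ≤ C} :=
  measurableSet_le hg.norm measurable_const

namespace IsBoundedBorel

variable {g h : ℝ → ℂ}

theorem const (c : ℂ) : IsBoundedBorel fun _ => c := ⟨measurable_const, ‖c‖, fun _ => le_rfl⟩

theorem mul (hg : IsBoundedBorel g) (hh : IsBoundedBorel h) : IsBoundedBorel (g * h) := by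
  obtain ⟨hg, C, hC⟩ := hg
  obtain ⟨hh, D, hD⟩ := hh
  exact ⟨hg.mul hh, C * D, fun t => norm_mul_le_of_le (hC t) (hD t)⟩

theorem add (hg : IsBoundedBorel g) (hh : IsBoundedBorel h) : IsBoundedBorel (g + h) := by
  obtain ⟨hg, C, hC⟩ := hg
  obtain ⟨hh, D, hD⟩ := hh
  exact ⟨hg.add hh, C + D, fun t => norm_add_le_of_le (hC t) (hD t)⟩

theorem conj (hg : IsBoundedBorel g) : IsBoundedBorel fun t => starRingEnd ℂ (g t) := by
  obtain ⟨hg, C, hC⟩ := hg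
  exact ⟨measurable_conj hg, C, fun t => by simpa using hC t⟩

theorem indicator_of_le (hg : Measurable g) {s : Set ℝ} (hs : MeasurableSet s) {C : ℝ}
    (hC : ∀ t ∈ s, ‖g t‖ ≤ C) : IsBoundedBorel (s.indicator g) := by
  refine ⟨hg.indicator hs, |C|, fun t => ?_⟩
  by_cases ht : t ∈ s
  · simpa [ht] using (hC t ht).trans (le_abs_self C)
  · simp [ht]

theorem indicator_one {s : Set ℝ} (hs : MeasurableSet s) : IsBoundedBorel (s.indicator 1) :=
  indicator_of_le (C := 1) measurable_one hs fun t _ => by simp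

theorem indicator_norm_le (hg : Measurable g) (C : ℝ) :
    IsBoundedBorel ({t | ‖g t‖ ≤ C}.indicator g) :=
  indicator_of_le hg (measurableSet_norm_le hg C) fun _ ht => ht

theorem memLp (hg : IsBoundedBorel g) (μ : Measure ℝ) [IsFiniteMeasure μ] : MemLp g 2 μ := by
  obtain ⟨hg, C, hC⟩ := hg
  exact MemLp.of_bound hg.aestronglyMeasurable C (.of_forall hC)

theorem memLp_mul (hg : IsBoundedBorel g) {μ : Measure ℝ} (hh : MemLp h 2 μ) :
    MemLp (g * h) 2 μ := by
  obtain ⟨hg, C, hC⟩ := hg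
  exact hh.of_le_mul (hg.aestronglyMeasurable.mul hh.1)
    (.of_forall fun t => norm_mul_le_of_le (hC t) le_rfl)

theorem tendsto_eLpNorm_mul (hg : IsBoundedBorel g) {μ : Measure ℝ} {u : ℕ → ℝ → ℂ}
    (hu : Tendsto (fun n => eLpNorm (u n) 2 μ) atTop (𝓝 0)) :
    Tendsto (fun n => eLpNorm (g * u n) 2 μ) atTop (𝓝 0) := by
  obtain ⟨C, hC⟩ := hg.exists_norm_le
  refine tendsto_of_tendsto_of_tendsto_of_le_of_le tendsto_const_nhds
    (by simpa using ENNReal.Tendsto.const_mul hu (Or.inr (ENNReal.ofReal_ne_top (r := C))))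
    (fun _ => zero_le) fun n => ?_
  exact eLpNorm_le_mul_eLpNorm_of_ae_le_mul
    (.of_forall fun t => norm_mul_le_of_le (hC t) le_rfl) 2

end IsBoundedBorel

theorem simpleFunc_isBoundedBorel (φ : SimpleFunc ℝ ℂ) : IsBoundedBorel φ :=
  ⟨φ.measurable, φ.exists_forall_norm_le⟩

theorem simpleFunc_memLp (φ : SimpleFunc ℝ ℂ) (μ : Measure ℝ) [IsFiniteMeasure μ] :
    MemLp φ 2 μ :=
  (simpleFunc_isBoundedBorel φ).memLp μ

namespace ProjMeasure

variable (E : ProjMeasure H)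

/-! ### Spectral integrals -/

theorem enorm_simple (φ : SimpleFunc ℝ ℂ) (f : H) :
    ‖E.simple φ f‖ₑ = eLpNorm φ 2 (E.scalar f) := by
  rw [← E.norm_simple, ofReal_norm]

theorem simple_add (φ ψ : SimpleFunc ℝ ℂ) : E.simple (φ + ψ) = E.simple φ + E.simple ψ := by
  ext f
  rw [add_apply]
  simp only [simple_apply]
  exact SimpleFunc.setToSimpleFunc_add _ (E.setFun_additive f)
    (SimpleFunc.integrable_of_isFiniteMeasure _) (SimpleFunc.integrable_of_isFiniteMeasure _)

theorem simple_piecewise {s : Set ℝ} (hs : MeasurableSet s) (c : ℂ) :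
    E.simple (SimpleFunc.piecewise s hs (SimpleFunc.const ℝ c) (SimpleFunc.const ℝ 0))
      = c • E.proj s := by
  ext f
  rw [simple_apply, SimpleFunc.setToSimpleFunc_indicator]
  · simp [setFun, E.vec_apply f hs]
  · ext; simp [setFun]

theorem tendsto_eLpNorm_approx {g : ℝ → ℂ} (hg : Measurable g) {μ : Measure ℝ}
    (hf : MemLp g 2 μ) :
    Tendsto (fun n => eLpNorm (⇑(approx g hg n) - g) 2 μ) atTop (𝓝 0) :=
  SimpleFunc.tendsto_approxOn_Lp_eLpNorm hg (Set.mem_univ _) (by norm_num) (by simp)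
    (by simpa using hf.2)

/-- The value of the spectral integral `∫ g dE` at `f`; for `g ∉ L²(‖E f‖²)` it is a junk value. -/
def integralAt (g : ℝ → ℂ) (hg : Measurable g) (f : H) : H :=
  limUnder atTop fun n => E.simple (approx g hg n) f

theorem mem_graph_integral {g : ℝ → ℂ} {hg : Measurable g} {f h : H} :
    (f, h) ∈ (E.integral g hg).graph ↔ MemLp g 2 (E.scalar f) ∧ E.integralAt g hg f = h :=
  mem_graph_iff_exists.trans ⟨fun ⟨hf, hh⟩ => ⟨hf, hh⟩, fun ⟨hf, hh⟩ => ⟨hf, hh⟩⟩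

section IntegralAt

variable {g h : ℝ → ℂ} (hg : Measurable g) (hh : Measurable h) {f : H}

theorem tendsto_simple_approx (hgf : MemLp g 2 (E.scalar f)) :
    Tendsto (fun n => E.simple (approx g hg n) f) atTop (𝓝 (E.integralAt g hg f)) :=
  E.tendsto_approx hg hgf

theorem enorm_simple_sub_integralAt (φ : SimpleFunc ℝ ℂ) (hgf : MemLp g 2 (E.scalar f)) :
    ‖E.simple φ f - E.integralAt g hg f‖ₑ = eLpNorm (⇑φ - g) 2 (E.scalar f) := by
  have hφ (ψ : SimpleFunc ℝ ℂ) := simpleFunc_memLp ψ (E.scalar f)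
  have h1 : Tendsto (fun n => ‖E.simple φ f - E.simple (approx g hg n) f‖ₑ) atTop
      (𝓝 ‖E.simple φ f - E.integralAt g hg f‖ₑ) :=
    (tendsto_const_nhds.sub (E.tendsto_simple_approx hg hgf)).enorm
  refine tendsto_nhds_unique h1 ?_
  simp only [← simple_sub, enorm_simple, SimpleFunc.coe_sub]
  refine tendsto_eLpNorm_of_tendsto_eLpNorm_sub (fun n => (hφ φ).sub (hφ _)) ((hφ φ).sub hgf) ?_
  refine (tendsto_eLpNorm_approx hg hgf).congr fun n => ?_
  rw [sub_sub_sub_cancel_left, eLpNorm_sub_comm]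

theorem enorm_integralAt_sub (hgf : MemLp g 2 (E.scalar f)) (hhf : MemLp h 2 (E.scalar f)) :
    ‖E.integralAt g hg f - E.integralAt h hh f‖ₑ = eLpNorm (g - h) 2 (E.scalar f) := by
  have hφ (ψ : SimpleFunc ℝ ℂ) := simpleFunc_memLp ψ (E.scalar f)
  refine tendsto_nhds_unique ((E.tendsto_simple_approx hg hgf).sub_const _).enorm ?_
  simp only [E.enorm_simple_sub_integralAt hh _ hhf]
  refine tendsto_eLpNorm_of_tendsto_eLpNorm_sub (fun n => (hφ _).sub hhf) (hgf.sub hhf) ?_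
  simpa only [sub_sub_sub_cancel_right] using tendsto_eLpNorm_approx hg hgf

theorem tendsto_simple {φ : ℕ → SimpleFunc ℝ ℂ} (hgf : MemLp g 2 (E.scalar f))
    (hφ : Tendsto (fun n => eLpNorm (⇑(φ n) - g) 2 (E.scalar f)) atTop (𝓝 0)) :
    Tendsto (fun n => E.simple (φ n) f) atTop (𝓝 (E.integralAt g hg f)) := by
  simpa only [tendsto_iff_edist_tendsto_0, edist_eq_enorm_sub,
    E.enorm_simple_sub_integralAt hg _ hgf]

theorem integralAt_simpleFunc (φ : SimpleFunc ℝ ℂ) :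
    E.integralAt φ φ.measurable f = E.simple φ f := by
  rw [← sub_eq_zero, ← enorm_eq_zero, enorm_sub_rev,
    E.enorm_simple_sub_integralAt _ _ (simpleFunc_memLp φ _), sub_self, eLpNorm_zero]

theorem enorm_integralAt (hgf : MemLp g 2 (E.scalar f)) :
    ‖E.integralAt g hg f‖ₑ = eLpNorm g 2 (E.scalar f) := by
  have h0 : E.simple 0 = 0 := by
    simpa using E.simple_piecewise MeasurableSet.univ 0
  simpa [h0, eLpNorm_neg] using E.enorm_simple_sub_integralAt hg 0 hgf

variable {hg hh} in
theorem integralAt_congr (hgh : g =ᵐ[E.scalar f] h) (hgf : MemLp g 2 (E.scalar f)) :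
    E.integralAt g hg f = E.integralAt h hh f := by
  rw [← sub_eq_zero, ← enorm_eq_zero, E.enorm_integralAt_sub hg hh hgf (hgf.ae_eq hgh),
    eLpNorm_congr_ae hgh.sub_eq, eLpNorm_zero]

theorem integralAt_add (hgf : MemLp g 2 (E.scalar f)) (hhf : MemLp h 2 (E.scalar f)) :
    E.integralAt (g + h) (hg.add hh) f = E.integralAt g hg f + E.integralAt h hh f := by
  have hsum : Tendsto (fun n => E.simple (approx g hg n + approx h hh n) f) atTop
      (𝓝 (E.integralAt (g + h) (hg.add hh) f)) := by
    refine E.tendsto_simple _ (hgf.add hhf) ?_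
    refine tendsto_of_tendsto_of_tendsto_of_le_of_le tendsto_const_nhds
      (by simpa using (tendsto_eLpNorm_approx hg hgf).add (tendsto_eLpNorm_approx hh hhf))
      (fun _ => zero_le) fun n => ?_
    rw [SimpleFunc.coe_add, add_sub_add_comm]
    exact eLpNorm_add_le ((SimpleFunc.aestronglyMeasurable _).sub hgf.1)
      ((SimpleFunc.aestronglyMeasurable _).sub hhf.1) one_le_two
  refine tendsto_nhds_unique hsum ?_
  simp only [simple_add, add_apply]
  exact (E.tendsto_simple_approx hg hgf).add (E.tendsto_simple_approx hh hhf)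

end IntegralAt

/-! ### Multiplicativity of the spectral integral -/

theorem proj_union {s t : Set ℝ} (hs : MeasurableSet s) (ht : MeasurableSet t)
    (hd : Disjoint s t) : E.proj (s ∪ t) = E.proj s + E.proj t := by
  ext f
  simpa [E.vec_apply f hs, E.vec_apply f ht, E.vec_apply f (hs.union ht)] using
    VectorMeasure.of_union (v := E.vec f) hd hs ht

theorem adjoint_proj {s : Set ℝ} (hs : MeasurableSet s) :
    ContinuousLinearMap.adjoint (E.proj s) = E.proj s :=
  (E.isStarProjection s hs).isSelfAdjoint

theorem proj_mul_of_disjoint {s t : Set ℝ} (hs : MeasurableSet s) (ht : MeasurableSet t)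
    (hd : Disjoint s t) : E.proj s * E.proj t = 0 := by
  have h : ((E.proj s * E.proj t : H →L[ℂ] H) : H →ₗ[ℂ] H) = 0 := by
    rw [← inner_map_self_eq_zero]
    intro f
    rw [← E.inner_proj_of_disjoint f ht hs hd.symm]
    change inner ℂ (E.proj s (E.proj t f)) f = _
    rw [← ContinuousLinearMap.adjoint_inner_right, E.adjoint_proj hs]
  ext f
  exact LinearMap.congr_fun h f

theorem proj_mul {s t : Set ℝ} (hs : MeasurableSet s) (ht : MeasurableSet t) :
    E.proj s * E.proj t = E.proj (s ∩ t) := by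
  have hst : E.proj s = E.proj (s ∩ t) + E.proj (s \ t) := by
    rw [← E.proj_union (hs.inter ht) (hs.diff ht) Set.disjoint_sdiff_inter.symm,
      Set.inter_union_sdiff]
  have hts : E.proj t = E.proj (s ∩ t) + E.proj (t \ s) := by
    rw [Set.inter_comm, ← E.proj_union (ht.inter hs) (ht.diff hs) Set.disjoint_sdiff_inter.symm,
      Set.inter_union_sdiff]
  rw [hst, hts, add_mul, mul_add, mul_add,
    (E.isStarProjection _ (hs.inter ht)).isIdempotentElem.eq,
    E.proj_mul_of_disjoint (hs.inter ht) (ht.diff hs)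
      (Set.disjoint_left.mpr fun _ hx hx' => hx'.2 hx.1),
    E.proj_mul_of_disjoint (hs.diff ht) (hs.inter ht)
      (Set.disjoint_left.mpr fun _ hx hx' => hx.2 hx'.2),
    E.proj_mul_of_disjoint (hs.diff ht) (ht.diff hs)
      (Set.disjoint_left.mpr fun _ hx hx' => hx.2 hx'.1)]
  simp only [add_zero]

theorem simple_mul (φ ψ : SimpleFunc ℝ ℂ) : E.simple (φ * ψ) = E.simple φ * E.simple ψ := by
  induction φ using SimpleFunc.induction with
  | @const c s hs =>
    induction ψ using SimpleFunc.induction with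
    | @const d t ht =>
      have hprod : (SimpleFunc.piecewise s hs (SimpleFunc.const ℝ c) (SimpleFunc.const ℝ 0)
          * SimpleFunc.piecewise t ht (SimpleFunc.const ℝ d) (SimpleFunc.const ℝ 0))
          = SimpleFunc.piecewise (s ∩ t) (hs.inter ht) (SimpleFunc.const ℝ (c * d))
            (SimpleFunc.const ℝ 0) := by
        ext x
        by_cases hxs : x ∈ s <;> by_cases hxt : x ∈ t <;> simp [hxs, hxt]
      simp only [hprod, simple_piecewise]
      rw [smul_mul_smul_comm, E.proj_mul hs ht]
    | add _ hψ hψ' => rw [mul_add, simple_add, hψ, hψ', simple_add, mul_add]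
  | add _ hφ hφ' => rw [add_mul, simple_add, hφ, hφ', simple_add, add_mul]

theorem inner_simple_left (φ : SimpleFunc ℝ ℂ) (f u : H) :
    inner ℂ (E.simple φ f) u = inner ℂ f (E.simple (φ.map (starRingEnd ℂ)) u) := by
  induction φ using SimpleFunc.induction with
  | @const c s hs =>
    have hconj : (SimpleFunc.piecewise s hs (SimpleFunc.const ℝ c) (SimpleFunc.const ℝ 0)).map
        (starRingEnd ℂ) = SimpleFunc.piecewise s hs (SimpleFunc.const ℝ (starRingEnd ℂ c))
          (SimpleFunc.const ℝ 0) := by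
      ext x
      by_cases hx : x ∈ s <;> simp [hx]
    rw [hconj, simple_piecewise, simple_piecewise, smul_apply, smul_apply, inner_smul_left,
      inner_smul_right, ← ContinuousLinearMap.adjoint_inner_right, E.adjoint_proj hs]
  | @add φ ψ _ hφ hψ =>
    have hconj : (φ + ψ).map (starRingEnd ℂ) = φ.map (starRingEnd ℂ) + ψ.map (starRingEnd ℂ) := by
      ext x; simp
    rw [hconj, simple_add, simple_add, add_apply, add_apply, inner_add_left, inner_add_right, hφ,
      hψ]

theorem inner_simple (φ : SimpleFunc ℝ ℂ) (f : H) :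
    inner ℂ f (E.simple φ f) = ∫ t, φ t ∂(E.scalar f) := by
  induction φ using SimpleFunc.induction with
  | @const c s hs =>
    have hcoe : ⇑(SimpleFunc.piecewise s hs (SimpleFunc.const ℝ c) (SimpleFunc.const ℝ 0))
        = s.indicator fun _ => c := by
      ext x
      by_cases hx : x ∈ s <;> simp [hx]
    rw [simple_piecewise, smul_apply, inner_smul_right, E.inner_proj f hs, hcoe,
      integral_indicator_const _ hs, measureReal_def, E.scalar_apply f hs,
      ENNReal.toReal_ofReal (by positivity), Complex.real_smul, mul_comm]
  | add _ hφ hψ =>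
    rw [simple_add, add_apply, inner_add_right, hφ, hψ]
    exact (integral_add (SimpleFunc.integrable_of_isFiniteMeasure _)
      (SimpleFunc.integrable_of_isFiniteMeasure _)).symm

section IntegralAt

variable {g h : ℝ → ℂ} (hg : Measurable g) {f : H}

theorem inner_integralAt (hgf : MemLp g 2 (E.scalar f)) :
    inner ℂ f (E.integralAt g hg f) = ∫ t, g t ∂(E.scalar f) := by
  refine tendsto_nhds_unique (tendsto_const_nhds.inner (E.tendsto_simple_approx hg hgf)) ?_
  simp only [inner_simple]
  exact tendsto_integral_of_tendsto_eLpNorm_sub one_le_two (fun n => simpleFunc_memLp _ _) hgf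
    (tendsto_eLpNorm_approx hg hgf)

theorem inner_integralAt_left {u : H} (hgf : MemLp g 2 (E.scalar f))
    (hgu : MemLp g 2 (E.scalar u)) :
    inner ℂ (E.integralAt g hg f) u
      = inner ℂ f (E.integralAt (fun t => starRingEnd ℂ (g t)) (measurable_conj hg) u) := by
  refine tendsto_nhds_unique ((E.tendsto_simple_approx hg hgf).inner tendsto_const_nhds) ?_
  simp only [inner_simple_left]
  refine tendsto_const_nhds.inner (E.tendsto_simple _ hgu.star ?_)
  refine (tendsto_eLpNorm_approx hg hgu).congr fun n => ?_
  refine eLpNorm_congr_norm_ae (.of_forall fun t => ?_)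
  simp [← map_sub]

theorem simple_integralAt (φ : SimpleFunc ℝ ℂ) (hgf : MemLp g 2 (E.scalar f)) :
    E.simple φ (E.integralAt g hg f) = E.integralAt (⇑φ * g) (φ.measurable.mul hg) f := by
  have hφ := simpleFunc_isBoundedBorel φ
  have hlim := ((E.simple φ).continuous.tendsto _).comp (E.tendsto_simple_approx hg hgf)
  refine tendsto_nhds_unique hlim ?_
  have hmul (n : ℕ) : (E.simple φ ∘ fun n => E.simple (approx g hg n) f) n
      = E.simple (φ * approx g hg n) f := by
    rw [simple_mul]; rfl
  refine Tendsto.congr (fun n => (hmul n).symm) (E.tendsto_simple _ (hφ.memLp_mul hgf) ?_)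
  simpa only [SimpleFunc.coe_mul, mul_sub] using
    hφ.tendsto_eLpNorm_mul (tendsto_eLpNorm_approx hg hgf)

theorem scalar_integralAt (hgf : MemLp g 2 (E.scalar f)) :
    E.scalar (E.integralAt g hg f) = (E.scalar f).withDensity fun t => ‖g t‖ₑ ^ 2 := by
  refine Measure.ext fun s hs => ?_
  have hproj := E.simple_piecewise hs 1
  rw [one_smul] at hproj
  rw [E.scalar_apply _ hs, ENNReal.ofReal_pow (norm_nonneg _), ofReal_norm, ← hproj,
    E.simple_integralAt hg _ hgf,
    E.enorm_integralAt _ ((simpleFunc_isBoundedBorel _).memLp_mul hgf), eLpNorm_two_sq,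
    withDensity_apply _ hs, ← lintegral_indicator hs]
  refine lintegral_congr fun t => ?_
  by_cases ht : t ∈ s <;> simp [ht]

theorem eLpNorm_scalar_integralAt {hg : Measurable g} (hh : Measurable h)
    (hgf : MemLp g 2 (E.scalar f)) :
    eLpNorm h 2 (E.scalar (E.integralAt g hg f)) = eLpNorm (h * g) 2 (E.scalar f) := by
  refine (ENNReal.pow_right_strictMono two_ne_zero).injective ?_
  simp only [eLpNorm_two_sq, E.scalar_integralAt hg hgf]
  rw [lintegral_withDensity_eq_lintegral_mul _ (hg.enorm.pow_const 2) (hh.enorm.pow_const 2)]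
  refine lintegral_congr fun t => ?_
  simp [enorm_mul, mul_pow, mul_comm]

theorem memLp_scalar_integralAt {hg : Measurable g} (hh : Measurable h)
    (hgf : MemLp g 2 (E.scalar f)) :
    MemLp h 2 (E.scalar (E.integralAt g hg f)) ↔ MemLp (h * g) 2 (E.scalar f) := by
  simp only [MemLp, E.eLpNorm_scalar_integralAt hh hgf, hh.aestronglyMeasurable,
    (hh.mul hg).aestronglyMeasurable]

theorem integralAt_integralAt {hg : Measurable g} (hh : Measurable h)
    (hgf : MemLp g 2 (E.scalar f)) (hhf : MemLp (h * g) 2 (E.scalar f)) :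
    E.integralAt h hh (E.integralAt g hg f) = E.integralAt (h * g) (hh.mul hg) f := by
  have hhgf := (E.memLp_scalar_integralAt (hg := hg) hh hgf).mpr hhf
  refine tendsto_nhds_unique (E.tendsto_simple_approx hh hhgf) ?_
  rw [tendsto_iff_edist_tendsto_0]
  refine (tendsto_eLpNorm_approx hh hhgf).congr fun n => ?_
  have hφ := simpleFunc_isBoundedBorel (approx h hh n)
  rw [edist_eq_enorm_sub, E.simple_integralAt hg _ hgf,
    E.enorm_integralAt_sub _ _ (hφ.memLp_mul hgf) hhf, ← sub_mul,
    E.eLpNorm_scalar_integralAt (hφ.measurable.sub hh) hgf]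

end IntegralAt


/-! ### Bounded spectral integrals -/

theorem integral_congr {g h : ℝ → ℂ} {hg : Measurable g} {hh : Measurable h}
    (hgh : ∀ f, g =ᵐ[E.scalar f] h) : E.integral g hg = E.integral h hh := by
  refine ext_graph fun f k => ?_
  rw [mem_graph_integral, mem_graph_integral, memLp_congr_ae (hgh f)]
  exact and_congr_right fun hf => by rw [E.integralAt_congr (hgh f).symm hf]

theorem scalar_eq_zero_iff {f : H} {s : Set ℝ} (hs : MeasurableSet s) :
    E.scalar f s = 0 ↔ E.proj s f = 0 := by
  rw [E.scalar_apply f hs, ENNReal.ofReal_eq_zero, sq_nonpos_iff, norm_eq_zero]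

theorem scalar_univ (f : H) : E.scalar f Set.univ = ENNReal.ofReal (‖f‖ ^ 2) := by
  rw [E.scalar_apply f MeasurableSet.univ, E.proj_univ, one_apply_eq_self]

theorem norm_integralAt_le {g : ℝ → ℂ} (hg : Measurable g) {f : H} {C : ℝ} (hC0 : 0 ≤ C)
    (hC : ∀ᵐ t ∂(E.scalar f), ‖g t‖ ≤ C) : ‖E.integralAt g hg f‖ ≤ C * ‖f‖ := by
  have huniv : E.scalar f Set.univ ^ (2⁻¹ : ℝ) = ENNReal.ofReal ‖f‖ := by
    rw [E.scalar_univ, ENNReal.ofReal_pow (norm_nonneg f), ← ENNReal.rpow_natCast]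
    exact ENNReal.rpow_rpow_inv two_ne_zero _
  rw [← ENNReal.ofReal_le_ofReal_iff (by positivity), ofReal_norm,
    E.enorm_integralAt _ (.of_bound hg.aestronglyMeasurable C hC), mul_comm,
    ENNReal.ofReal_mul (norm_nonneg _), ← huniv]
  simpa using eLpNorm_le_of_ae_bound (p := 2) hC

open scoped Classical in
/-- The bounded operator `∫ g dE` for a bounded Borel function `g`, and `0` for any other `g`. -/
def op (g : ℝ → ℂ) : H →L[ℂ] H :=
  if h : IsBoundedBorel g then
    LinearMap.mkContinuousOfExistsBound
      { toFun := E.integralAt g h.measurable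
        map_add' := fun f f' => (E.integral g h.measurable).map_add
          ⟨f, h.memLp _⟩ ⟨f', h.memLp _⟩
        map_smul' := fun c f => (E.integral g h.measurable).map_smul c ⟨f, h.memLp _⟩ }
      (by
        obtain ⟨C, hC⟩ := h.exists_norm_le
        exact ⟨C, fun f => E.norm_integralAt_le h.measurable ((norm_nonneg _).trans (hC 0))
          (.of_forall hC)⟩)
  else 0

variable {E}

section Op

variable {g h : ℝ → ℂ} {f : H}

theorem op_apply (hg : IsBoundedBorel g) (f : H) : E.op g f = E.integralAt g hg.measurable f := by
  rw [op, dif_pos hg]; rfl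

theorem enorm_op (hg : IsBoundedBorel g) (f : H) : ‖E.op g f‖ₑ = eLpNorm g 2 (E.scalar f) := by
  rw [op_apply hg, E.enorm_integralAt _ (hg.memLp _)]

theorem norm_op_apply_le (hg : IsBoundedBorel g) {C : ℝ} (hC0 : 0 ≤ C)
    (hC : ∀ᵐ t ∂(E.scalar f), ‖g t‖ ≤ C) : ‖E.op g f‖ ≤ C * ‖f‖ := by
  rw [op_apply hg]
  exact E.norm_integralAt_le hg.measurable hC0 hC

theorem norm_op_le (hg : IsBoundedBorel g) {C : ℝ} (hC0 : 0 ≤ C)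
    (hC : ∀ f, ∀ᵐ t ∂(E.scalar f), ‖g t‖ ≤ C) : ‖E.op g‖ ≤ C :=
  ContinuousLinearMap.opNorm_le_bound _ hC0 fun f => norm_op_apply_le hg hC0 (hC f)

theorem integral_eq_ofCLM (hg : IsBoundedBorel g) :
    E.integral g hg.measurable = ofCLM (E.op g) := by
  refine ext_graph fun f k => ?_
  rw [mem_graph_integral, mem_graph_ofCLM, op_apply hg]
  exact and_iff_right (hg.memLp _)

theorem op_integralAt (hg : IsBoundedBorel g) (hh : Measurable h) (hf : MemLp h 2 (E.scalar f)) :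
    E.op g (E.integralAt h hh f) = E.integralAt (g * h) (hg.measurable.mul hh) f := by
  rw [op_apply hg, E.integralAt_integralAt hg.measurable hf (hg.memLp_mul hf)]

theorem memLp_scalar_op (hg : IsBoundedBorel g) (hh : Measurable h) :
    MemLp h 2 (E.scalar (E.op g f)) ↔ MemLp (h * g) 2 (E.scalar f) := by
  rw [op_apply hg, E.memLp_scalar_integralAt hh (hg.memLp _)]

theorem integralAt_op (hg : IsBoundedBorel g) (hh : Measurable h)
    (hf : MemLp (h * g) 2 (E.scalar f)) :
    E.integralAt h hh (E.op g f) = E.integralAt (h * g) (hh.mul hg.measurable) f := by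
  rw [op_apply hg, E.integralAt_integralAt hh (hg.memLp _) hf]

theorem op_mul (hg : IsBoundedBorel g) (hh : IsBoundedBorel h) :
    E.op (g * h) = E.op g * E.op h := by
  ext f
  rw [mul_apply_eq_comp, op_apply hh, op_integralAt hg hh.measurable (hh.memLp _),
    op_apply (hg.mul hh)]

theorem op_mul_comm (hg : IsBoundedBorel g) (hh : IsBoundedBorel h) :
    E.op g * E.op h = E.op h * E.op g := by
  rw [← op_mul hg hh, ← op_mul hh hg, mul_comm]

theorem op_add (hg : IsBoundedBorel g) (hh : IsBoundedBorel h) :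
    E.op (g + h) = E.op g + E.op h := by
  ext f
  rw [add_apply, op_apply hg, op_apply hh, op_apply (hg.add hh),
    E.integralAt_add hg.measurable hh.measurable (hg.memLp _) (hh.memLp _)]

theorem adjoint_op (hg : IsBoundedBorel g) :
    ContinuousLinearMap.adjoint (E.op g) = E.op fun t => starRingEnd ℂ (g t) := by
  symm
  rw [ContinuousLinearMap.eq_adjoint_iff]
  intro f u
  have hinner := E.inner_integralAt_left hg.measurable (hg.memLp (E.scalar u))
    (hg.memLp (E.scalar f))
  rw [op_apply hg, op_apply hg.conj, ← inner_conj_symm, ← hinner, inner_conj_symm]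

theorem op_indicator_const {s : Set ℝ} (hs : MeasurableSet s) (c : ℂ) :
    E.op (s.indicator fun _ => c) = c • E.proj s := by
  have hb : IsBoundedBorel (s.indicator fun _ => c) :=
    .indicator_of_le measurable_const hs fun _ _ => le_rfl
  have hcoe : ⇑(SimpleFunc.piecewise s hs (SimpleFunc.const ℝ c) (SimpleFunc.const ℝ 0))
      = s.indicator fun _ => c := by
    ext x
    by_cases hx : x ∈ s <;> simp [hx]
  ext f
  rw [op_apply hb, ← E.simple_piecewise hs, ← integralAt_simpleFunc]
  simp only [hcoe]

theorem op_indicator_one {s : Set ℝ} (hs : MeasurableSet s) : E.op (s.indicator 1) = E.proj s :=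
  (op_indicator_const hs 1).trans (one_smul ℂ _)

theorem op_indicator {s : Set ℝ} (hs : MeasurableSet s) (hg : IsBoundedBorel g) :
    E.op (s.indicator g) = E.proj s * E.op g := by
  rw [← op_indicator_one hs, ← op_mul (.indicator_one hs) hg]
  congr 1
  ext t
  by_cases ht : t ∈ s <;> simp [ht]

theorem op_const (c : ℂ) : E.op (fun _ => c) = c • 1 := by
  have huniv := E.op_indicator_const MeasurableSet.univ c
  rwa [Set.indicator_univ, E.proj_univ] at huniv

end Op

/-! ### Convergence, adjoints and closedness -/

section Convergence

variable {f : H}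

theorem tendsto_integralAt_of_dominated {g : ℕ → ℝ → ℂ} {h G : ℝ → ℂ} (hg : ∀ n, Measurable (g n))
    (hh : Measurable h) (hG : MemLp G 2 (E.scalar f))
    (hle : ∀ n, ∀ᵐ t ∂(E.scalar f), ‖g n t‖ ≤ ‖G t‖)
    (hlim : ∀ᵐ t ∂(E.scalar f), Tendsto (fun n => g n t) atTop (𝓝 (h t))) :
    Tendsto (fun n => E.integralAt (g n) (hg n) f) atTop (𝓝 (E.integralAt h hh f)) := by
  have hgf (n : ℕ) : MemLp (g n) 2 (E.scalar f) := hG.of_le (hg n).aestronglyMeasurable (hle n)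
  have hhf : MemLp h 2 (E.scalar f) := by
    refine hG.of_le hh.aestronglyMeasurable ?_
    filter_upwards [hlim, ae_all_iff.mpr hle] with t hlim hle using le_of_tendsto' hlim.norm hle
  simp only [tendsto_iff_edist_tendsto_0, edist_eq_enorm_sub,
    E.enorm_integralAt_sub (hg _) hh (hgf _) hhf]
  exact tendsto_eLpNorm_two_sub_of_dominated (fun n => (hgf n).1) hG hle hlim

theorem tendsto_proj {s : ℕ → Set ℝ} (hs : ∀ n, MeasurableSet (s n))
    (h : ∀ᵐ t ∂(E.scalar f), ∀ᶠ n in atTop, t ∈ s n) :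
    Tendsto (fun n => E.proj (s n) f) atTop (𝓝 f) := by
  have hone : E.integralAt (fun _ => 1) measurable_const f = f := by
    rw [← op_apply (.const 1), op_const, one_smul, one_apply_eq_self]
  have hlim : Tendsto (fun n => E.integralAt ((s n).indicator 1)
      (IsBoundedBorel.indicator_one (hs n)).measurable f) atTop
      (𝓝 (E.integralAt (fun _ => 1) measurable_const f)) := by
    refine tendsto_integralAt_of_dominated _ _ ((IsBoundedBorel.const 1).memLp _)
      (fun n => .of_forall fun t => ?_) (h.mono fun t ht => ?_)
    · by_cases ht : t ∈ s n <;> simp [ht]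
    · exact tendsto_const_nhds.congr' (ht.mono fun n hn => by simp [hn])
  rw [hone] at hlim
  exact hlim.congr fun n => by rw [← op_apply (.indicator_one (hs n)), op_indicator_one (hs n)]

theorem memLp_of_tendsto {g : ℕ → ℝ → ℂ} {h : ℝ → ℂ} (hg : ∀ n, IsBoundedBorel (g n))
    (hh : Measurable h) {C : ℝ} (hC : ∀ n, ‖E.op (g n) f‖ ≤ C)
    (hlim : ∀ᵐ t ∂(E.scalar f), Tendsto (fun n => g n t) atTop (𝓝 (h t))) :
    MemLp h 2 (E.scalar f) := by
  refine ⟨hh.aestronglyMeasurable, ?_⟩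
  calc eLpNorm h 2 (E.scalar f)
      ≤ liminf (fun n => eLpNorm (g n) 2 (E.scalar f)) atTop :=
        Lp.eLpNorm_lim_le_liminf_eLpNorm (fun n => (hg n).measurable.aestronglyMeasurable) h hlim
    _ ≤ liminf (fun _ : ℕ => ENNReal.ofReal C) atTop := liminf_le_liminf <| .of_forall fun n => by
        rw [← enorm_op (hg n), ← ofReal_norm]
        exact ENNReal.ofReal_le_ofReal (hC n)
    _ < ∞ := by simp

end Convergence

section Adjoint

variable {g : ℝ → ℂ}

theorem eventually_norm_le_natCast (g : ℝ → ℂ) (t : ℝ) :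
    ∀ᶠ n : ℕ in atTop, t ∈ {t | ‖g t‖ ≤ (n : ℝ)} :=
  tendsto_natCast_atTop_atTop.eventually_ge_atTop ‖g t‖

theorem tendsto_proj_norm_le (hg : Measurable g) (f : H) :
    Tendsto (fun n : ℕ => E.proj {t | ‖g t‖ ≤ n} f) atTop (𝓝 f) :=
  tendsto_proj (fun n => measurableSet_norm_le hg n) (.of_forall (eventually_norm_le_natCast g))

theorem mul_indicator_one (s : Set ℝ) (g : ℝ → ℂ) : g * s.indicator 1 = s.indicator g := by
  ext t
  by_cases ht : t ∈ s <;> simp [ht]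

theorem mem_graph_integral_proj (hg : Measurable g) {s : Set ℝ} (hs : MeasurableSet s)
    (hb : IsBoundedBorel (s.indicator g)) (f : H) :
    (E.proj s f, E.op (s.indicator g) f) ∈ (E.integral g hg).graph := by
  have hgs : MemLp (g * s.indicator 1) 2 (E.scalar f) := by
    rw [mul_indicator_one]; exact hb.memLp _
  rw [mem_graph_integral, ← op_indicator_one hs, memLp_scalar_op (.indicator_one hs) hg,
    integralAt_op (.indicator_one hs) hg hgs, op_apply hb]
  exact ⟨hgs, by simp only [mul_indicator_one]⟩

theorem dense_domain_integral (hg : Measurable g) :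
    Dense ((E.integral g hg).domain : Set H) := fun f =>
  mem_closure_of_tendsto (tendsto_proj_norm_le hg f) <| .of_forall fun n =>
    (E.mem_graph_integral.mp (mem_graph_integral_proj hg (measurableSet_norm_le hg n)
      (.indicator_norm_le hg n) f)).1

theorem mem_graph_integral_of_forall_proj (hg : Measurable g) {u w : H}
    (h : ∀ n : ℕ, E.op ({t | ‖g t‖ ≤ n}.indicator g) u = E.proj {t | ‖g t‖ ≤ n} w) :
    (u, w) ∈ (E.integral g hg).graph := by
  have hs (n : ℕ) := measurableSet_norm_le hg (n : ℝ)
  have hb (n : ℕ) := IsBoundedBorel.indicator_norm_le hg (n : ℝ)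
  have hmem : MemLp g 2 (E.scalar u) := by
    refine memLp_of_tendsto hb hg (C := ‖w‖) (fun n => ?_) (.of_forall fun t => ?_)
    · rw [h]
      exact (E.proj _).le_of_opNorm_le (E.isStarProjection _ (hs n)).norm_le w |>.trans
        (one_mul _).le
    · exact tendsto_const_nhds.congr' ((eventually_norm_le_natCast g t).mono fun n hn =>
        (Set.indicator_of_mem hn g).symm)
  refine E.mem_graph_integral.mpr ⟨hmem, tendsto_nhds_unique (tendsto_proj_norm_le (E := E) hg _)
    ((tendsto_proj_norm_le (E := E) hg w).congr fun n => ?_)⟩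
  rw [← h, ← op_indicator_one (hs n), op_integralAt (.indicator_one (hs n)) _ hmem,
    op_apply (hb n)]
  simp only [mul_comm _ g, mul_indicator_one]

theorem op_indicator_conj_eq_proj (hg : Measurable g) {u w : H}
    (huw : (u, w) ∈ ((E.integral g hg)†).graph) {s : Set ℝ} (hs : MeasurableSet s)
    (hb : IsBoundedBorel (s.indicator g)) :
    E.op (s.indicator fun t => starRingEnd ℂ (g t)) u = E.proj s w := by
  have hconj : (s.indicator fun t => starRingEnd ℂ (g t))
      = fun t => starRingEnd ℂ (s.indicator g t) := by
    ext t
    by_cases ht : t ∈ s <;> simp [ht]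
  refine ext_inner_right ℂ fun v => ?_
  obtain ⟨hv, hgv⟩ := mem_graph_iff_exists.mp (mem_graph_integral_proj hg hs hb v)
  have hadj := (mem_graph_adjoint_iff (dense_domain_integral hg)).mp huw ⟨_, hv⟩
  rw [hgv] at hadj
  rw [hconj, ← adjoint_op hb, ContinuousLinearMap.adjoint_inner_left, ← hadj,
    ← ContinuousLinearMap.adjoint_inner_left, E.adjoint_proj hs]

theorem adjoint_integral (hg : Measurable g) :
    (E.integral g hg)† = E.integral (fun t => starRingEnd ℂ (g t)) (measurable_conj hg) := by
  refine ext_graph fun u w => ⟨fun huw => ?_, fun huw => ?_⟩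
  · refine mem_graph_integral_of_forall_proj _ fun n => ?_
    simp only [RCLike.norm_conj]
    exact op_indicator_conj_eq_proj hg huw (measurableSet_norm_le hg n)
      (.indicator_norm_le hg n)
  · obtain ⟨hu, rfl⟩ := E.mem_graph_integral.mp huw
    have hgu : MemLp g 2 (E.scalar u) := by simpa [Pi.star_def] using hu.star
    refine (mem_graph_adjoint_iff (dense_domain_integral hg)).mpr fun x => ?_
    rw [← inner_conj_symm, ← E.inner_integralAt_left hg x.2 hgu, inner_conj_symm]
    rfl

theorem isClosed_integral (hg : Measurable g) : (E.integral g hg).IsClosed := by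
  have h := adjoint_integral (E := E) (measurable_conj hg)
  simp only [Complex.conj_conj] at h
  exact h ▸ LinearPMap.adjoint_isClosed (dense_domain_integral _)

variable (E) in
/-- The self-adjoint operator `∫ λ dE(λ)`. -/
abbrev toPMap : H →ₗ.[ℂ] H := E.integral (fun t => (t : ℂ)) Complex.measurable_ofReal

theorem dense_domain_toPMap : Dense (E.toPMap.domain : Set H) := dense_domain_integral _

theorem adjoint_toPMap : E.toPMap† = E.toPMap := by
  rw [toPMap, adjoint_integral]
  simp only [Complex.conj_ofReal]

end Adjoint

end ProjMeasure

namespace ProjMeasure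

/-! ### Images of projection-valued measures -/

/-- The image of a projection-valued measure under a Borel map. -/
def map (E : ProjMeasure H) (φ : ℝ → ℝ) (hφ : Measurable φ) : ProjMeasure H where
  proj s := E.proj (φ ⁻¹' s)
  isStarProjection _ hs := E.isStarProjection _ (hφ hs)
  proj_univ := E.proj_univ
  hasSum_iUnion s hs hd f := by
    rw [Set.preimage_iUnion]
    exact E.hasSum_iUnion _ (fun n => hφ (hs n)) (fun i j hij => (hd hij).preimage φ) f

variable {E E' : ProjMeasure H}

section Map

variable {φ : ℝ → ℝ} (hφ : Measurable φ) {g : ℝ → ℂ} (hg : Measurable g) {f : H}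

theorem scalar_map (f : H) : (E.map φ hφ).scalar f = (E.scalar f).map φ := by
  refine Measure.ext fun s hs => ?_
  rw [Measure.map_apply hφ hs, scalar_apply _ _ hs, scalar_apply _ _ (hφ hs)]
  rfl

theorem simple_map (ψ : SimpleFunc ℝ ℂ) :
    (E.map φ hφ).simple ψ = E.simple (ψ.comp φ hφ) := by
  induction ψ using SimpleFunc.induction with
  | @const c s hs =>
    have hcomp : (SimpleFunc.piecewise s hs (SimpleFunc.const ℝ c) (SimpleFunc.const ℝ 0)).comp φ hφ
        = SimpleFunc.piecewise (φ ⁻¹' s) (hφ hs) (SimpleFunc.const ℝ c) (SimpleFunc.const ℝ 0) := by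
      ext x
      by_cases hx : φ x ∈ s <;> simp [hx]
    rw [hcomp, simple_piecewise, simple_piecewise]
    rfl
  | @add ψ₁ ψ₂ _ h₁ h₂ =>
    have hcomp : (ψ₁ + ψ₂).comp φ hφ = ψ₁.comp φ hφ + ψ₂.comp φ hφ := rfl
    rw [hcomp, simple_add, simple_add, h₁, h₂]

include hg in
theorem memLp_scalar_map :
    MemLp g 2 ((E.map φ hφ).scalar f) ↔ MemLp (g ∘ φ) 2 (E.scalar f) := by
  rw [scalar_map]
  exact memLp_map_measure_iff hg.aestronglyMeasurable hφ.aemeasurable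

theorem integralAt_map (hf : MemLp (g ∘ φ) 2 (E.scalar f)) :
    (E.map φ hφ).integralAt g hg f = E.integralAt (g ∘ φ) (hg.comp hφ) f := by
  have hf' := (memLp_scalar_map hφ hg).mpr hf
  refine tendsto_nhds_unique (tendsto_simple_approx _ hg hf') ?_
  simp only [simple_map]
  refine E.tendsto_simple _ hf ((tendsto_eLpNorm_approx hg hf').congr fun n => ?_)
  rw [scalar_map, eLpNorm_map_measure
    ((SimpleFunc.measurable _).sub hg).aestronglyMeasurable hφ.aemeasurable]
  rfl

theorem integral_map : (E.map φ hφ).integral g hg = E.integral (g ∘ φ) (hg.comp hφ) := by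
  refine ext_graph fun f k => ?_
  rw [mem_graph_integral, mem_graph_integral, memLp_scalar_map hφ hg]
  exact and_congr_right fun hf => by rw [integralAt_map hφ hg hf]

end Map

/-! ### Intertwining -/

section Intertwines

variable {B : H →L[ℂ] H}

theorem scalar_apply_le_of_mul_proj (hB : ∀ s, MeasurableSet s → B * E.proj s = E'.proj s * B)
    (f : H) : E'.scalar (B f) ≤ ENNReal.ofReal (‖B‖ ^ 2) • E.scalar f := by
  refine Measure.le_iff.mpr fun s hs => ?_
  have hBs : E'.proj s (B f) = B (E.proj s f) := (congr($(hB s hs) f)).symm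
  rw [Measure.smul_apply, scalar_apply _ _ hs, scalar_apply _ _ hs, smul_eq_mul,
    ← ENNReal.ofReal_mul (by positivity), hBs, ← mul_pow]
  exact ENNReal.ofReal_le_ofReal (pow_le_pow_left₀ (norm_nonneg _) (B.le_opNorm _) 2)

theorem intertwines_integral (hB : ∀ s, MeasurableSet s → B * E.proj s = E'.proj s * B)
    {g : ℝ → ℂ} (hg : Measurable g) : Intertwines B (E.integral g hg) (E'.integral g hg) := by
  intro f h hfh
  obtain ⟨hf, rfl⟩ := (mem_graph_integral _).mp hfh
  have hBf : MemLp g 2 (E'.scalar (B f)) :=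
    (hf.smul_measure ENNReal.ofReal_ne_top).mono_measure (scalar_apply_le_of_mul_proj hB f)
  refine (mem_graph_integral _).mpr
    ⟨hBf, tendsto_nhds_unique (E'.tendsto_simple_approx hg hBf) ?_⟩
  refine ((B.continuous.tendsto _).comp (E.tendsto_simple_approx hg hf)).congr fun n => ?_
  have hBs (c : ℂ) : B (E.proj (approx g hg n ⁻¹' {c}) f) = E'.proj (approx g hg n ⁻¹' {c}) (B f) :=
    congr($(hB _ (SimpleFunc.measurableSet_fiber _ c)) f)
  simp [simple, sum_apply, hBs]

theorem mul_norm_proj_le_norm_proj_integralAt {g : ℝ → ℂ} (hg : Measurable g) {f : H}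
    (hf : MemLp g 2 (E.scalar f)) {s : Set ℝ} (hs : MeasurableSet s) {ρ : ℝ} (hρ : 0 ≤ ρ)
    (hgs : ∀ t ∈ s, ρ ≤ ‖g t‖) : ρ * ‖E.proj s f‖ ≤ ‖E.proj s (E.integralAt g hg f)‖ := by
  have hle : ENNReal.ofReal (ρ ^ 2) * E.scalar f s ≤ E.scalar (E.integralAt g hg f) s := by
    rw [E.scalar_integralAt hg hf, withDensity_apply _ hs, ← setLIntegral_const]
    refine setLIntegral_mono' hs fun t ht => ?_
    rw [ENNReal.ofReal_pow hρ, ← ofReal_norm]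
    gcongr
    exact hgs t ht
  rw [scalar_apply _ _ hs, scalar_apply _ _ hs, ← ENNReal.ofReal_mul (by positivity),
    ENNReal.ofReal_le_ofReal_iff (by positivity), ← mul_pow] at hle
  exact (pow_le_pow_iff_left₀ (by positivity) (by positivity) two_ne_zero).mp hle

theorem mul_norm_proj_compl_ball_le {c ρ : ℝ} (hρ : 0 ≤ ρ) {u w : H} (h : (u, w) ∈ E.toPMap.graph) :
    ρ * ‖E.proj (Metric.ball c ρ)ᶜ u‖ ≤ ‖E.proj (Metric.ball c ρ)ᶜ (w - (c : ℂ) • u)‖ := by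
  obtain ⟨hu, rfl⟩ := (mem_graph_integral _).mp h
  have hc := IsBoundedBorel.const (-(c : ℂ))
  have hsub : E.integralAt (Complex.ofReal + fun _ => -(c : ℂ))
      (Complex.measurable_ofReal.add measurable_const) u
      = E.integralAt (fun t => (t : ℂ)) Complex.measurable_ofReal u - (c : ℂ) • u := by
    rw [E.integralAt_add _ measurable_const hu (hc.memLp _), ← op_apply hc, op_const, smul_apply,
      one_apply_eq_self, neg_smul, sub_eq_add_neg]
  rw [← hsub]
  refine mul_norm_proj_le_norm_proj_integralAt _ (hu.add (hc.memLp _))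
    measurableSet_ball.compl hρ fun t ht => ?_
  have hnorm : ‖(Complex.ofReal + fun _ : ℝ => -(c : ℂ)) t‖ = |t - c| := by
    rw [Pi.add_apply, ← sub_eq_add_neg, ← Complex.ofReal_sub, Complex.norm_real, Real.norm_eq_abs]
  rwa [hnorm, ← Real.dist_eq, ← not_lt]

theorem exists_mem_graph_of_proj_closedBall {c r : ℝ} (hr : 0 ≤ r) {f : H}
    (hf : E.proj (Metric.closedBall c r) f = f) :
    ∃ k, (f, k + (c : ℂ) • f) ∈ E.toPMap.graph ∧
      E.proj (Metric.closedBall c r) k = k ∧ ‖k‖ ≤ r * ‖f‖ := by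
  set I := Metric.closedBall c r
  have hI : MeasurableSet I := measurableSet_closedBall
  have hle : ∀ t ∈ I, ‖((t - c : ℝ) : ℂ)‖ ≤ r := fun t ht => by
    rwa [Complex.norm_real, ← dist_eq_norm]
  have hm : IsBoundedBorel (I.indicator fun t => ((t - c : ℝ) : ℂ)) :=
    .indicator_of_le (by fun_prop) hI hle
  have hc : IsBoundedBorel (I.indicator fun _ => (c : ℂ)) :=
    .indicator_of_le measurable_const hI fun _ _ => le_rfl
  have hsplit : I.indicator (fun t : ℝ => (t : ℂ))
      = (I.indicator fun t => ((t - c : ℝ) : ℂ)) + I.indicator fun _ => (c : ℂ) := by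
    ext t
    by_cases ht : t ∈ I <;> simp [ht]
  refine ⟨E.op (I.indicator fun t => ((t - c : ℝ) : ℂ)) f, ?_, ?_, ?_⟩
  · have hgraph := mem_graph_integral_proj (E := E) Complex.measurable_ofReal hI
      (hsplit ▸ hm.add hc) f
    rwa [hf, hsplit, op_add hm hc, op_indicator_const hI, add_apply, smul_apply, hf] at hgraph
  · rw [← mul_apply_eq_comp, ← op_indicator hI hm, Set.indicator_indicator, Set.inter_self]
  · refine norm_op_apply_le hm hr (.of_forall fun t => ?_)
    by_cases ht : t ∈ I
    · rw [Set.indicator_of_mem ht]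
      exact hle t ht
    · rwa [Set.indicator_of_notMem ht, norm_zero]

theorem proj_compl {s : Set ℝ} (hs : MeasurableSet s) : E.proj sᶜ = 1 - E.proj s := by
  rw [← E.proj_univ, ← Set.union_compl_self s, E.proj_union hs hs.compl disjoint_compl_right,
    add_sub_cancel_left]

variable (hB : Intertwines B E.toPMap E'.toPMap)

include hB

theorem pow_mul_norm_proj_compl_ball_le {c r ρ : ℝ} (hr : 0 ≤ r) (hρ : 0 ≤ ρ) (n : ℕ) {f : H}
    (hf : E.proj (Metric.closedBall c r) f = f) :
    ρ ^ n * ‖E'.proj (Metric.ball c ρ)ᶜ (B f)‖ ≤ ‖B‖ * (r ^ n * ‖f‖) := by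
  induction n generalizing f with
  | zero =>
    have hproj := (E'.isStarProjection _ (measurableSet_ball (x := c) (ε := ρ)).compl).norm_le
    simpa using ((E'.proj _).le_of_opNorm_le hproj (B f)).trans
      ((one_mul _).trans_le (B.le_opNorm f))
  | succ n ih =>
    obtain ⟨k, hfk, hk, hkf⟩ := exists_mem_graph_of_proj_closedBall hr hf
    have hρk := mul_norm_proj_compl_ball_le (c := c) hρ (hB _ _ hfk)
    rw [map_add, map_smul, add_sub_cancel_right] at hρk
    calc ρ ^ (n + 1) * ‖E'.proj (Metric.ball c ρ)ᶜ (B f)‖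
        = ρ ^ n * (ρ * ‖E'.proj (Metric.ball c ρ)ᶜ (B f)‖) := by ring
      _ ≤ ρ ^ n * ‖E'.proj (Metric.ball c ρ)ᶜ (B k)‖ := by gcongr
      _ ≤ ‖B‖ * (r ^ n * ‖k‖) := ih hk
      _ ≤ ‖B‖ * (r ^ n * (r * ‖f‖)) := by gcongr
      _ = _ := by ring

theorem proj_compl_ball_eq_zero_of_intertwines {c r ρ : ℝ} (hr : 0 ≤ r) (hρ : r < ρ) {f : H}
    (hf : E.proj (Metric.closedBall c r) f = f) : E'.proj (Metric.ball c ρ)ᶜ (B f) = 0 := by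
  have hρ0 : 0 < ρ := hr.trans_lt hρ
  have hlim : Tendsto (fun n : ℕ => (r / ρ) ^ n * (‖B‖ * ‖f‖)) atTop (𝓝 0) := by
    simpa using (tendsto_pow_atTop_nhds_zero_of_lt_one (by positivity)
      ((div_lt_one hρ0).mpr hρ)).mul_const (‖B‖ * ‖f‖)
  refine norm_le_zero_iff.mp (ge_of_tendsto' hlim fun n => ?_)
  rw [div_pow, div_mul_eq_mul_div, le_div_iff₀ (by positivity), mul_comm, mul_left_comm]
  exact pow_mul_norm_proj_compl_ball_le hB hr hρ0.le n hf

theorem proj_compl_closedBall_mul_of_intertwines {c r : ℝ} (hr : 0 ≤ r) :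
    E'.proj (Metric.closedBall c r)ᶜ * B * E.proj (Metric.closedBall c r) = 0 := by
  have hI : MeasurableSet (Metric.closedBall c r) := measurableSet_closedBall
  have hcompl : (Metric.closedBall c r)ᶜ = ⋃ n : ℕ, (Metric.ball c (r + 1 / (n + 1)))ᶜ := by
    ext t
    simp only [Set.mem_compl_iff, Metric.mem_closedBall, not_le, Set.mem_iUnion, Metric.mem_ball,
      not_lt]
    refine ⟨fun ht => ?_, fun ⟨n, hn⟩ => ?_⟩
    · obtain ⟨n, hn⟩ := exists_nat_one_div_lt (sub_pos.mpr ht)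
      exact ⟨n, by linarith⟩
    · linarith [Nat.one_div_pos_of_nat (α := ℝ) (n := n)]
  ext f
  change E'.proj (Metric.closedBall c r)ᶜ (B (E.proj (Metric.closedBall c r) f)) = 0
  rw [← scalar_eq_zero_iff _ hI.compl, hcompl, measure_iUnion_null_iff]
  intro n
  rw [scalar_eq_zero_iff _ measurableSet_ball.compl]
  exact proj_compl_ball_eq_zero_of_intertwines hB hr (lt_add_of_pos_right r Nat.one_div_pos_of_nat)
    congr($((E.isStarProjection _ hI).isIdempotentElem.eq) f)

theorem mul_proj_closedBall_of_intertwines {c r : ℝ} (hr : 0 ≤ r) :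
    B * E.proj (Metric.closedBall c r) = E'.proj (Metric.closedBall c r) * B := by
  have hI : MeasurableSet (Metric.closedBall c r) := measurableSet_closedBall
  have hB' := hB.adjoint dense_domain_toPMap dense_domain_toPMap
  rw [adjoint_toPMap, adjoint_toPMap] at hB'
  have h := proj_compl_closedBall_mul_of_intertwines (c := c) hB hr
  have h' := congrArg star (proj_compl_closedBall_mul_of_intertwines (c := c) hB' hr)
  simp only [star_mul, (isStarProjection _ _ hI).isSelfAdjoint.star_eq,
    (isStarProjection _ _ hI.compl).isSelfAdjoint.star_eq, ContinuousLinearMap.star_eq_adjoint,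
    ContinuousLinearMap.adjoint_adjoint, star_zero] at h'
  rw [proj_compl hI, sub_mul, sub_mul, one_mul, sub_eq_zero] at h
  rw [proj_compl hI, mul_sub, mul_sub, mul_one, sub_eq_zero] at h'
  rw [h, mul_assoc, h']

theorem mul_proj_of_intertwines {s : Set ℝ} (hs : MeasurableSet s) :
    B * E.proj s = E'.proj s * B := by
  have hgen := Dense.borel_eq_generateFrom_Icc_mem (α := ℝ) dense_univ
  induction s, hs using MeasurableSpace.induction_on_inter
    (BorelSpace.measurable_eq.trans hgen) (isPiSystem_Icc_mem _ _) with
  | empty => ext f; simp [proj_empty]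
  | basic t ht =>
    obtain ⟨a, -, b, -, hab, rfl⟩ := ht
    rw [Real.Icc_eq_closedBall]
    exact mul_proj_closedBall_of_intertwines hB (by linarith)
  | compl t ht h => rw [proj_compl ht, proj_compl ht, mul_sub, sub_mul, h, mul_one, one_mul]
  | iUnion t hd ht h =>
    ext f
    have hE' : HasSum (fun n => B (E.proj (t n) f)) (E'.proj (⋃ n, t n) (B f)) :=
      (E'.hasSum_iUnion t ht hd (B f)).congr_fun fun n => congr($(h n) f)
    exact ((E.hasSum_iUnion t ht hd f).mapL B).unique hE'

end Intertwines

end ProjMeasure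

/-! ### The spectral theorem -/

theorem isStarProjection_of_inner_apply_eq {P : H →L[ℂ] H}
    (h : ∀ f, inner ℂ f (P f) = ((‖P f‖ ^ 2 : ℝ) : ℂ)) : IsStarProjection P := by
  have hsa : IsSelfAdjoint P := by
    rw [ContinuousLinearMap.isSelfAdjoint_iff_isSymmetric,
      LinearMap.isSymmetric_iff_inner_map_self_real]
    intro f
    change starRingEnd ℂ (inner ℂ (P f) f) = inner ℂ (P f) f
    rw [inner_conj_symm, ← inner_conj_symm (P f) f, h f, Complex.conj_ofReal]
  refine ⟨inner_self_apply_ext fun f => ?_, hsa⟩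
  rw [mul_apply_eq_comp, ← ContinuousLinearMap.adjoint_inner_left, hsa.adjoint_eq, h f,
    inner_self_eq_norm_sq_to_K]
  norm_cast

section OfMeasures

variable {μ : H → Measure ℝ}

/-- The operators `P s` represent the measures `μ f` as `μ f s = ⟨f, P(s) f⟩ = ‖P(s) f‖²`. -/
structure Represents (μ : H → Measure ℝ) (P : Set ℝ → H →L[ℂ] H) : Prop where
  inner_apply : ∀ s, MeasurableSet s → ∀ f, inner ℂ f (P s f) = ((μ f).real s : ℂ)
  norm_apply_sq : ∀ s, MeasurableSet s → ∀ f, ‖P s f‖ ^ 2 = (μ f).real s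

namespace Represents

variable {P : Set ℝ → H →L[ℂ] H} (hP : Represents μ P)

include hP

theorem isStarProjection {s : Set ℝ} (hs : MeasurableSet s) : IsStarProjection (P s) :=
  isStarProjection_of_inner_apply_eq fun f => by
    rw [hP.inner_apply s hs, hP.norm_apply_sq s hs]

variable [∀ f, IsFiniteMeasure (μ f)]

omit [CompleteSpace H] in
theorem union {s t : Set ℝ} (hs : MeasurableSet s) (ht : MeasurableSet t) (hd : Disjoint s t) :
    P (s ∪ t) = P s + P t :=
  inner_self_apply_ext fun f => by
    rw [add_apply, inner_add_right, hP.inner_apply s hs, hP.inner_apply t ht,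
      hP.inner_apply _ (hs.union ht), measureReal_union hd ht, Complex.ofReal_add]

omit [CompleteSpace H] in
theorem biUnion {s : ℕ → Set ℝ} (hs : ∀ n, MeasurableSet (s n))
    (hd : Pairwise (Function.onFun Disjoint s)) (I : Finset ℕ) :
    P (⋃ n ∈ I, s n) = ∑ n ∈ I, P (s n) :=
  inner_self_apply_ext fun f => by
    rw [hP.inner_apply _ (I.measurableSet_biUnion fun n _ => hs n), sum_apply, inner_sum,
      measureReal_biUnion_finset (fun i _ j _ hij => hd hij) fun n _ => hs n, Complex.ofReal_sum]
    exact Finset.sum_congr rfl fun n _ => (hP.inner_apply _ (hs n) f).symm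

omit [CompleteSpace H] in
theorem hasSum_iUnion {s : ℕ → Set ℝ} (hs : ∀ n, MeasurableSet (s n))
    (hd : Pairwise (Function.onFun Disjoint s)) (f : H) :
    HasSum (fun n => P (s n) f) (P (⋃ n, s n) f) := by
  have hfin (I : Finset ℕ) : MeasurableSet (⋃ n ∈ I, s n) :=
    I.measurableSet_biUnion fun n _ => hs n
  have hsub (I : Finset ℕ) : ⋃ n ∈ I, s n ⊆ ⋃ n, s n := Set.iUnion₂_subset_iUnion _ _
  have hnorm (I : Finset ℕ) : ‖P (⋃ n, s n) f - ∑ n ∈ I, P (s n) f‖ ^ 2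
      = (μ f).real (⋃ n, s n) - ∑ n ∈ I, (μ f).real (s n) := by
    have hunion := hP.union (hfin I) ((MeasurableSet.iUnion hs).diff (hfin I))
      Set.disjoint_sdiff_right
    rw [Set.union_sdiff_cancel (hsub I), hP.biUnion hs hd] at hunion
    rw [hunion, add_apply, sum_apply, add_sub_cancel_left,
      hP.norm_apply_sq _ ((MeasurableSet.iUnion hs).diff (hfin I)),
      measureReal_sdiff (hsub I) (hfin I),
      measureReal_biUnion_finset (fun i _ j _ hij => hd hij) fun n _ => hs n]
  have hmeas : HasSum (fun n => (μ f).real (s n)) ((μ f).real (⋃ n, s n)) := by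
    have htsum := measure_iUnion hd hs (μ := μ f)
    rw [measureReal_def, htsum, ENNReal.tsum_toReal_eq fun n => measure_ne_top _ _]
    exact ENNReal.hasSum_toReal (htsum ▸ measure_ne_top _ _)
  have hlim : Tendsto (fun I : Finset ℕ => ‖P (⋃ n, s n) f - ∑ n ∈ I, P (s n) f‖) atTop (𝓝 0) := by
    have hsqrt := (hmeas.const_sub ((μ f).real (⋃ n, s n))).sqrt
    simpa only [← hnorm, Real.sqrt_sq (norm_nonneg _), sub_self, Real.sqrt_zero,
      SummationFilter.unconditional_filter] using hsqrt
  rw [HasSum, SummationFilter.unconditional_filter, tendsto_iff_norm_sub_tendsto_zero]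
  exact hlim.congr fun I => norm_sub_rev _ _

/-- The projection-valued measure of operators representing measures of mass `‖f‖²`. -/
def toProjMeasure (hμ : ∀ f, (μ f).real Set.univ = ‖f‖ ^ 2) : ProjMeasure H where
  proj := P
  isStarProjection _ := hP.isStarProjection
  proj_univ := inner_self_apply_ext fun f => by
    rw [hP.inner_apply _ .univ, hμ, one_apply_eq_self, inner_self_eq_norm_sq_to_K]
    norm_cast
  hasSum_iUnion _ := hP.hasSum_iUnion

theorem scalar_toProjMeasure (hμ : ∀ f, (μ f).real Set.univ = ‖f‖ ^ 2) (f : H) :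
    (hP.toProjMeasure hμ).scalar f = μ f := by
  ext s hs
  rw [ProjMeasure.scalar_apply _ f hs]
  exact (congrArg ENNReal.ofReal (hP.norm_apply_sq s hs f)).trans ofReal_measureReal

end Represents

end OfMeasures

theorem exists_tendsto_eLpNorm_sub_indicator_one {X ι : Type*} [TopologicalSpace X] [NormalSpace X]
    [TopologicalSpace.PseudoMetrizableSpace X] [CompactSpace X] [MeasurableSpace X] [BorelSpace X]
    (μ : ι → Measure X) [∀ i, IsFiniteMeasure (μ i)] {s : Set X} (hs : MeasurableSet s) :
    ∃ φ : Finset ι × ℕ → C(X, ℝ), ∀ i,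
      Tendsto (fun a => eLpNorm (⇑(φ a) - s.indicator 1) 2 (μ i)) atTop (𝓝 0) := by
  have happrox (a : Finset ι × ℕ) : ∃ φ : C(X, ℝ), ∀ i ∈ a.1,
      eLpNorm (⇑φ - s.indicator 1) 2 (μ i) ≤ ((a.2 + 1 : ℕ) : ℝ≥0∞)⁻¹ := by
    have hmem : MemLp (s.indicator fun _ => (1 : ℝ)) 2 (∑ i ∈ a.1, μ i) :=
      memLp_indicator_const 2 hs 1 (.inr (measure_ne_top _ s))
    obtain ⟨φ, hφ, -⟩ := hmem.exists_boundedContinuous_eLpNorm_sub_le ENNReal.ofNat_ne_top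
      (ENNReal.inv_ne_zero.mpr (ENNReal.natCast_ne_top (a.2 + 1)))
    refine ⟨φ.toContinuousMap, fun i hi => le_trans ?_ hφ⟩
    rw [eLpNorm_sub_comm]
    refine eLpNorm_mono_measure _ (Measure.le_iff.mpr fun t _ => ?_)
    rw [Measure.finsetSum_apply]
    exact Finset.single_le_sum_of_canonicallyOrdered (f := fun i => μ i t) hi
  choose φ hφ using happrox
  simp only [← prod_atTop_atTop_eq]
  refine ⟨φ, fun i => tendsto_of_tendsto_of_tendsto_of_le_of_le' tendsto_const_nhds
    (ENNReal.tendsto_inv_nat_nhds_zero.comp ((tendsto_add_atTop_nat 1).comp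
      (tendsto_snd (f := atTop)))) (.of_forall fun _ => zero_le) ?_⟩
  filter_upwards [tendsto_fst.eventually (eventually_ge_atTop {i})] with a ha
  exact hφ a i (ha (Finset.mem_singleton_self i))

section Representation

open scoped CompactlySupported

variable {X : Type*} [TopologicalSpace X] (Φ : C(X, ℝ) →⋆ₐ[ℝ] (H →L[ℂ] H))

theorem adjoint_rep (φ : C(X, ℝ)) : ContinuousLinearMap.adjoint (Φ φ) = Φ φ := by
  rw [← ContinuousLinearMap.star_eq_adjoint, ← map_star, star_trivial]

theorem inner_rep_mul_self (φ : C(X, ℝ)) (f : H) :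
    inner ℂ f (Φ (φ * φ) f) = ((‖Φ φ f‖ ^ 2 : ℝ) : ℂ) := by
  rw [map_mul, mul_apply_eq_comp, ← ContinuousLinearMap.adjoint_inner_left, adjoint_rep,
    inner_self_eq_norm_sq_to_K]
  norm_cast

theorem ofReal_re_inner_rep (φ : C(X, ℝ)) (f : H) :
    (((inner ℂ f (Φ φ f)).re : ℝ) : ℂ) = inner ℂ f (Φ φ f) := by
  rw [← Complex.conj_eq_iff_re, inner_conj_symm, ← ContinuousLinearMap.adjoint_inner_right,
    adjoint_rep]

variable [CompactSpace X] [T2Space X] [MeasurableSpace X] [BorelSpace X]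

/-- The positive functional `φ ↦ ⟨f, Φ(φ) f⟩` on `C_c(X, ℝ)`, the domain of Mathlib's
Riesz–Markov–Kakutani theorem; here `X` is compact. -/
def repFunctional (f : H) : C_c(X, ℝ) →ₚ[ℝ] ℝ :=
  PositiveLinearMap.mk₀
    { toFun := fun φ => (inner ℂ f (Φ φ.toContinuousMap f)).re
      map_add' := fun φ ψ => by
        have hadd : (φ + ψ).toContinuousMap = φ.toContinuousMap + ψ.toContinuousMap := rfl
        rw [hadd, map_add, add_apply, inner_add_right, Complex.add_re]
      map_smul' := fun c φ => by
        have hsmul : (c • φ).toContinuousMap = c • φ.toContinuousMap := rfl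
        rw [hsmul, map_smul, smul_apply, ← Complex.coe_smul, inner_smul_right,
          Complex.re_ofReal_mul, RingHom.id_apply, smul_eq_mul] }
    (fun φ hφ => by
      let ψ : C(X, ℝ) := ⟨fun x => √(φ x), φ.continuous.sqrt⟩
      have hψ : φ.toContinuousMap = ψ * ψ := by
        ext x
        exact (Real.mul_self_sqrt (hφ x)).symm
      change 0 ≤ (inner ℂ f (Φ φ.toContinuousMap f)).re
      rw [hψ, inner_rep_mul_self, Complex.ofReal_re]
      positivity)

/-- The measure representing `φ ↦ ⟨f, Φ(φ) f⟩`. -/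
def repMeasure (f : H) : Measure X := RealRMK.rieszMeasure (repFunctional Φ f)

instance (f : H) : IsFiniteMeasure (repMeasure Φ f) := by
  unfold repMeasure
  infer_instance

theorem inner_rep (φ : C(X, ℝ)) (f : H) :
    inner ℂ f (Φ φ f) = ((∫ x, φ x ∂(repMeasure Φ f) : ℝ) : ℂ) := by
  rw [← ofReal_re_inner_rep]
  exact congrArg _ (RealRMK.integral_rieszMeasure (repFunctional Φ f)
    (CompactlySupportedContinuousMap.continuousMapEquiv φ)).symm

theorem integral_sq_repMeasure (φ : C(X, ℝ)) (f : H) :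
    ∫ x, φ x ^ 2 ∂(repMeasure Φ f) = ‖Φ φ f‖ ^ 2 := by
  have hsq := inner_rep_mul_self Φ φ f
  rw [inner_rep] at hsq
  simpa only [sq, ContinuousMap.mul_apply] using Complex.ofReal_injective hsq

theorem measureReal_repMeasure_univ (f : H) : (repMeasure Φ f).real Set.univ = ‖f‖ ^ 2 := by
  simpa using integral_sq_repMeasure Φ 1 f

theorem memLp_repMeasure (φ : C(X, ℝ)) (f : H) : MemLp φ 2 (repMeasure Φ f) :=
  .of_bound φ.continuous.measurable.aestronglyMeasurable ‖φ‖ (.of_forall φ.norm_coe_le_norm)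

theorem enorm_rep (φ : C(X, ℝ)) (f : H) : ‖Φ φ f‖ₑ = eLpNorm φ 2 (repMeasure Φ f) := by
  refine (ENNReal.pow_right_strictMono two_ne_zero).injective ?_
  simp only [eLpNorm_two_sq]
  rw [← ofReal_norm, ← ENNReal.ofReal_pow (norm_nonneg _), ← integral_sq_repMeasure,
    ofReal_integral_eq_lintegral_ofReal (memLp_repMeasure Φ φ f).integrable_sq
      (.of_forall fun x => sq_nonneg _)]
  refine lintegral_congr fun x => ?_
  rw [← sq_abs, ENNReal.ofReal_pow (abs_nonneg _), ← Real.norm_eq_abs, ofReal_norm]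

theorem exists_tendsto_rep {ι : Type*} {l : Filter ι} [l.NeBot] {φ : ι → C(X, ℝ)} {g : X → ℝ}
    {f : H} (hg : MemLp g 2 (repMeasure Φ f))
    (hφ : Tendsto (fun i => eLpNorm (⇑(φ i) - g) 2 (repMeasure Φ f)) l (𝓝 0)) :
    ∃ p, Tendsto (fun i => Φ (φ i) f) l (𝓝 p) := by
  refine cauchy_map_iff_exists_tendsto.mp (EMetric.cauchy_iff.mpr ⟨map_neBot.ne, fun ε hε => ?_⟩)
  refine ⟨_, image_mem_map (hφ.eventually (gt_mem_nhds (ENNReal.half_pos hε.ne'))), ?_⟩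
  rintro - ⟨i, hi, rfl⟩ - ⟨j, hj, rfl⟩
  have hsub := ((memLp_repMeasure Φ (φ i) f).sub hg).1
  have hsub' := ((memLp_repMeasure Φ (φ j) f).sub hg).1
  calc edist (Φ (φ i) f) (Φ (φ j) f)
    _ = eLpNorm ((⇑(φ i) - g) - (⇑(φ j) - g)) 2 (repMeasure Φ f) := by
        rw [edist_eq_enorm_sub, ← sub_apply, ← map_sub, enorm_rep, sub_sub_sub_cancel_right]
        rfl
    _ ≤ _ := eLpNorm_sub_le hsub hsub' one_le_two
    _ < ε / 2 + ε / 2 := ENNReal.add_lt_add hi hj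
    _ = ε := ENNReal.add_halves ε

theorem exists_represents_repMeasure [TopologicalSpace.PseudoMetrizableSpace X] {s : Set X}
    (hs : MeasurableSet s) :
    ∃ P : H →L[ℂ] H, (∀ f, inner ℂ f (P f) = ((repMeasure Φ f).real s : ℂ)) ∧
      ∀ f, ‖P f‖ ^ 2 = (repMeasure Φ f).real s := by
  classical
  obtain ⟨φ, hφ⟩ := exists_tendsto_eLpNorm_sub_indicator_one (repMeasure Φ) hs
  have hmem (f : H) : MemLp (s.indicator (1 : X → ℝ)) 2 (repMeasure Φ f) :=
    memLp_indicator_const 2 hs 1 (.inr (measure_ne_top _ s))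
  choose p hp using fun f => exists_tendsto_rep Φ (hmem f) (hφ f)
  have hnorm (f : H) : ‖p f‖ ^ 2 = (repMeasure Φ f).real s := by
    have henorm : ‖p f‖ₑ = eLpNorm (s.indicator (1 : X → ℝ)) 2 (repMeasure Φ f) := by
      refine tendsto_nhds_unique (hp f).enorm ?_
      simp only [enorm_rep]
      exact tendsto_eLpNorm_of_tendsto_eLpNorm_sub (fun a => memLp_repMeasure Φ _ f) (hmem f) (hφ f)
    have hsq : ‖p f‖ₑ ^ 2 = repMeasure Φ f s := by
      rw [henorm, eLpNorm_two_sq, ← lintegral_indicator_one hs]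
      refine lintegral_congr fun x => ?_
      by_cases hx : x ∈ s <;> simp [hx]
    rw [measureReal_def, ← hsq, ENNReal.toReal_pow, toReal_enorm]
  refine ⟨(linearMapOfTendsto p (fun a => (Φ (φ a) : H →ₗ[ℂ] H))
    (tendsto_pi_nhds.mpr hp)).mkContinuous 1 fun f => ?_, fun f => ?_, hnorm⟩
  · rw [one_mul]
    refine (pow_le_pow_iff_left₀ (norm_nonneg _) (norm_nonneg f) two_ne_zero).mp ?_
    exact (hnorm f).trans_le ((measureReal_mono (Set.subset_univ s)).trans_eq
      (measureReal_repMeasure_univ Φ f))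
  · refine tendsto_nhds_unique (tendsto_const_nhds.inner (hp f)) ?_
    simp only [inner_rep]
    refine (Complex.continuous_ofReal.tendsto _).comp ?_
    have hint := tendsto_integral_of_tendsto_eLpNorm_sub one_le_two
      (fun a => memLp_repMeasure Φ (φ a) f) (hmem f) (hφ f)
    rwa [integral_indicator_one hs] at hint

end Representation

theorem exists_projMeasure_of_rep {K : Set ℝ} [CompactSpace K] (Φ : C(K, ℝ) →⋆ₐ[ℝ] (H →L[ℂ] H)) :
    ∃ E : ProjMeasure H, ∀ f, E.scalar f = (repMeasure Φ f).map Subtype.val := by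
  have hval := measurable_subtype_coe (p := (· ∈ K))
  choose! P hPinner hPnorm using fun s (hs : MeasurableSet s) =>
    exists_represents_repMeasure Φ (hval hs)
  have hP : Represents (fun f => (repMeasure Φ f).map Subtype.val) P :=
    ⟨fun s hs f => by rw [hPinner s hs, map_measureReal_apply hval hs],
      fun s hs f => by rw [hPnorm s hs, map_measureReal_apply hval hs]⟩
  exact ⟨hP.toProjMeasure fun f => by
    rw [map_measureReal_apply hval .univ, Set.preimage_univ, measureReal_repMeasure_univ],
    hP.scalar_toProjMeasure _⟩

theorem exists_projMeasure_of_isSelfAdjoint {Q : H →L[ℂ] H} (hQ : IsSelfAdjoint Q) :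
    ∃ E : ProjMeasure H, E.toPMap = ofCLM Q := by
  obtain ⟨E, hE⟩ := exists_projMeasure_of_rep (cfcHom hQ)
  have hK : MeasurableSet (spectrum ℝ Q) := (spectrum.isCompact Q).measurableSet
  obtain ⟨C, hC⟩ := (spectrum.isCompact (𝕜 := ℝ) Q).isBounded.exists_norm_le
  have hb : IsBoundedBorel ((spectrum ℝ Q).indicator fun t : ℝ => (t : ℂ)) :=
    .indicator_of_le Complex.measurable_ofReal hK fun t ht => by
      rw [Complex.norm_real]
      exact hC t ht
  have hae (f : H) : (fun t : ℝ => (t : ℂ)) =ᵐ[E.scalar f]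
      (spectrum ℝ Q).indicator fun t => (t : ℂ) := by
    have hmem : ∀ᵐ t ∂(E.scalar f), t ∈ spectrum ℝ Q := by
      rw [hE]
      exact (ae_map_iff measurable_subtype_coe.aemeasurable hK).mpr (.of_forall Subtype.property)
    filter_upwards [hmem] with t ht
    rw [Set.indicator_of_mem ht]
  refine ⟨E, ?_⟩
  rw [ProjMeasure.toPMap, E.integral_congr (hh := hb.measurable) hae,
    ProjMeasure.integral_eq_ofCLM hb]
  congr 1
  refine inner_self_apply_ext fun f => ?_
  rw [ProjMeasure.op_apply hb, E.inner_integralAt hb.measurable (hb.memLp _),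
    ← integral_congr_ae (hae f), hE, integral_map measurable_subtype_coe.aemeasurable
      Complex.measurable_ofReal.aestronglyMeasurable]
  have hid := inner_rep (cfcHom hQ) (ContinuousMap.restrict (spectrum ℝ Q) (.id ℝ)) f
  rw [cfcHom_id hQ] at hid
  exact integral_ofReal.trans hid.symm

namespace ProjMeasure

variable {E : ProjMeasure H} {g : ℝ → ℂ} {hg : Measurable g}

theorem ae_ne_zero_of_forall_mem_graph (hker : ∀ u, (u, 0) ∈ (E.integral g hg).graph → u = 0)
    (f : H) : ∀ᵐ t ∂(E.scalar f), g t ≠ 0 := by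
  have hs : MeasurableSet (g ⁻¹' {0}) := hg (measurableSet_singleton 0)
  have hz : (g ⁻¹' {0}).indicator g = fun _ => 0 := by
    ext t
    by_cases ht : g t = 0 <;> simp [ht]
  have hgraph := mem_graph_integral_proj (E := E) hg hs (hz ▸ .const 0) f
  rw [hz, op_const, zero_smul] at hgraph
  exact compl_mem_ae_iff.mpr ((E.scalar_eq_zero_iff hs).mpr (hker _ hgraph))

theorem mem_graph_integral_inv_of_mem (h0 : ∀ f, ∀ᵐ t ∂(E.scalar f), g t ≠ 0) {u v : H}
    (h : (u, v) ∈ (E.integral g hg).graph) : (v, u) ∈ (E.integral g⁻¹ hg.inv).graph := by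
  obtain ⟨hmem, rfl⟩ := E.mem_graph_integral.mp h
  have hone : g⁻¹ * g =ᵐ[E.scalar u] fun _ => 1 := by
    filter_upwards [h0 u] with t ht
    exact inv_mul_cancel₀ ht
  have hmem' : MemLp (g⁻¹ * g) 2 (E.scalar u) :=
    (memLp_congr_ae hone).mpr ((IsBoundedBorel.const 1).memLp _)
  rw [mem_graph_integral, E.memLp_scalar_integralAt hg.inv hmem,
    E.integralAt_integralAt hg.inv hmem hmem']
  refine ⟨hmem', ?_⟩
  rw [E.integralAt_congr (hh := measurable_const) hone hmem', ← op_apply (.const 1), op_const,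
    one_smul, one_apply_eq_self]

theorem mem_graph_integral_inv_iff (h0 : ∀ f, ∀ᵐ t ∂(E.scalar f), g t ≠ 0) {u v : H} :
    (v, u) ∈ (E.integral g⁻¹ hg.inv).graph ↔ (u, v) ∈ (E.integral g hg).graph := by
  refine ⟨fun h => ?_, mem_graph_integral_inv_of_mem h0⟩
  have hinv :=
    mem_graph_integral_inv_of_mem (fun f => (h0 f).mono fun t => inv_ne_zero (a := g t)) h
  simpa only [show (fun t => (g t)⁻¹)⁻¹ = g from inv_inv g] using hinv

variable (E) in
theorem mem_graph_integral_add_const_iff (c : ℂ) {u v : H} :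
    (u, v + c • u) ∈ (E.integral (g + fun _ => c) (hg.add measurable_const)).graph ↔
      (u, v) ∈ (E.integral g hg).graph := by
  have hc : MemLp (fun _ : ℝ => c) 2 (E.scalar u) := (IsBoundedBorel.const c).memLp _
  have hadd : MemLp (g + fun _ => c) 2 (E.scalar u) ↔ MemLp g 2 (E.scalar u) :=
    ⟨fun h => by simpa using h.sub hc, fun h => h.add hc⟩
  rw [mem_graph_integral, mem_graph_integral, hadd]
  refine and_congr_right fun hgu => ?_
  rw [E.integralAt_add hg measurable_const hgu hc, ← op_apply (.const c), op_const, smul_apply,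
    one_apply_eq_self, add_left_inj]

end ProjMeasure

/- The hypothesis `hA` encodes `A = Q⁻¹ - c`. -/
theorem exists_projMeasure_of_resolvent {A : H →ₗ.[ℂ] H} {Q : H →L[ℂ] H} (hQ : IsSelfAdjoint Q)
    (c : ℝ) (hA : ∀ f h, (f, h) ∈ A.graph ↔ Q (h + (c : ℂ) • f) = f) :
    ∃ E : ProjMeasure H, E.toPMap = A := by
  obtain ⟨E, hE⟩ := exists_projMeasure_of_isSelfAdjoint hQ
  have hEQ {u v : H} : (u, v) ∈ E.toPMap.graph ↔ Q u = v := by rw [hE, mem_graph_ofCLM, eq_comm]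
  have h0 (f : H) : ∀ᵐ t : ℝ ∂(E.scalar f), (t : ℂ) ≠ 0 :=
    ProjMeasure.ae_ne_zero_of_forall_mem_graph (hg := Complex.measurable_ofReal)
      (fun u hu => A.graph_fst_eq_zero_snd ((hA 0 u).mpr (by simpa using hEQ.mp hu)) rfl) f
  have hφ : Measurable fun t : ℝ => t⁻¹ - c := measurable_inv.sub_const c
  have hcomp : (fun t : ℝ => (t : ℂ)) ∘ (fun t : ℝ => t⁻¹ - c)
      = (fun t : ℝ => (t : ℂ))⁻¹ + fun _ => -(c : ℂ) := by
    ext t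
    simp [sub_eq_add_neg]
  refine ⟨E.map _ hφ, ext_graph fun f h => ?_⟩
  rw [ProjMeasure.toPMap, ProjMeasure.integral_map hφ, hA, ← hEQ,
    ← ProjMeasure.mem_graph_integral_inv_iff (hg := Complex.measurable_ofReal) h0]
  have hadd := E.mem_graph_integral_add_const_iff (hg := Complex.measurable_ofReal.inv)
    (-(c : ℂ)) (u := f) (v := h + (c : ℂ) • f)
  rw [neg_smul, add_neg_cancel_right] at hadd
  simp only [hcomp]
  exact hadd

theorem integral_spectralMeasure {A : H →ₗ.[ℂ] H} (h : ∃ E : ProjMeasure H, E.toPMap = A) :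
    (spectralMeasure A).toPMap = A := by
  rw [spectralMeasure, dif_pos h]
  exact h.choose_spec

/-! ### Nonnegative operators -/

namespace ProjMeasure

variable {E : ProjMeasure H}

theorem inner_proj_op_indicator {g : ℝ → ℂ} {s : Set ℝ} (hs : MeasurableSet s)
    (hg : IsBoundedBorel (s.indicator g)) (f : H) :
    inner ℂ (E.proj s f) (E.op (s.indicator g) f) = ∫ t in s, g t ∂(E.scalar f) := by
  rw [← ContinuousLinearMap.adjoint_inner_right, E.adjoint_proj hs, ← mul_apply_eq_comp,
    ← op_indicator hs hg, Set.indicator_indicator, Set.inter_self, op_apply hg,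
    E.inner_integralAt hg.measurable (hg.memLp _), integral_indicator hs]

theorem ae_nonneg (hE : ∀ f h, (f, h) ∈ E.toPMap.graph → 0 ≤ (inner ℂ f h).re) (f : H) :
    ∀ᵐ t ∂(E.scalar f), 0 ≤ t := by
  have hIco (n : ℕ) : ∀ᵐ t ∂(E.scalar f), t ∉ Set.Ico (-(n : ℝ)) 0 := by
    set s := Set.Ico (-(n : ℝ)) 0
    have hs : MeasurableSet s := measurableSet_Ico
    have hbound : ∀ t ∈ s, ‖t‖ ≤ n := fun t ht => by
      rw [Real.norm_eq_abs, abs_of_neg ht.2]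
      exact neg_le.mp ht.1
    have hb : IsBoundedBorel (s.indicator fun t : ℝ => (t : ℂ)) :=
      .indicator_of_le Complex.measurable_ofReal hs fun t ht => by
        rw [Complex.norm_real]
        exact hbound t ht
    have hint : IntegrableOn (fun t : ℝ => -t) s (E.scalar f) :=
      .of_bound (measure_lt_top _ _) measurable_neg.aestronglyMeasurable n
        ((ae_restrict_iff' hs).mpr (.of_forall fun t ht => by simpa using hbound t ht))
    have hnonneg : 0 ≤ᵐ[(E.scalar f).restrict s] fun t : ℝ => -t :=
      (ae_restrict_iff' hs).mpr (.of_forall fun t ht => neg_nonneg.mpr ht.2.le)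
    have hle := hE _ _ (mem_graph_integral_proj Complex.measurable_ofReal hs hb f)
    rw [inner_proj_op_indicator hs hb, integral_complex_ofReal, Complex.ofReal_re] at hle
    have hzero : ∫ t in s, -t ∂(E.scalar f) = 0 :=
      le_antisymm (by rw [integral_neg]; exact neg_nonpos.mpr hle)
        (integral_nonneg_of_ae hnonneg)
    rw [setIntegral_eq_zero_iff_of_nonneg_ae hnonneg hint] at hzero
    filter_upwards [(ae_restrict_iff' hs).mp hzero] with t ht hts
    exact hts.2.ne (neg_eq_zero.mp (ht hts))
  filter_upwards [ae_all_iff.mpr hIco] with t ht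
  obtain ⟨n, hn⟩ := exists_nat_ge (-t)
  exact le_of_not_gt fun hlt => ht n ⟨neg_le.mp hn, hlt⟩

theorem mem_graph_opMul_integral {g h : ℝ → ℂ} (hg : Measurable g) (hh : Measurable h) {f k : H} :
    (f, k) ∈ (opMul (E.integral g hg) (E.integral h hh)).graph ↔
      MemLp h 2 (E.scalar f) ∧ (f, k) ∈ (E.integral (g * h) (hg.mul hh)).graph := by
  rw [mem_graph_opMul]
  simp only [mem_graph_integral]
  constructor
  · rintro ⟨_, ⟨hhf, rfl⟩, hgf, rfl⟩
    rw [E.memLp_scalar_integralAt hg hhf] at hgf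
    exact ⟨hhf, hgf, (E.integralAt_integralAt hg hhf hgf).symm⟩
  · rintro ⟨hhf, hgf, rfl⟩
    exact ⟨_, ⟨hhf, rfl⟩, (E.memLp_scalar_integralAt hg hhf).mpr hgf,
      E.integralAt_integralAt hg hhf hgf⟩

end ProjMeasure

/-! ### Closed operators -/

theorem inner_eq_of_mem_graph_adjoint {S : H →ₗ.[ℂ] H} (hd : Dense (S.domain : Set H))
    {f k u v : H} (hf : (f, k) ∈ S.graph) (hu : (u, v) ∈ S†.graph) :
    inner ℂ v f = inner ℂ u k := by
  obtain ⟨hfd, rfl⟩ := mem_graph_iff_exists.mp hf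
  exact (mem_graph_adjoint_iff hd).mp hu ⟨f, hfd⟩

theorem mem_orthogonal_range_iff {S : H →ₗ.[ℂ] H} (hd : Dense (S.domain : Set H)) {f : H} :
    f ∈ (LinearMap.range S.toFun)ᗮ ↔ (f, (0 : H)) ∈ S†.graph := by
  rw [mem_graph_adjoint_iff hd, Submodule.mem_orthogonal']
  simp only [inner_zero_left, LinearMap.mem_range, forall_exists_index, forall_apply_eq_imp_iff]
  exact forall_congr' fun x => eq_comm

/-- The graph of `S` as a subspace of the Hilbert space `H ⊕ H`. -/
def l2graph (S : H →ₗ.[ℂ] H) : Submodule ℂ (WithLp 2 (H × H)) :=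
  S.graph.comap (WithLp.linearEquiv 2 ℂ (H × H)).toLinearMap

omit [CompleteSpace H] in
theorem mem_l2graph {S : H →ₗ.[ℂ] H} {x : WithLp 2 (H × H)} :
    x ∈ l2graph S ↔ (x.fst, x.snd) ∈ S.graph := Iff.rfl

omit [CompleteSpace H] in
theorem isClosed_l2graph {S : H →ₗ.[ℂ] H} (hS : S.IsClosed) :
    IsClosed (l2graph S : Set (WithLp 2 (H × H))) :=
  IsClosed.preimage (WithLp.prodContinuousLinearEquiv 2 ℂ H H).continuous hS

theorem mem_orthogonal_l2graph {S : H →ₗ.[ℂ] H} (hd : Dense (S.domain : Set H))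
    {x : WithLp 2 (H × H)} : x ∈ (l2graph S)ᗮ ↔ (x.snd, -x.fst) ∈ S†.graph := by
  rw [Submodule.mem_orthogonal']
  constructor
  · refine fun h => (mem_graph_adjoint_iff hd).mpr fun v => ?_
    have hv := h (WithLp.toLp 2 ((v : H), S v)) (S.mem_graph v)
    rw [WithLp.prod_inner_apply] at hv
    rw [inner_neg_left]
    exact (eq_neg_of_add_eq_zero_right hv).symm
  · intro h y hy
    have hxy := inner_eq_of_mem_graph_adjoint hd (mem_l2graph.mp hy) h
    rw [inner_neg_left] at hxy
    rw [WithLp.prod_inner_apply]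
    exact add_eq_zero_iff_neg_eq.mpr hxy

section Closed

variable {S : H →ₗ.[ℂ] H} (hS : S.IsClosed) (hd : Dense (S.domain : Set H))
include hS hd

theorem exists_mem_graph_sub_mem_graph_adjoint (f h : H) :
    ∃ u k, (u, k) ∈ S.graph ∧ (h - k, u - f) ∈ S†.graph := by
  have : CompleteSpace (l2graph S) := (isClosed_l2graph hS).completeSpace_coe
  obtain ⟨y, hy, z, hz, hyz⟩ := (l2graph S).exists_add_mem_mem_orthogonal (WithLp.toLp 2 (f, h))
  obtain rfl : z = WithLp.toLp 2 (f, h) - y := eq_sub_of_add_eq' hyz.symm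
  refine ⟨y.fst, y.snd, mem_l2graph.mp hy, ?_⟩
  rw [← neg_sub f]
  exact (mem_orthogonal_l2graph hd).mp hz

theorem adjoint_adjoint_of_isClosed (hd' : Dense (S†.domain : Set H)) : S†† = S := by
  have hle {f h : H} (hf : (f, h) ∈ S.graph) : (f, h) ∈ S††.graph :=
    (mem_graph_adjoint_iff hd').mpr fun y => by
      rw [← inner_conj_symm, ← inner_conj_symm f,
        inner_eq_of_mem_graph_adjoint hd hf (S†.mem_graph y)]
  refine ext_graph fun f h => ⟨fun hf => ?_, hle⟩
  obtain ⟨u, k, hu, hsub⟩ := exists_mem_graph_sub_mem_graph_adjoint hS hd f h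
  have hinner := inner_eq_of_mem_graph_adjoint hd' hsub (S††.graph.sub_mem hf (hle hu))
  have hnorm : ‖h - k‖ ^ 2 + ‖f - u‖ ^ 2 = 0 := by
    change inner ℂ (h - k) (h - k) = inner ℂ (f - u) (u - f) at hinner
    rw [← neg_sub f u, inner_neg_right, ← add_eq_zero_iff_eq_neg, inner_self_eq_norm_sq_to_K,
      inner_self_eq_norm_sq_to_K] at hinner
    exact Complex.ofReal_injective (by push_cast; exact hinner)
  obtain ⟨hk, hf0⟩ := (add_eq_zero_iff_of_nonneg (sq_nonneg _) (sq_nonneg _)).mp hnorm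
  rw [sq_eq_zero_iff, norm_eq_zero, sub_eq_zero] at hk hf0
  rwa [hk, hf0]

/-- Von Neumann's theorem: `S† S` is self-adjoint, since `(1 + S† S)⁻¹` is the compression to the
first summand of the orthogonal projection of `H ⊕ H` onto the graph of `S`. -/
theorem exists_projMeasure_adjoint_mul_self : ∃ E : ProjMeasure H, E.toPMap = opMul S† S := by
  have : CompleteSpace (l2graph S) := (isClosed_l2graph hS).completeSpace_coe
  let J : H →L[ℂ] WithLp 2 (H × H) :=
    ((WithLp.prodContinuousLinearEquiv 2 ℂ H H).symm : (H × H) →L[ℂ] WithLp 2 (H × H)) ∘L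
      ContinuousLinearMap.inl ℂ H H
  let Q : H →L[ℂ] H := WithLp.fstL 2 ℂ H H ∘L (l2graph S).starProjection ∘L J
  have hinner (f : H) (x : WithLp 2 (H × H)) : inner ℂ x (J f) = inner ℂ x.fst f := by
    rw [WithLp.prod_inner_apply]
    exact (congr_arg _ (inner_zero_right _)).trans (add_zero _)
  have hQ : IsSelfAdjoint Q := by
    refine ContinuousLinearMap.isSelfAdjoint_iff_isSymmetric.mpr fun f g => ?_
    calc inner ℂ (Q f) g = inner ℂ ((l2graph S).starProjection (J f)) (J g) := (hinner g _).symm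
      _ = inner ℂ (J f) ((l2graph S).starProjection (J g)) :=
        Submodule.inner_starProjection_left_eq_right _ _ _
      _ = inner ℂ f (Q g) := by rw [← inner_conj_symm, hinner, inner_conj_symm]; rfl
  refine exists_projMeasure_of_resolvent hQ 1 fun f h => ?_
  rw [Complex.ofReal_one, one_smul, mem_graph_opMul]
  constructor
  · rintro ⟨k, hk, hkh⟩
    have horth : J (h + f) - WithLp.toLp 2 (f, k) ∈ (l2graph S)ᗮ := by
      rw [mem_orthogonal_l2graph hd]
      change ((0 : H) - k, -(h + f - f)) ∈ _
      simpa using S†.graph.neg_mem hkh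
    exact congr_arg WithLp.fst (Submodule.eq_starProjection_of_mem_orthogonal
      (v := WithLp.toLp 2 (f, k)) (mem_l2graph.mpr hk) horth)
  · intro hf
    have horth := (l2graph S).sub_starProjection_mem_orthogonal (J (h + f))
    have hmem := mem_l2graph.mp ((l2graph S).starProjection_apply_mem (J (h + f)))
    set y := (l2graph S).starProjection (J (h + f))
    rw [mem_orthogonal_l2graph hd] at horth
    change ((0 : H) - y.snd, -(h + f - y.fst)) ∈ _ at horth
    replace hf : y.fst = f := hf
    rw [hf] at horth hmem
    exact ⟨y.snd, hmem, by simpa using S†.graph.neg_mem horth⟩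

theorem exists_seq_mem_graph_adjoint_mul_self {f h : H} (hf : (f, h) ∈ S.graph) :
    ∃ u k : ℕ → H, (∀ n, u n ∈ (opMul S† S).domain) ∧ (∀ n, (u n, k n) ∈ S.graph) ∧
      Tendsto u atTop (𝓝 f) ∧ Tendsto k atTop (𝓝 h) := by
  let K : Submodule ℂ (WithLp 2 (H × H)) :=
    l2graph S ⊓ (opMul S† S).domain.comap (WithLp.fstL 2 ℂ H H).toLinearMap
  have hKS : K.topologicalClosure ≤ l2graph S :=
    K.topologicalClosure_minimal inf_le_left (isClosed_l2graph hS)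
  obtain ⟨y, hy, z, hz, hyz⟩ := K.topologicalClosure.exists_add_mem_mem_orthogonal
    (WithLp.toLp 2 (f, h))
  rw [Submodule.orthogonal_closure] at hz
  have hzS : z ∈ l2graph S := by
    rw [eq_sub_of_add_eq' hyz.symm]
    exact (l2graph S).sub_mem hf (hKS hy)
  obtain ⟨u, k, hu, hk⟩ := exists_mem_graph_sub_mem_graph_adjoint hS hd z.fst 0
  have hk' : (k, z.fst - u) ∈ S†.graph := by simpa using S†.graph.neg_mem hk
  have hmem : WithLp.toLp 2 (u, k) ∈ K :=
    ⟨hu, LinearPMap.mem_domain_of_mem_graph (mem_graph_opMul.mpr ⟨k, hu, hk'⟩)⟩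
  have hfst : inner ℂ z.fst z.fst = 0 := by
    have horth := (Submodule.mem_orthogonal _ _).mp hz _ hmem
    have hadj : inner ℂ (z.fst - u) z.fst = inner ℂ k z.snd :=
      inner_eq_of_mem_graph_adjoint hd hzS hk'
    rw [← sub_add_cancel (inner ℂ z.fst z.fst) (inner ℂ u z.fst), ← inner_sub_left, hadj, add_comm]
    exact horth
  have hfst0 : z.fst = 0 := inner_self_eq_zero.mp hfst
  have hsnd0 : z.snd = 0 := S.graph_fst_eq_zero_snd hzS hfst0
  have hz0 : z = 0 := congr_arg (WithLp.toLp 2) (Prod.ext hfst0 hsnd0)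
  rw [hz0, add_zero] at hyz
  obtain ⟨x, hxK, hx⟩ := mem_closure_iff_seq_limit.mp (hyz ▸ hy)
  exact ⟨fun n => (x n).fst, fun n => (x n).snd, fun n => (hxK n).2, fun n => (hxK n).1,
    ((WithLp.fstL 2 ℂ H H).continuous.tendsto _).comp hx,
    ((WithLp.sndL 2 ℂ H H).continuous.tendsto _).comp hx⟩

end Closed

section EqualModuli

variable {A B : H →ₗ.[ℂ] H}

theorem norm_eq_of_adjoint_mul_self_eq (hA : Dense (A.domain : Set H))
    (hB : Dense (B.domain : Set H)) (hAB : opMul A† A = opMul B† B) {u h m : H}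
    (hu : u ∈ (opMul A† A).domain) (hh : (u, h) ∈ A.graph) (hm : (u, m) ∈ B.graph) :
    ‖h‖ = ‖m‖ := by
  obtain ⟨w, hw⟩ := LinearPMap.mem_domain_iff.mp hu
  obtain ⟨h', hh', hhw⟩ := mem_graph_opMul.mp hw
  obtain ⟨m', hm', hmw⟩ := mem_graph_opMul.mp (hAB ▸ hw)
  obtain rfl := LinearPMap.mem_graph_snd_inj _ hh hh' rfl
  obtain rfl := LinearPMap.mem_graph_snd_inj _ hm hm' rfl
  have hinner : inner ℂ h h = inner ℂ m m :=
    (inner_eq_of_mem_graph_adjoint hA hh hhw).symm.trans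
      (inner_eq_of_mem_graph_adjoint hB hm hmw)
  rw [inner_self_eq_norm_sq_to_K, inner_self_eq_norm_sq_to_K] at hinner
  refine (sq_eq_sq₀ (norm_nonneg _) (norm_nonneg _)).mp (Complex.ofReal_injective ?_)
  push_cast
  exact hinner

theorem exists_mem_graph_of_adjoint_mul_self_eq (hA : A.IsClosed) (hAd : Dense (A.domain : Set H))
    (hB : B.IsClosed) (hBd : Dense (B.domain : Set H)) (hAB : opMul A† A = opMul B† B) {f h : H}
    (hf : (f, h) ∈ A.graph) : ∃ m, (f, m) ∈ B.graph ∧ ‖m‖ = ‖h‖ := by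
  obtain ⟨u, k, hu, huk, hulim, hklim⟩ := exists_seq_mem_graph_adjoint_mul_self hA hAd hf
  have huB (n : ℕ) : ∃ m, (u n, m) ∈ B.graph := by
    obtain ⟨w, hw⟩ := LinearPMap.mem_domain_iff.mp (hAB ▸ hu n)
    obtain ⟨m, hm, -⟩ := mem_graph_opMul.mp hw
    exact ⟨m, hm⟩
  choose m hm using huB
  have hdist (i j : ℕ) : dist (m i) (m j) = dist (k i) (k j) := by
    rw [dist_eq_norm, dist_eq_norm]
    exact (norm_eq_of_adjoint_mul_self_eq hAd hBd hAB ((opMul A† A).domain.sub_mem (hu i) (hu j))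
      (A.graph.sub_mem (huk i) (huk j)) (B.graph.sub_mem (hm i) (hm j))).symm
  have hmc : CauchySeq m := by
    have hkc := hklim.cauchySeq
    rw [Metric.cauchySeq_iff] at hkc ⊢
    simpa only [hdist] using hkc
  obtain ⟨y, hy⟩ := cauchySeq_tendsto_of_complete hmc
  refine ⟨y, hB.mem_of_tendsto (hulim.prodMk_nhds hy) (.of_forall hm), ?_⟩
  exact tendsto_nhds_unique hy.norm (hklim.norm.congr fun n =>
    norm_eq_of_adjoint_mul_self_eq hAd hBd hAB (hu n) (huk n) (hm n))

end EqualModuli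

/-! ### The absolute value and the polar decomposition -/

/-- The principal square root, as a function on `ℝ`. -/
abbrev csqrt (t : ℝ) : ℂ := (t : ℂ) ^ (1 / 2 : ℂ)

theorem csqrt_mul_self (t : ℝ) : csqrt t * csqrt t = t := by
  have h := Complex.cpow_nat_inv_pow (t : ℂ) two_ne_zero
  rw [sq] at h
  simpa only [csqrt, one_div, Nat.cast_ofNat] using h

theorem csqrt_of_nonneg {t : ℝ} (ht : 0 ≤ t) : csqrt t = ((√t : ℝ) : ℂ) := by
  rw [csqrt, Real.sqrt_eq_rpow, Complex.ofReal_cpow ht]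
  norm_num

theorem norm_csqrt_le (t : ℝ) : ‖csqrt t‖ ≤ 1 + ‖(t : ℂ)‖ := by
  rw [← csqrt_mul_self t, norm_mul]
  nlinarith [norm_nonneg (csqrt t), sq_nonneg (‖csqrt t‖ - 1)]

theorem measurable_csqrt : Measurable csqrt := measurable_cpow_ofReal _

theorem memLp_csqrt {μ : Measure ℝ} [IsFiniteMeasure μ] (h : MemLp (fun t : ℝ => (t : ℂ)) 2 μ) :
    MemLp csqrt 2 μ := by
  have hone : MemLp (fun _ : ℝ => (1 : ℝ)) 2 μ := memLp_const 1
  have hbound : MemLp (fun t : ℝ => (1 : ℝ) + ‖(t : ℂ)‖) 2 μ := hone.add h.norm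
  refine hbound.of_le measurable_csqrt.aestronglyMeasurable (.of_forall fun t => ?_)
  rw [Real.norm_of_nonneg (by positivity)]
  exact norm_csqrt_le t

theorem dense_domain_absOp {S : H →ₗ.[ℂ] H} : Dense ((absOp S).domain : Set H) :=
  ProjMeasure.dense_domain_integral _

theorem isClosed_absOp {S : H →ₗ.[ℂ] H} : (absOp S).IsClosed :=
  ProjMeasure.isClosed_integral _

theorem exists_continuousLinearMap_of_norm_eq {D : Type*} [AddCommGroup D] [Module ℂ D]
    {a b : D →ₗ[ℂ] H} (hab : ∀ x, ‖a x‖ = ‖b x‖) :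
    ∃ U : H →L[ℂ] H, (∀ x, U (b x) = a x) ∧ ∀ y ∈ (LinearMap.range b)ᗮ, U y = 0 := by
  set R := LinearMap.range b
  let e : D × Rᗮ →ₗ[ℂ] H := b.coprod Rᗮ.subtype
  let g : D × Rᗮ →ₗ[ℂ] H := a ∘ₗ LinearMap.fst ℂ _ _
  have hdense : DenseRange e := by
    refine (Submodule.dense_iff_topologicalClosure_eq_top (s := LinearMap.range e)).mpr ?_
    rw [Submodule.topologicalClosure_eq_top_iff, LinearMap.range_coprod, Submodule.range_subtype,
      ← Submodule.inf_orthogonal]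
    exact Submodule.inf_orthogonal_eq_bot _
  have hle : ∀ x, ‖g x‖ ≤ 1 * ‖e x‖ := by
    rintro ⟨x, y⟩
    change ‖a x‖ ≤ 1 * ‖b x + (y : H)‖
    have hxy : inner ℂ (b x) (y : H) = 0 := (Submodule.mem_orthogonal _ _).mp y.2 _ ⟨x, rfl⟩
    have hpyth := norm_add_sq_eq_norm_sq_add_norm_sq_of_inner_eq_zero _ _ hxy
    rw [hab, one_mul]
    nlinarith [norm_nonneg (b x + (y : H)), norm_nonneg (b x), norm_nonneg (y : H)]
  have hU : ∀ x, g.extendOfNorm e (e x) = g x := LinearMap.extendOfNorm_eq hdense ⟨1, hle⟩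
  exact ⟨g.extendOfNorm e, fun x => by simpa [e, g] using! hU (x, 0),
    fun y hy => by simpa [e, g] using! hU (0, ⟨y, hy⟩)⟩

section Isometry

variable {D : Type*} [AddCommGroup D] [Module ℂ D] {a b : D →ₗ[ℂ] H} {U : H →L[ℂ] H}
  (hab : ∀ x, ‖a x‖ = ‖b x‖) (hUb : ∀ x, U (b x) = a x)
include hab hUb

omit [CompleteSpace H] in
theorem norm_apply_of_mem_closure_range {f : H}
    (hf : f ∈ (LinearMap.range b).topologicalClosure) : ‖U f‖ = ‖f‖ := by
  refine closure_minimal (t := {v | ‖U v‖ = ‖v‖}) ?_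
    (isClosed_eq U.continuous.norm continuous_norm) hf
  rintro _ ⟨x, rfl⟩
  exact (congr_arg norm (hUb x)).trans (hab x)

theorem ker_eq_orthogonal_range (hU0 : ∀ y ∈ (LinearMap.range b)ᗮ, U y = 0) :
    LinearMap.ker (U : H →ₗ[ℂ] H) = (LinearMap.range b)ᗮ := by
  refine le_antisymm (fun f hf => ?_) hU0
  obtain ⟨p, hp, y, hy, rfl⟩ :=
    (LinearMap.range b).topologicalClosure.exists_add_mem_mem_orthogonal f
  rw [Submodule.orthogonal_closure] at hy
  have hUp : U p = 0 := by simpa [hU0 y hy] using hf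
  have hp0 := norm_apply_of_mem_closure_range hab hUb hp
  rw [hUp, norm_zero, eq_comm, norm_eq_zero] at hp0
  rwa [hp0, zero_add]

end Isometry

section AbsoluteValue

variable {S : H →ₗ.[ℂ] H} (hS : S.IsClosed) (hd : Dense (S.domain : Set H))
include hS hd

theorem toPMap_spectralMeasure_adjoint_mul_self :
    (spectralMeasure (opMul S† S)).toPMap = opMul S† S :=
  integral_spectralMeasure (exists_projMeasure_adjoint_mul_self hS hd)

theorem ae_nonneg_adjoint_mul_self (f : H) :
    ∀ᵐ t ∂((spectralMeasure (opMul S† S)).scalar f), 0 ≤ t := by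
  refine ProjMeasure.ae_nonneg (fun f h hf => ?_) f
  rw [toPMap_spectralMeasure_adjoint_mul_self hS hd] at hf
  obtain ⟨k, hk, hkh⟩ := mem_graph_opMul.mp hf
  rw [← inner_conj_symm, inner_eq_of_mem_graph_adjoint hd hk hkh, Complex.conj_re]
  exact inner_self_nonneg (𝕜 := ℂ)

theorem adjoint_absOp : (absOp S)† = absOp S := by
  refine (ProjMeasure.adjoint_integral measurable_csqrt).trans
    (ProjMeasure.integral_congr _ fun f => ?_)
  filter_upwards [ae_nonneg_adjoint_mul_self hS hd f] with t ht
  rw [csqrt_of_nonneg ht, Complex.conj_ofReal]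
  exact (csqrt_of_nonneg ht).symm

theorem opMul_absOp_self : opMul (absOp S) (absOp S) = opMul S† S := by
  have hsq : csqrt * csqrt = fun t : ℝ => (t : ℂ) := funext csqrt_mul_self
  conv_rhs => rw [← toPMap_spectralMeasure_adjoint_mul_self hS hd]
  refine ext_graph fun f h => ?_
  refine (ProjMeasure.mem_graph_opMul_integral measurable_csqrt measurable_csqrt).trans ?_
  simp only [hsq]
  exact and_iff_right_of_imp fun h =>
    memLp_csqrt ((ProjMeasure.mem_graph_integral _).mp h).1

theorem adjoint_absOp_mul_self : opMul (absOp S)† (absOp S) = opMul S† S := by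
  rw [adjoint_absOp hS hd, opMul_absOp_self hS hd]

theorem exists_mem_graph_absOp {f h : H} (hf : (f, h) ∈ S.graph) :
    ∃ m, (f, m) ∈ (absOp S).graph ∧ ‖m‖ = ‖h‖ :=
  exists_mem_graph_of_adjoint_mul_self_eq hS hd isClosed_absOp dense_domain_absOp
    (adjoint_absOp_mul_self hS hd).symm hf

theorem exists_mem_graph_of_absOp {f m : H} (hf : (f, m) ∈ (absOp S).graph) :
    ∃ h, (f, h) ∈ S.graph ∧ ‖h‖ = ‖m‖ :=
  exists_mem_graph_of_adjoint_mul_self_eq isClosed_absOp dense_domain_absOp hS hd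
    (adjoint_absOp_mul_self hS hd) hf

theorem mem_graph_absOp_zero_iff {f : H} :
    (f, (0 : H)) ∈ (absOp S).graph ↔ (f, (0 : H)) ∈ S.graph := by
  constructor
  · intro h
    obtain ⟨k, hk, hk0⟩ := exists_mem_graph_of_absOp hS hd h
    rw [norm_zero, norm_eq_zero] at hk0
    rwa [hk0] at hk
  · intro h
    obtain ⟨m, hm, hm0⟩ := exists_mem_graph_absOp hS hd h
    rw [norm_zero, norm_eq_zero] at hm0
    rwa [hm0] at hm

theorem domain_absOp : (absOp S).domain = S.domain := by
  ext f
  simp only [LinearPMap.mem_domain_iff]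
  constructor
  · rintro ⟨m, hm⟩
    obtain ⟨h, hh, -⟩ := exists_mem_graph_of_absOp hS hd hm
    exact ⟨h, hh⟩
  · rintro ⟨h, hh⟩
    obtain ⟨m, hm, -⟩ := exists_mem_graph_absOp hS hd hh
    exact ⟨m, hm⟩

theorem toPMap_spectralMeasure_absOp : (spectralMeasure (absOp S)).toPMap = absOp S := by
  refine integral_spectralMeasure
    ⟨(spectralMeasure (opMul S† S)).map Real.sqrt Real.continuous_sqrt.measurable, ?_⟩
  refine (ProjMeasure.integral_map _ _).trans (ProjMeasure.integral_congr _ fun f => ?_)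
  filter_upwards [ae_nonneg_adjoint_mul_self hS hd f] with t ht
  exact (csqrt_of_nonneg ht).symm

theorem ae_nonneg_absOp (f : H) : ∀ᵐ t ∂((spectralMeasure (absOp S)).scalar f), 0 ≤ t := by
  refine ProjMeasure.ae_nonneg (fun f h hf => ?_) f
  rw [toPMap_spectralMeasure_absOp hS hd] at hf
  obtain ⟨hmem, rfl⟩ := (ProjMeasure.mem_graph_integral _).mp hf
  have hsqrt : ∫ t, csqrt t ∂((spectralMeasure (opMul S† S)).scalar f)
      = ((∫ t, √t ∂((spectralMeasure (opMul S† S)).scalar f) : ℝ) : ℂ) := by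
    rw [← integral_complex_ofReal]
    refine integral_congr_ae ?_
    filter_upwards [ae_nonneg_adjoint_mul_self hS hd f] with t ht
    exact csqrt_of_nonneg ht
  rw [ProjMeasure.inner_integralAt _ _ hmem, hsqrt, Complex.ofReal_re]
  exact integral_nonneg fun t => Real.sqrt_nonneg t

theorem exists_isPolarFactor : ∃ U : H →L[ℂ] H, IsPolarFactor S U := by
  let a : (absOp S).domain →ₗ[ℂ] H := S.toFun ∘ₗ Submodule.inclusion (domain_absOp hS hd).le
  have hab (x : (absOp S).domain) : ‖a x‖ = ‖(absOp S).toFun x‖ := by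
    obtain ⟨h, hh, hnorm⟩ := exists_mem_graph_of_absOp hS hd ((absOp S).mem_graph x)
    exact (congr_arg norm (LinearPMap.mem_graph_snd_inj _ (S.mem_graph _) hh rfl)).trans hnorm
  obtain ⟨U, hUb, hU0⟩ := exists_continuousLinearMap_of_norm_eq hab
  have hker := ker_eq_orthogonal_range hab hUb hU0
  have hgraph {f m : H} (hm : (f, m) ∈ (absOp S).graph) : (f, U m) ∈ S.graph := by
    obtain ⟨hf, rfl⟩ := mem_graph_iff_exists.mp hm
    exact (hUb ⟨f, hf⟩).symm ▸ S.mem_graph (Submodule.inclusion (domain_absOp hS hd).le ⟨f, hf⟩)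
  refine ⟨U, ext_graph fun f h => ?_, ?_, fun f => ?_⟩
  · simp only [mem_graph_opMul, mem_graph_ofCLM]
    constructor
    · rintro ⟨m, hm, rfl⟩
      exact hgraph hm
    · intro hf
      obtain ⟨m, hm, -⟩ := exists_mem_graph_absOp hS hd hf
      exact ⟨m, hm, LinearPMap.mem_graph_snd_inj _ (hgraph hm) hf rfl⟩
  · rw [hker, Submodule.orthogonal_orthogonal_eq_closure]
    exact fun f hf => norm_apply_of_mem_closure_range hab hUb hf
  · rw [← mem_graph_iff_exists, ← mem_graph_absOp_zero_iff hS hd, ← adjoint_absOp hS hd,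
      ← mem_orthogonal_range_iff dense_domain_absOp, ← hker]
    rfl

theorem isPolarFactor_polarFactor : IsPolarFactor S (polarFactor S) := by
  have hex := exists_isPolarFactor hS hd
  rw [polarFactor, dif_pos hex]
  exact hex.choose_spec

theorem mem_graph_iff_absOp {f h : H} :
    (f, h) ∈ S.graph ↔ ∃ m, (f, m) ∈ (absOp S).graph ∧ polarFactor S m = h := by
  conv_lhs => rw [← (isPolarFactor_polarFactor hS hd).mul_abs]
  simp only [mem_graph_opMul, mem_graph_ofCLM]

omit hS hd in
theorem IsPolarFactor.inner_apply {U : H →L[ℂ] H} (hU : IsPolarFactor S U) {m : H}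
    (hm : m ∈ (LinearMap.ker (U : H →ₗ[ℂ] H))ᗮ) (f : H) :
    inner ℂ (U f) (U m) = inner ℂ f m := by
  have : CompleteSpace (LinearMap.ker (U : H →ₗ[ℂ] H)) := U.isClosed_ker.completeSpace_coe
  let V : ((LinearMap.ker (U : H →ₗ[ℂ] H))ᗮ : Submodule ℂ H) →ₗᵢ[ℂ] H :=
    ⟨(U : H →ₗ[ℂ] H) ∘ₗ Submodule.subtype _, fun x => hU.isometric x x.2⟩
  obtain ⟨p, hp, y, hy, rfl⟩ :=
    (LinearMap.ker (U : H →ₗ[ℂ] H)).exists_add_mem_mem_orthogonal f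
  have hp0 : U p = 0 := hp
  rw [map_add, hp0, zero_add, inner_add_left, (Submodule.mem_orthogonal _ _).mp hm p hp, zero_add]
  exact V.inner_map_map ⟨y, hy⟩ ⟨m, hm⟩

theorem inner_polarFactor {f u m : H} (hu : (u, m) ∈ (absOp S).graph) :
    inner ℂ (polarFactor S f) (polarFactor S m) = inner ℂ f m := by
  have hU := isPolarFactor_polarFactor hS hd
  refine hU.inner_apply ((Submodule.mem_orthogonal _ _).mpr fun v hv => ?_) f
  have hv0 : (v, (0 : H)) ∈ (absOp S)†.graph := by
    rw [adjoint_absOp hS hd, mem_graph_absOp_zero_iff hS hd, mem_graph_iff_exists]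
    exact (hU.ker_eq v).mp hv
  exact (inner_eq_of_mem_graph_adjoint dense_domain_absOp hu hv0).symm.trans (inner_zero_left _)

theorem intertwines_polarFactor (hd' : Dense (S†.domain : Set H)) :
    Intertwines (polarFactor S) (opMul S† S) (opMul S†† S†) := by
  intro f h hf
  rw [← opMul_absOp_self hS hd] at hf
  obtain ⟨m, hfm, hmh⟩ := mem_graph_opMul.mp hf
  rw [mem_graph_opMul, adjoint_adjoint_of_isClosed hS hd hd']
  refine ⟨m, ?_, (mem_graph_iff_absOp hS hd).mpr ⟨h, hmh, rfl⟩⟩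
  rw [mem_graph_adjoint_iff hd]
  intro x
  obtain ⟨k, hxk, hk⟩ := (mem_graph_iff_absOp hS hd).mp (S.mem_graph x)
  rw [← adjoint_absOp hS hd] at hfm
  rw [← hk, inner_polarFactor hS hd hxk]
  exact inner_eq_of_mem_graph_adjoint dense_domain_absOp hxk hfm

theorem intertwines_opPow_absOp (hd' : Dense (S†.domain : Set H)) (z : ℂ) :
    Intertwines (polarFactor S) (opPow (absOp S) z) (opPow (absOp S†) z) := by
  have hS' : S†.IsClosed := LinearPMap.adjoint_isClosed hd
  have hsq := intertwines_polarFactor hS hd hd'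
  rw [← toPMap_spectralMeasure_adjoint_mul_self hS hd,
    ← toPMap_spectralMeasure_adjoint_mul_self hS' hd'] at hsq
  have habs : Intertwines (polarFactor S) (absOp S) (absOp S†) :=
    ProjMeasure.intertwines_integral (fun s hs => ProjMeasure.mul_proj_of_intertwines hsq hs)
      measurable_csqrt
  rw [← toPMap_spectralMeasure_absOp hS hd, ← toPMap_spectralMeasure_absOp hS' hd'] at habs
  exact ProjMeasure.intertwines_integral
    (fun s hs => ProjMeasure.mul_proj_of_intertwines habs hs) (measurable_cpow_ofReal z)

end AbsoluteValue

/-! ### Three lines -/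

theorem mul_abs_le {k : ℝ} (hk : 0 < k) (c y : ℝ) : c * |y| ≤ k * y ^ 2 + k⁻¹ * c ^ 2 := by
  have hsq : 0 ≤ k⁻¹ * (k * |y| - c / 2) ^ 2 := by positivity
  have hexpand : k⁻¹ * (k * |y| - c / 2) ^ 2 = k * y ^ 2 - c * |y| + k⁻¹ * c ^ 2 / 4 := by
    rw [← sq_abs y]
    field_simp
    ring
  have hc : 0 ≤ k⁻¹ * c ^ 2 := by positivity
  linarith

theorem norm_exp_mul_sq_sub (k : ℝ) (z : ℂ) :
    ‖Complex.exp (k * (z ^ 2 - z))‖ = Real.exp (-(k * |z.im| ^ 2 + k * z.re * (1 - z.re))) := by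
  rw [Complex.norm_exp, sq_abs]
  congr 1
  rw [Complex.re_ofReal_mul]
  simp only [sq, Complex.sub_re, Complex.mul_re]
  ring

theorem norm_exp_mul_sq_sub_smul_le {V : Type*} [NormedAddCommGroup V] [NormedSpace ℂ V] {v : V}
    {c k m : ℝ} (hk : 0 < k) {z : ℂ} (hz0 : 0 ≤ z.re) (hz1 : z.re ≤ 1)
    (hv : ‖v‖ ≤ m * Real.exp (c * |z.im|)) :
    ‖Complex.exp (k * (z ^ 2 - z)) • v‖ ≤ m * Real.exp (k⁻¹ * c ^ 2) := by
  have hm : 0 ≤ m := nonneg_of_mul_nonneg_left ((norm_nonneg v).trans hv) (Real.exp_pos _)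
  have hre : 0 ≤ k * z.re * (1 - z.re) := mul_nonneg (by positivity) (sub_nonneg.mpr hz1)
  calc ‖Complex.exp (k * (z ^ 2 - z)) • v‖
      ≤ Real.exp (-(k * |z.im| ^ 2 + k * z.re * (1 - z.re))) * (m * Real.exp (c * |z.im|)) := by
        rw [norm_smul, norm_exp_mul_sq_sub]
        gcongr
    _ = m * Real.exp (c * |z.im| - (k * |z.im| ^ 2 + k * z.re * (1 - z.re))) := by
        rw [sub_eq_add_neg (c * |z.im|), Real.exp_add]
        ring
    _ ≤ m * Real.exp (k⁻¹ * c ^ 2) := by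
        gcongr
        have hquad := mul_abs_le hk c z.im
        rw [← sq_abs] at hquad
        linarith

/- The factor `exp (k (z² - z))` turns exponential growth in `Im z` into boundedness on the strip,
at the price of the constant `exp (k⁻¹ c²)`. -/
theorem norm_le_interp_of_exp_growth {V : Type*} [NormedAddCommGroup V] [NormedSpace ℂ V]
    {F : ℂ → V} (hF : Differentiable ℂ F) {a b c M : ℝ}
    (hM : ∀ z : ℂ, 0 ≤ z.re → z.re ≤ 1 → ‖F z‖ ≤ M * Real.exp (c * |z.im|))
    (h0 : ∀ z : ℂ, z.re = 0 → ‖F z‖ ≤ a * Real.exp (c * |z.im|))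
    (h1 : ∀ z : ℂ, z.re = 1 → ‖F z‖ ≤ b * Real.exp (c * |z.im|)) {k : ℝ} (hk : 0 < k) {z : ℂ}
    (hz0 : 0 ≤ z.re) (hz1 : z.re ≤ 1) :
    ‖F z‖ ≤ a ^ (1 - z.re) * b ^ z.re *
      Real.exp (k * |z.im| ^ 2 + k * z.re * (1 - z.re) + k⁻¹ * c ^ 2) := by
  have ha : 0 ≤ a := by simpa using (norm_nonneg _).trans (h0 0 rfl)
  have hb : 0 ≤ b := by simpa using (norm_nonneg _).trans (h1 1 rfl)
  set D := Real.exp (k⁻¹ * c ^ 2)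
  set N := k * |z.im| ^ 2 + k * z.re * (1 - z.re)
  have hD : 0 < D := Real.exp_pos _
  let G : ℂ → V := fun z => Complex.exp (k * (z ^ 2 - z)) • F z
  have hG : Differentiable ℂ G := by fun_prop
  have hinterp : ‖G z‖ ≤ (a * D) ^ (1 - z.re) * (b * D) ^ z.re := by
    refine Complex.HadamardThreeLines.norm_le_interp_of_mem_verticalClosedStrip₀₁' G ⟨hz0, hz1⟩
      hG.diffContOnCl ⟨M * D, ?_⟩ (fun w hw => ?_) fun w hw => ?_
    · rintro _ ⟨w, hw, rfl⟩
      exact norm_exp_mul_sq_sub_smul_le hk hw.1 hw.2 (hM w hw.1 hw.2)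
    · have hw : w.re = 0 := hw
      exact norm_exp_mul_sq_sub_smul_le hk hw.ge (by simp [hw]) (h0 w hw)
    · have hw : w.re = 1 := hw
      exact norm_exp_mul_sq_sub_smul_le hk (by simp [hw]) hw.le (h1 w hw)
  have hconst : (a * D) ^ (1 - z.re) * (b * D) ^ z.re = a ^ (1 - z.re) * b ^ z.re * D := by
    rw [Real.mul_rpow ha hD.le, Real.mul_rpow hb hD.le, mul_mul_mul_comm, ← Real.rpow_add hD,
      sub_add_cancel, Real.rpow_one]
  calc ‖F z‖ = Real.exp N * ‖G z‖ := by
        rw [norm_smul, norm_exp_mul_sq_sub, ← mul_assoc, ← Real.exp_add, add_neg_cancel,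
          Real.exp_zero, one_mul]
    _ ≤ Real.exp N * (a ^ (1 - z.re) * b ^ z.re * D) := by
        rw [← hconst]
        gcongr
    _ = a ^ (1 - z.re) * b ^ z.re * Real.exp (N + k⁻¹ * c ^ 2) := by
        rw [Real.exp_add N]
        ring

theorem le_of_forall_mul_exp {a Q M : ℝ} (h : ∀ k : ℝ, 0 < k → a ≤ Q * Real.exp (k * M)) :
    a ≤ Q := by
  have hcont : Continuous fun k : ℝ => Q * Real.exp (k * M) := by fun_prop
  have hlim : Tendsto (fun k : ℝ => Q * Real.exp (k * M)) (𝓝[>] 0) (𝓝 Q) := by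
    simpa using (hcont.tendsto 0).mono_left (nhdsWithin_le_nhds (s := Set.Ioi 0))
  exact ge_of_tendsto hlim (eventually_nhdsWithin_of_forall h)

theorem le_mul_exp_sqrt {a Q X p : ℝ} (hX : 0 ≤ X) (hp : 0 < p)
    (h : ∀ k : ℝ, 0 < k → a ≤ Q * Real.exp (k * X + k⁻¹ * p ^ 2)) :
    a ≤ Q * Real.exp (2 * p * √X) := by
  rcases hX.eq_or_lt with rfl | hX
  · rw [Real.sqrt_zero, mul_zero, Real.exp_zero, mul_one]
    refine le_of_forall_mul_exp (M := p ^ 2) fun k hk => ?_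
    simpa using h k⁻¹ (inv_pos.mpr hk)
  · have hs : 0 < √X := Real.sqrt_pos.mpr hX
    have hmin : p / √X * X + (p / √X)⁻¹ * p ^ 2 = 2 * p * √X := by
      nth_rewrite 2 [← Real.mul_self_sqrt hX.le]
      field_simp [hs.ne']
      ring
    rw [← hmin]
    exact h (p / √X) (div_pos hp hs)

/-! ### Truncated powers -/

theorem norm_cpow_ofReal_le_of_arg_le {t c : ℝ} (ht : t ≠ 0) (harg : Complex.arg t ≤ c) (z : ℂ) :
    ‖(t : ℂ) ^ z‖ ≤ |t| ^ z.re * Real.exp (c * max 0 (-z.im)) := by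
  have harg0 : 0 ≤ Complex.arg t := by simp [Complex.arg_nonneg_iff]
  have hexponent : -(Complex.arg t * z.im) ≤ c * max 0 (-z.im) :=
    calc -(Complex.arg t * z.im) = Complex.arg t * (-z.im) := by ring
      _ ≤ Complex.arg t * max 0 (-z.im) := by gcongr; exact le_max_right _ _
      _ ≤ c * max 0 (-z.im) := by gcongr
  rw [Complex.norm_cpow_of_ne_zero (Complex.ofReal_ne_zero.mpr ht), Complex.norm_real,
    Real.norm_eq_abs, div_eq_mul_inv, ← Real.exp_neg]
  gcongr

/-- The set `{1/(n+1) ≤ |t| ≤ n+1}`, on which all powers of `t` are bounded. -/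
def band (n : ℕ) : Set ℝ := {t | 1 / ((n : ℝ) + 1) ≤ |t| ∧ |t| ≤ n + 1}

/-- The set `{|t| ≥ δ}`, which carries the spectrum of an operator with bounded inverse. -/
def gap (δ : ℝ) : Set ℝ := {t | δ ≤ |t|}

/-- The function `t ↦ t ^ z` cut off to `s`. -/
def cutPow (s : Set ℝ) (z : ℂ) : ℝ → ℂ := s.indicator fun t => (t : ℂ) ^ z

theorem measurableSet_gap (δ : ℝ) : MeasurableSet (gap δ) :=
  measurableSet_le measurable_const continuous_abs.measurable

theorem measurableSet_band (n : ℕ) : MeasurableSet (band n) :=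
  (measurableSet_gap _).inter (measurableSet_le continuous_abs.measurable measurable_const)

theorem ne_zero_of_mem_gap {δ t : ℝ} (hδ : 0 < δ) (ht : t ∈ gap δ) : t ≠ 0 :=
  abs_pos.mp (hδ.trans_le ht)

theorem ne_zero_of_mem_band {n : ℕ} {t : ℝ} (ht : t ∈ band n) : t ≠ 0 :=
  ne_zero_of_mem_gap (δ := 1 / ((n : ℝ) + 1)) (by positivity) ht.1

theorem eventually_mem_band {t : ℝ} (ht : t ≠ 0) : ∀ᶠ n in atTop, t ∈ band n := by
  obtain ⟨N, hN⟩ := exists_nat_one_div_lt (abs_pos.mpr ht)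
  obtain ⟨M, hM⟩ := exists_nat_ge |t|
  filter_upwards [eventually_ge_atTop N, eventually_ge_atTop M] with n hn hm
  have hn' : (N : ℝ) ≤ n := Nat.cast_le.mpr hn
  have hm' : (M : ℝ) ≤ n := Nat.cast_le.mpr hm
  exact ⟨(one_div_le_one_div_of_le (by positivity) (by linarith)).trans hN.le, by linarith⟩

theorem abs_rpow_le_of_mem_band {n : ℕ} {t : ℝ} (ht : t ∈ band n) (x : ℝ) :
    |t| ^ x ≤ ((n : ℝ) + 1) ^ |x| := by
  have hn : (0 : ℝ) < n + 1 := by positivity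
  rcases le_total 0 x with hx | hx
  · rw [abs_of_nonneg hx]
    exact Real.rpow_le_rpow (abs_nonneg t) ht.2 hx
  · rw [abs_of_nonpos hx, Real.rpow_neg hn.le, ← Real.inv_rpow hn.le, ← one_div]
    exact Real.rpow_le_rpow_of_nonpos (by positivity) ht.1 hx

theorem norm_log_le_of_mem_band {n : ℕ} {t : ℝ} (ht : t ∈ band n) :
    ‖Complex.log t‖ ≤ Real.log (n + 1) + Real.pi := by
  have hre : |(Complex.log t).re| ≤ Real.log (n + 1) := by
    have hlower := Real.log_le_log (by positivity) ht.1
    rw [one_div, Real.log_inv] at hlower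
    rw [Complex.log_re, Complex.norm_real, Real.norm_eq_abs]
    exact abs_le.mpr ⟨hlower, Real.log_le_log (abs_pos.mpr (ne_zero_of_mem_band ht)) ht.2⟩
  have him : |(Complex.log t).im| ≤ Real.pi := by
    rw [Complex.log_im]
    exact Complex.abs_arg_le_pi _
  exact (Complex.norm_le_abs_re_add_abs_im _).trans (add_le_add hre him)

theorem norm_cutPow_band_le {c t : ℝ} (harg : Complex.arg t ≤ c) (n : ℕ) (z : ℂ) :
    ‖cutPow (band n) z t‖ ≤ ((n : ℝ) + 1) ^ |z.re| * Real.exp (c * max 0 (-z.im)) := by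
  by_cases ht : t ∈ band n
  · rw [cutPow, Set.indicator_of_mem ht]
    refine (norm_cpow_ofReal_le_of_arg_le (ne_zero_of_mem_band ht) harg z).trans ?_
    gcongr
    exact abs_rpow_le_of_mem_band ht _
  · rw [cutPow, Set.indicator_of_notMem ht, norm_zero]
    positivity

theorem isBoundedBorel_cutPow_band (n : ℕ) (z : ℂ) : IsBoundedBorel (cutPow (band n) z) :=
  ⟨(measurable_cpow_ofReal z).indicator (measurableSet_band n), _,
    fun t => norm_cutPow_band_le (Complex.arg_le_pi t) n z⟩

theorem isBoundedBorel_cutPow_gap {δ : ℝ} (hδ : 0 < δ) {z : ℂ} (hz : z.re ≤ 0) :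
    IsBoundedBorel (cutPow (gap δ) z) := by
  refine .indicator_of_le (measurable_cpow_ofReal z) (measurableSet_gap δ)
    (C := δ ^ z.re * Real.exp (Real.pi * max 0 (-z.im))) fun t ht => ?_
  refine (norm_cpow_ofReal_le_of_arg_le (ne_zero_of_mem_gap hδ ht)
    (Complex.arg_le_pi t) z).trans ?_
  gcongr ?_ * _
  exact Real.rpow_le_rpow_of_nonpos hδ ht hz

theorem cutPow_mul_cutPow {s u : Set ℝ} (h0 : (0 : ℝ) ∉ s ∩ u) (z w : ℂ) :
    cutPow s z * cutPow u w = cutPow (s ∩ u) (z + w) := by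
  rw [cutPow, cutPow, cutPow, Pi.mul_def]
  simp only [← Set.inter_indicator_mul]
  refine Set.indicator_congr fun t ht => ?_
  have ht0 : t ≠ 0 := fun h => h0 (h ▸ ht)
  exact (Complex.cpow_add _ _ (Complex.ofReal_ne_zero.mpr ht0)).symm

theorem cutPow_zero (s : Set ℝ) : cutPow s 0 = s.indicator 1 :=
  Set.indicator_congr fun t _ => Complex.cpow_zero (t : ℂ)

theorem cutPow_one (s : Set ℝ) : cutPow s 1 = s.indicator fun t => (t : ℂ) :=
  Set.indicator_congr fun t _ => Complex.cpow_one (t : ℂ)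

theorem norm_cpow_add_sub_le {a z h : ℂ} (ha : a ≠ 0) (hh : ‖Complex.log a * h‖ ≤ 1) :
    ‖a ^ (z + h) - a ^ z - h * (a ^ z * Complex.log a)‖ ≤ ‖a ^ z‖ * ‖Complex.log a * h‖ ^ 2 := by
  have hfactor : a ^ (z + h) - a ^ z - h * (a ^ z * Complex.log a)
      = a ^ z * (Complex.exp (Complex.log a * h) - 1 - Complex.log a * h) := by
    rw [Complex.cpow_add _ _ ha, Complex.cpow_def_of_ne_zero ha h]
    ring
  rw [hfactor, norm_mul]
  gcongr
  exact Complex.norm_exp_sub_one_sub_id_le hh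

theorem norm_cutPow_band_add_sub_le (n : ℕ) (t : ℝ) (z : ℂ) {w : ℂ}
    (hw : (Real.log (n + 1) + Real.pi) * ‖w‖ ≤ 1) :
    ‖cutPow (band n) (z + w) t - cutPow (band n) z t
        - w * (cutPow (band n) z * (band n).indicator fun t => Complex.log t) t‖
      ≤ ((n : ℝ) + 1) ^ |z.re| * Real.exp (Real.pi * max 0 (-z.im))
        * (Real.log (n + 1) + Real.pi) ^ 2 * ‖w‖ ^ 2 := by
  set L : ℝ := Real.log (n + 1) + Real.pi
  set D : ℝ := ((n : ℝ) + 1) ^ |z.re| * Real.exp (Real.pi * max 0 (-z.im))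
  by_cases ht : t ∈ band n
  · have hlw : ‖Complex.log t * w‖ ≤ L * ‖w‖ := by
      rw [norm_mul]
      exact mul_le_mul_of_nonneg_right (norm_log_le_of_mem_band ht) (norm_nonneg w)
    have hpow : ‖(t : ℂ) ^ z‖ ≤ D := by
      simpa only [cutPow, Set.indicator_of_mem ht] using
        norm_cutPow_band_le (Complex.arg_le_pi t) n z
    simp only [cutPow, Pi.mul_apply, Set.indicator_of_mem ht]
    calc ‖(t : ℂ) ^ (z + w) - t ^ z - w * (t ^ z * Complex.log t)‖
        ≤ ‖(t : ℂ) ^ z‖ * ‖Complex.log t * w‖ ^ 2 :=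
          norm_cpow_add_sub_le (Complex.ofReal_ne_zero.mpr (ne_zero_of_mem_band ht))
            (hlw.trans hw)
      _ ≤ D * (L * ‖w‖) ^ 2 := by gcongr
      _ = D * L ^ 2 * ‖w‖ ^ 2 := by ring
  · simp only [cutPow, Pi.mul_apply, Set.indicator_of_notMem ht, sub_zero, mul_zero, norm_zero]
    positivity

namespace ProjMeasure

variable {E G : ProjMeasure H}

theorem op_congr {g h : ℝ → ℂ} (hg : IsBoundedBorel g) (hh : IsBoundedBorel h)
    (hgh : ∀ f, g =ᵐ[E.scalar f] h) : E.op g = E.op h := by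
  ext f
  rw [op_apply hg, op_apply hh, E.integralAt_congr (hgh f) (hg.memLp _)]

theorem op_sub_sub_smul {g h k : ℝ → ℂ} (hg : IsBoundedBorel g) (hh : IsBoundedBorel h)
    (hk : IsBoundedBorel k) (c : ℂ) :
    IsBoundedBorel (g - h - c • k) ∧ E.op (g - h - c • k) = E.op g - E.op h - c • E.op k := by
  have hh' : IsBoundedBorel ((fun _ => -1) * h) := (IsBoundedBorel.const (-1)).mul hh
  have hk' : IsBoundedBorel ((fun _ => -c) * k) := (IsBoundedBorel.const (-c)).mul hk
  have hsum : g - h - c • k = g + (fun _ => -1) * h + (fun _ => -c) * k := by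
    ext t
    simp [sub_eq_add_neg]
  refine ⟨hsum ▸ (hg.add hh').add hk', ?_⟩
  rw [hsum, op_add (hg.add hh') hk', op_add hg hh', op_mul (.const _) hh, op_mul (.const _) hk,
    op_const, op_const, smul_mul_assoc, smul_mul_assoc, one_mul, one_mul, neg_one_smul, neg_smul,
    ← sub_eq_add_neg, ← sub_eq_add_neg]

theorem hasDerivAt_op {φ : ℂ → ℝ → ℂ} {φ' : ℝ → ℂ} (hφ : ∀ w, IsBoundedBorel (φ w))
    (hφ' : IsBoundedBorel φ') {z : ℂ} {C : ℝ}
    (h : ∀ᶠ w in 𝓝 0, ∀ t, ‖φ (z + w) t - φ z t - w * φ' t‖ ≤ C * ‖w‖ ^ 2) :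
    HasDerivAt (fun w => E.op (φ w)) (E.op φ') z := by
  rw [hasDerivAt_iff_isLittleO_nhds_zero]
  refine Asymptotics.IsBigO.trans_isLittleO (g := fun w : ℂ => w ^ 2)
    (Asymptotics.IsBigO.of_bound C ?_) (Asymptotics.isLittleO_pow_id one_lt_two)
  filter_upwards [h] with w hw
  obtain ⟨hb, hop⟩ := op_sub_sub_smul (E := E) (hφ (z + w)) (hφ z) hφ' w
  rw [← hop, norm_pow]
  exact norm_op_le hb ((norm_nonneg _).trans (hw 0)) fun f => .of_forall hw

theorem differentiable_op_cutPow_band (n : ℕ) :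
    Differentiable ℂ fun z => E.op (cutPow (band n) z) := fun z => by
  have hlog : IsBoundedBorel ((band n).indicator fun t => Complex.log t) :=
    .indicator_of_le (Complex.measurable_log.comp Complex.measurable_ofReal) (measurableSet_band n)
      fun t ht => norm_log_le_of_mem_band ht
  have hsmall : ∀ᶠ w : ℂ in 𝓝 0, (Real.log (n + 1) + Real.pi) * ‖w‖ < 1 := by
    have hcont : ContinuousAt (fun w : ℂ => (Real.log (n + 1) + Real.pi) * ‖w‖) 0 := by fun_prop
    exact hcont.eventually_lt_const (by simp)
  have hderiv := hasDerivAt_op (E := E) (isBoundedBorel_cutPow_band n)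
    ((isBoundedBorel_cutPow_band n z).mul hlog)
    (hsmall.mono fun w hw t => norm_cutPow_band_add_sub_le n t z hw.le)
  exact hderiv.differentiableAt

/-! ### Interpolation between truncated powers -/

theorem op_cutPow_band_mul (n : ℕ) (z w : ℂ) :
    E.op (cutPow (band n) z) * E.op (cutPow (band n) w) = E.op (cutPow (band n) (z + w)) := by
  rw [← op_mul (isBoundedBorel_cutPow_band n z) (isBoundedBorel_cutPow_band n w),
    cutPow_mul_cutPow fun h => ne_zero_of_mem_band h.1 rfl, Set.inter_self]

theorem op_cutPow_band_zero (n : ℕ) : E.op (cutPow (band n) 0) = E.proj (band n) := by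
  rw [cutPow_zero, op_indicator_one (measurableSet_band n)]

section ArgBound

variable {c : ℝ} (hG : ∀ f, ∀ᵐ t ∂(G.scalar f), Complex.arg (t : ℝ) ≤ c)
  (hE : ∀ f, ∀ᵐ t ∂(E.scalar f), Complex.arg (t : ℝ) ≤ c)
include hE

theorem norm_op_cutPow_band_le (n : ℕ) (z : ℂ) :
    ‖E.op (cutPow (band n) z)‖ ≤ ((n : ℝ) + 1) ^ |z.re| * Real.exp (c * max 0 (-z.im)) :=
  norm_op_le (isBoundedBorel_cutPow_band n z) (by positivity)
    fun f => (hE f).mono fun _ ht => norm_cutPow_band_le ht n z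

include hG

theorem norm_op_cutPow_mul_mul_le (V : H →L[ℂ] H) (n m : ℕ) (z : ℂ) :
    ‖G.op (cutPow (band n) z) * V * E.op (cutPow (band m) (-z))‖
      ≤ (((n : ℝ) + 1) * (m + 1)) ^ |z.re| * ‖V‖ * Real.exp (c * |z.im|) := by
  have hGz := norm_op_cutPow_band_le hG n z
  have hEz := norm_op_cutPow_band_le hE m (-z)
  rw [Complex.neg_re, Complex.neg_im, neg_neg, abs_neg] at hEz
  have hexp : Real.exp (c * max 0 (-z.im)) * Real.exp (c * max 0 z.im)
      = Real.exp (c * |z.im|) := by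
    rw [← Real.exp_add, ← mul_add]
    congr 2
    rcases le_total 0 z.im with h | h
    · rw [max_eq_left (by linarith), max_eq_right h, abs_of_nonneg h, zero_add]
    · rw [max_eq_right (by linarith), max_eq_left h, abs_of_nonpos h, add_zero]
  calc ‖G.op (cutPow (band n) z) * V * E.op (cutPow (band m) (-z))‖
      ≤ ‖G.op (cutPow (band n) z)‖ * ‖V‖ * ‖E.op (cutPow (band m) (-z))‖ :=
        (norm_mul_le _ _).trans (by gcongr; exact norm_mul_le _ _)
    _ ≤ ((n : ℝ) + 1) ^ |z.re| * Real.exp (c * max 0 (-z.im)) * ‖V‖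
        * (((m : ℝ) + 1) ^ |z.re| * Real.exp (c * max 0 z.im)) := by gcongr
    _ = (((n : ℝ) + 1) * (m + 1)) ^ |z.re| * ‖V‖ * Real.exp (c * |z.im|) := by
        rw [← hexp, Real.mul_rpow (by positivity) (by positivity)]
        ring

theorem norm_op_cutPow_mul_mul_le_interp {V W : H →L[ℂ] H} {n m : ℕ}
    (hVW : G.op (cutPow (band n) 1) * V * E.op (cutPow (band m) (-1))
      = G.proj (band n) * W * E.proj (band m))
    {k : ℝ} (hk : 0 < k) {z : ℂ} (hz0 : 0 ≤ z.re) (hz1 : z.re ≤ 1) :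
    ‖G.op (cutPow (band n) z) * V * E.op (cutPow (band m) (-z))‖
      ≤ ‖V‖ ^ (1 - z.re) * ‖W‖ ^ z.re *
        Real.exp (k * |z.im| ^ 2 + k * z.re * (1 - z.re) + k⁻¹ * c ^ 2) := by
  have hshift (w : ℂ) : G.op (cutPow (band n) w) * V * E.op (cutPow (band m) (-w))
      = G.op (cutPow (band n) (w - 1)) * W * E.op (cutPow (band m) (-(w - 1))) :=
    calc G.op (cutPow (band n) w) * V * E.op (cutPow (band m) (-w))
        = G.op (cutPow (band n) (w - 1)) * (G.op (cutPow (band n) 1) * V *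
            E.op (cutPow (band m) (-1))) * E.op (cutPow (band m) (-(w - 1))) := by
          rw [show w = w - 1 + 1 by ring, ← op_cutPow_band_mul, neg_add_rev,
            ← op_cutPow_band_mul m (-1), add_sub_cancel_right]
          simp only [mul_assoc]
      _ = G.op (cutPow (band n) (w - 1)) * W * E.op (cutPow (band m) (-(w - 1))) := by
          have hn := op_cutPow_band_mul (E := G) n (w - 1) 0
          have hm := op_cutPow_band_mul (E := E) m 0 (-(w - 1))
          rw [op_cutPow_band_zero, add_zero] at hn
          rw [op_cutPow_band_zero, zero_add] at hm
          rw [hVW, ← mul_assoc, ← mul_assoc, hn, mul_assoc, hm]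
  have hone : (1 : ℝ) ≤ (n + 1) * (m + 1) := by
    nlinarith [n.cast_nonneg (α := ℝ), m.cast_nonneg (α := ℝ)]
  refine norm_le_interp_of_exp_growth
    (F := fun z => G.op (cutPow (band n) z) * V * E.op (cutPow (band m) (-z)))
    (M := (n + 1) * (m + 1) * ‖V‖) ?_ (fun w hw0 hw1 => ?_) (fun w hw => ?_) (fun w hw => ?_)
    hk hz0 hz1
  · exact ((differentiable_op_cutPow_band n).mul_const V).mul
      (Differentiable.comp (g := fun z => E.op (cutPow (band m) z))
        (differentiable_op_cutPow_band m) differentiable_neg)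
  · refine (norm_op_cutPow_mul_mul_le hG hE V n m w).trans ?_
    rw [abs_of_nonneg hw0]
    gcongr
    exact (Real.rpow_le_rpow_of_exponent_le hone hw1).trans_eq (Real.rpow_one _)
  · simpa [hw] using norm_op_cutPow_mul_mul_le hG hE V n m w
  · rw [hshift]
    simpa [hw] using norm_op_cutPow_mul_mul_le hG hE W n m (w - 1)

end ArgBound

/-! ### Powers of an operator with a spectral gap -/

/-- The spectrum of `∫ t dE` has distance at least `δ > 0` from the origin. -/
structure HasGap (E : ProjMeasure H) (δ : ℝ) : Prop where
  pos : 0 < δ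
  ae_mem : ∀ f, ∀ᵐ t ∂(E.scalar f), t ∈ gap δ

theorem hasGap_of_norm_le {C : ℝ} (hC : 0 ≤ C)
    (hE : ∀ f h, (f, h) ∈ E.toPMap.graph → ‖f‖ ≤ C * ‖h‖) : E.HasGap (1 / (C + 1)) := by
  set δ := 1 / (C + 1)
  have hδ : 0 < δ := by positivity
  refine ⟨hδ, fun f => ?_⟩
  have hs : MeasurableSet (gap δ)ᶜ := (measurableSet_gap δ).compl
  have hle : ∀ t ∈ (gap δ)ᶜ, ‖(t : ℂ)‖ ≤ δ := fun t ht => by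
    rw [Complex.norm_real, Real.norm_eq_abs]
    have hlt : ¬ δ ≤ |t| := ht
    exact (not_le.mp hlt).le
  have hb := IsBoundedBorel.indicator_of_le Complex.measurable_ofReal hs hle
  set u := E.proj (gap δ)ᶜ f
  have hu : E.proj (gap δ)ᶜ u = u := by
    rw [← mul_apply_eq_comp, proj_mul _ hs hs, Set.inter_self]
  have hsmall : ‖E.op ((gap δ)ᶜ.indicator fun t => (t : ℂ)) u‖ ≤ δ * ‖u‖ :=
    norm_op_apply_le hb hδ.le <| .of_forall fun t => by
      by_cases ht : t ∈ (gap δ)ᶜ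
      · simpa only [Set.indicator_of_mem ht] using hle t ht
      · simpa only [Set.indicator_of_notMem ht, norm_zero] using hδ.le
  have hlarge : ‖u‖ ≤ C * (δ * ‖u‖) := by
    have hgraph := E.mem_graph_integral_proj Complex.measurable_ofReal hs hb u
    rw [hu] at hgraph
    exact (hE _ _ hgraph).trans (by gcongr)
  have hCδ : C * δ = 1 - δ := by
    simp only [δ]
    field_simp
    ring
  have hzero : ‖u‖ ≤ 0 := by
    rw [← mul_assoc, hCδ] at hlarge
    exact nonpos_of_mul_nonpos_right (by linarith) hδ
  exact (E.scalar_eq_zero_iff hs).mpr (norm_le_zero_iff.mp hzero)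

namespace HasGap

variable {δ : ℝ} (hE : E.HasGap δ)
include hE

theorem integral_cpow {z : ℂ} (hz : z.re ≤ 0) :
    E.integral (fun t => (t : ℂ) ^ z) (measurable_cpow_ofReal z)
      = ofCLM (E.op (cutPow (gap δ) z)) := by
  rw [← integral_eq_ofCLM (isBoundedBorel_cutPow_gap hE.pos hz)]
  refine E.integral_congr fun f => ?_
  filter_upwards [hE.ae_mem f] with t ht
  exact (Set.indicator_of_mem ht fun t : ℝ => (t : ℂ) ^ z).symm

theorem op_cutPow_mul {s : Set ℝ} {z w : ℂ} (hw : w.re ≤ 0) (hz : IsBoundedBorel (cutPow s z))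
    (hwz : IsBoundedBorel (cutPow s (w + z))) :
    E.op (cutPow (gap δ) w) * E.op (cutPow s z) = E.op (cutPow s (w + z)) := by
  have hb := isBoundedBorel_cutPow_gap hE.pos hw
  rw [← op_mul hb hz]
  refine op_congr (hb.mul hz) hwz fun f => ?_
  filter_upwards [hE.ae_mem f] with t ht
  rw [cutPow_mul_cutPow (fun h => ne_zero_of_mem_gap hE.pos h.1 rfl)]
  by_cases hts : t ∈ s <;> simp [cutPow, hts, ht]

theorem op_cutPow_gap_mul {z w : ℂ} (hw : w.re ≤ 0) (hz : z.re ≤ 0) :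
    E.op (cutPow (gap δ) w) * E.op (cutPow (gap δ) z) = E.op (cutPow (gap δ) (w + z)) :=
  hE.op_cutPow_mul hw (isBoundedBorel_cutPow_gap hE.pos hz)
    (isBoundedBorel_cutPow_gap hE.pos (by rw [Complex.add_re]; linarith))

theorem op_cutPow_gap_comm {z w : ℂ} (hw : w.re ≤ 0) (hz : z.re ≤ 0) (f : H) :
    E.op (cutPow (gap δ) w) (E.op (cutPow (gap δ) z) f)
      = E.op (cutPow (gap δ) z) (E.op (cutPow (gap δ) w) f) :=
  congr($(op_mul_comm (isBoundedBorel_cutPow_gap hE.pos hw)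
    (isBoundedBorel_cutPow_gap hE.pos hz)) f)

theorem op_cutPow_gap_mul_band {w : ℂ} (hw : w.re ≤ 0) (n : ℕ) (z : ℂ) :
    E.op (cutPow (gap δ) w) * E.op (cutPow (band n) z) = E.op (cutPow (band n) (w + z)) :=
  hE.op_cutPow_mul hw (isBoundedBorel_cutPow_band n z) (isBoundedBorel_cutPow_band n _)

theorem op_cutPow_band_mul_gap {w : ℂ} (hw : w.re ≤ 0) (n : ℕ) (z : ℂ) :
    E.op (cutPow (band n) z) * E.op (cutPow (gap δ) w) = E.op (cutPow (band n) (w + z)) := by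
  rw [op_mul_comm (isBoundedBorel_cutPow_band n z) (isBoundedBorel_cutPow_gap hE.pos hw),
    hE.op_cutPow_gap_mul_band hw]

theorem op_cutPow_gap_mul_proj {w : ℂ} (hw : w.re ≤ 0) (n : ℕ) :
    E.op (cutPow (gap δ) w) * E.proj (band n) = E.op (cutPow (band n) w) := by
  rw [← op_cutPow_band_zero, hE.op_cutPow_gap_mul_band hw, add_zero]

theorem proj_mul_op_cutPow_gap {w : ℂ} (hw : w.re ≤ 0) (n : ℕ) :
    E.proj (band n) * E.op (cutPow (gap δ) w) = E.op (cutPow (band n) w) := by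
  rw [← op_cutPow_band_zero, hE.op_cutPow_band_mul_gap hw, add_zero]

theorem tendsto_proj_band (f : H) : Tendsto (fun n => E.proj (band n) f) atTop (𝓝 f) :=
  tendsto_proj measurableSet_band <|
    (hE.ae_mem f).mono fun _ ht => eventually_mem_band (ne_zero_of_mem_gap hE.pos ht)

theorem norm_le_of_forall_mul_proj_band {K : H →L[ℂ] H} {Q : ℝ}
    (hK : ∀ n, ‖K * E.proj (band n)‖ ≤ Q) : ‖K‖ ≤ Q := by
  refine K.opNorm_le_bound ((norm_nonneg _).trans (hK 0)) fun f => ?_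
  have hlim : Tendsto (fun n => ‖(K * E.proj (band n)) f‖) atTop (𝓝 ‖K f‖) :=
    ((K.continuous.tendsto f).comp (hE.tendsto_proj_band f)).norm
  exact le_of_tendsto hlim (.of_forall fun n => ContinuousLinearMap.le_of_opNorm_le _ (hK n) f)

theorem norm_le_of_forall_proj_band_mul {K : H →L[ℂ] H} {Q : ℝ}
    (hK : ∀ n, ‖E.proj (band n) * K‖ ≤ Q) : ‖K‖ ≤ Q := by
  refine K.opNorm_le_bound ((norm_nonneg _).trans (hK 0)) fun f => ?_
  have hlim : Tendsto (fun n => ‖(E.proj (band n) * K) f‖) atTop (𝓝 ‖K f‖) :=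
    (hE.tendsto_proj_band (K f)).norm
  exact le_of_tendsto hlim (.of_forall fun n => ContinuousLinearMap.le_of_opNorm_le _ (hK n) f)

section Interpolation

variable {A B K : H →L[ℂ] H}
  (hAB : E.op (cutPow (gap δ) (-1)) * A = B.adjoint * E.op (cutPow (gap δ) (-1)))
include hAB

theorem op_cutPow_band_mul_adjoint_mul (n m : ℕ) :
    E.op (cutPow (band n) 1) * B.adjoint * E.op (cutPow (band m) (-1))
      = E.proj (band n) * A * E.proj (band m) := by
  have hneg : (-1 : ℂ).re ≤ 0 := by simp
  rw [← hE.op_cutPow_gap_mul_proj hneg, ← mul_assoc, mul_assoc _ B.adjoint, ← hAB, ← mul_assoc,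
    hE.op_cutPow_band_mul_gap hneg, neg_add_cancel, op_cutPow_band_zero]

theorem proj_band_mul_mul_proj_band {z : ℂ} (hz0 : 0 ≤ z.re) (hz1 : z.re ≤ 1)
    (hK : K * E.op (cutPow (gap δ) (-1))
      = E.op (cutPow (gap δ) (-z)) * A * E.op (cutPow (gap δ) (-1 + z))) (n m : ℕ) :
    E.proj (band n) * K * E.proj (band m)
      = E.op (cutPow (band n) (1 - z)) * B.adjoint * E.op (cutPow (band m) (-(1 - z))) := by
  set R := E.op (cutPow (gap δ) (-1))
  have hneg : (-1 : ℂ).re ≤ 0 := by simp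
  have hz : (-z).re ≤ 0 := by simpa using hz0
  have hz' : (-1 + z).re ≤ 0 := by simpa using hz1
  have hRinv : R * E.op (cutPow (band m) 1) = E.proj (band m) := by
    rw [hE.op_cutPow_gap_mul_band hneg, neg_add_cancel, op_cutPow_band_zero]
  calc E.proj (band n) * K * E.proj (band m)
      = E.proj (band n) * (K * R) * E.op (cutPow (band m) 1) := by
        rw [← hRinv]
        simp only [mul_assoc]
    _ = E.op (cutPow (band n) (-z)) * A * E.op (cutPow (band m) z) := by
        rw [hK, ← mul_assoc, ← mul_assoc, hE.proj_mul_op_cutPow_gap hz, mul_assoc _ _ (E.op _),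
          hE.op_cutPow_gap_mul_band hz', show -1 + z + 1 = z by ring]
    _ = E.op (cutPow (band n) (1 - z)) * (R * A) * E.op (cutPow (band m) z) := by
        rw [← mul_assoc, hE.op_cutPow_band_mul_gap hneg, show -1 + (1 - z) = -z by ring]
    _ = E.op (cutPow (band n) (1 - z)) * B.adjoint * E.op (cutPow (band m) (-(1 - z))) := by
        rw [hAB, ← mul_assoc, mul_assoc _ R, hE.op_cutPow_gap_mul_band hneg, neg_sub,
          neg_add_eq_sub]

/- With `R = ∫ t⁻¹ dE`, the relation `R A = B† R` says that `A = S R` and `B = S† R` for some `S`;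
the operator `K` extends `T^(-z) S T^(z-1)` for `T = ∫ t dE`. On the line `Re z = 0` the truncations
of `K` are conjugates of `A` by imaginary powers of `T`, on `Re z = 1` they are conjugates of
`B†`. -/
theorem norm_le_interp {c : ℝ} (hc : ∀ f, ∀ᵐ t ∂(E.scalar f), Complex.arg (t : ℝ) ≤ c) {z : ℂ}
    (hz0 : 0 ≤ z.re) (hz1 : z.re ≤ 1)
    (hK : K * E.op (cutPow (gap δ) (-1))
      = E.op (cutPow (gap δ) (-z)) * A * E.op (cutPow (gap δ) (-1 + z)))
    {k : ℝ} (hk : 0 < k) :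
    ‖K‖ ≤ ‖A‖ ^ (1 - z.re) * ‖B‖ ^ z.re *
      Real.exp (k * |z.im| ^ 2 + k * z.re * (1 - z.re) + k⁻¹ * c ^ 2) := by
  refine hE.norm_le_of_forall_proj_band_mul fun n => hE.norm_le_of_forall_mul_proj_band fun m => ?_
  have hinterp := norm_op_cutPow_mul_mul_le_interp hc hc
    (hE.op_cutPow_band_mul_adjoint_mul hAB n m) hk (z := 1 - z) (by simpa using hz1)
    (by simpa using hz0)
  rw [LinearIsometryEquiv.norm_map, ← hE.proj_band_mul_mul_proj_band hAB hz0 hz1 hK] at hinterp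
  simp only [Complex.sub_re, Complex.sub_im, Complex.one_re, Complex.one_im, sub_sub_cancel,
    zero_sub, abs_neg] at hinterp
  rwa [mul_comm (‖A‖ ^ _), mul_right_comm k]

theorem norm_le_interp_of_ae_nonneg (hpos : ∀ f, ∀ᵐ t ∂(E.scalar f), 0 ≤ t) {z : ℂ}
    (hz0 : 0 ≤ z.re) (hz1 : z.re ≤ 1)
    (hK : K * E.op (cutPow (gap δ) (-1))
      = E.op (cutPow (gap δ) (-z)) * A * E.op (cutPow (gap δ) (-1 + z))) :
    ‖K‖ ≤ ‖A‖ ^ (1 - z.re) * ‖B‖ ^ z.re := by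
  have harg (f : H) : ∀ᵐ t ∂(E.scalar f), Complex.arg (t : ℝ) ≤ 0 :=
    (hpos f).mono fun _ ht => (Complex.arg_ofReal_of_nonneg ht).le
  refine le_of_forall_mul_exp (M := |z.im| ^ 2 + z.re * (1 - z.re)) fun k hk => ?_
  refine (hE.norm_le_interp hAB harg hz0 hz1 hK hk).trans_eq ?_
  ring_nf

end Interpolation

section Heinz

variable {C : H →L[ℂ] H}
  (hG : ∀ f, (E.op (cutPow (gap δ) (-1)) f, C f) ∈ G.toPMap.graph)
include hG

omit hE in
theorem op_cutPow_band_one_mul_op_cutPow_gap (n : ℕ) :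
    G.op (cutPow (band n) 1) * E.op (cutPow (gap δ) (-1)) = G.proj (band n) * C := by
  ext f
  obtain ⟨hmem, happ⟩ := G.mem_graph_integral.mp (hG f)
  rw [mul_apply_eq_comp, mul_apply_eq_comp, ← happ, ← op_indicator_one (measurableSet_band n),
    op_integralAt (.indicator_one (measurableSet_band n)) _ hmem,
    op_apply (isBoundedBorel_cutPow_band n 1)]
  simp only [cutPow_one, mul_comm _ (fun t : ℝ => (t : ℂ)), mul_indicator_one]

theorem exists_norm_op_cutPow_band_mul_le {x : ℝ} (hx0 : 0 ≤ x) (hx1 : x ≤ 1) :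
    ∃ Q, ∀ n, ‖G.op (cutPow (band n) x) * E.op (cutPow (gap δ) (-x))‖ ≤ Q := by
  have hπ (F : ProjMeasure H) (f : H) : ∀ᵐ t ∂(F.scalar f), Complex.arg (t : ℝ) ≤ Real.pi :=
    .of_forall fun t => Complex.arg_le_pi t
  have htrunc (n m : ℕ) : G.op (cutPow (band n) 1) * 1 * E.op (cutPow (band m) (-1))
      = G.proj (band n) * C * E.proj (band m) := by
    rw [mul_one, ← hE.op_cutPow_gap_mul_proj (by simp), ← mul_assoc,
      op_cutPow_band_one_mul_op_cutPow_gap hG]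
  obtain ⟨Q, hQ⟩ : ∃ Q, ∀ n m,
      ‖G.op (cutPow (band n) x) * 1 * E.op (cutPow (band m) (-x))‖ ≤ Q :=
    ⟨_, fun n m => norm_op_cutPow_mul_mul_le_interp (hπ G) (hπ E) (htrunc n m) one_pos hx0 hx1⟩
  refine ⟨Q, fun n => hE.norm_le_of_forall_mul_proj_band fun m => ?_⟩
  rw [mul_assoc, hE.op_cutPow_gap_mul_proj (by simpa using hx0)]
  simpa only [mul_one] using hQ n m

/- A form of the Heinz inequality. -/
theorem memLp_cpow {x : ℝ} (hx0 : 0 ≤ x) (hx1 : x ≤ 1) (f : H) :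
    MemLp (fun t : ℝ => (t : ℂ) ^ (x : ℂ)) 2 (G.scalar (E.op (cutPow (gap δ) (-x)) f)) := by
  rcases hx0.eq_or_lt with rfl | hx
  · simpa using memLp_const (1 : ℂ)
  obtain ⟨Q, hQ⟩ := hE.exists_norm_op_cutPow_band_mul_le hG hx0 hx1
  refine memLp_of_tendsto (fun n => isBoundedBorel_cutPow_band n x) (measurable_cpow_ofReal _)
    (C := Q * ‖f‖) (fun n => ContinuousLinearMap.le_of_opNorm_le _ (hQ n) f)
    (.of_forall fun t => ?_)
  rcases eq_or_ne t 0 with rfl | ht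
  · have hcut (n : ℕ) : cutPow (band n) x 0 = 0 :=
      Set.indicator_of_notMem (fun h => ne_zero_of_mem_band h rfl) _
    simp only [hcut, Complex.ofReal_zero, Complex.zero_cpow (Complex.ofReal_ne_zero.mpr hx.ne')]
    exact tendsto_const_nhds
  · refine tendsto_const_nhds.congr' ?_
    filter_upwards [eventually_mem_band ht] with n hn
    exact (Set.indicator_of_mem hn fun t : ℝ => (t : ℂ) ^ (x : ℂ)).symm

end Heinz

theorem adjoint_op_cutPow_gap {w : ℂ} (hw : w.re ≤ 0) :
    ∃ V : H →L[ℂ] H, (E.op (cutPow (gap δ) w)).adjoint = E.op (cutPow (gap δ) w) * V := by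
  have hb := isBoundedBorel_cutPow_gap hE.pos hw
  let φ : ℝ → ℂ := fun t => starRingEnd ℂ (cutPow (gap δ) w t) / cutPow (gap δ) w t
  have hφ : IsBoundedBorel φ := by
    refine ⟨(measurable_conj hb.measurable).div hb.measurable, 1, fun t => ?_⟩
    rw [norm_div, RCLike.norm_conj]
    exact div_self_le_one _
  refine ⟨E.op φ, ?_⟩
  have hφmul : (fun t => starRingEnd ℂ (cutPow (gap δ) w t)) = cutPow (gap δ) w * φ := by
    ext t
    rcases eq_or_ne (cutPow (gap δ) w t) 0 with h | h
    · simp [h]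
    · exact (mul_div_cancel₀ _ h).symm
  rw [adjoint_op hb, ← op_mul hb hφ, hφmul]

end HasGap

end ProjMeasure

/-! ### Bounded operators as partial operators -/

theorem adjoint_ofCLM (A : H →L[ℂ] H) : (ofCLM A)† = ofCLM A.adjoint :=
  ContinuousLinearMap.toPMap_adjoint_eq_adjoint_toPMap_of_dense A dense_univ

theorem exists_opMul_eq_ofCLM {A : H →ₗ.[ℂ] H} (hA : A.IsClosed) {V : H →L[ℂ] H}
    (hV : ∀ f, V f ∈ A.domain) : ∃ W : H →L[ℂ] H, opMul A (ofCLM V) = ofCLM W := by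
  let L : H →ₗ[ℂ] H := A.toFun ∘ₗ (V : H →ₗ[ℂ] H).codRestrict A.domain hV
  have hL (f h : H) : L f = h ↔ (V f, h) ∈ A.graph :=
    ⟨fun hf => mem_graph_iff_exists.mpr ⟨hV f, hf⟩, fun hf => (mem_graph_iff_exists.mp hf).2⟩
  have hcont : Continuous L := by
    have hgraph : (L.graph : Set (H × H)) = (fun p => (V p.1, p.2)) ⁻¹' (A.graph : Set (H × H)) :=
      Set.ext fun p => eq_comm.trans (hL p.1 p.2)
    refine L.continuous_of_isClosed_graph ?_
    rw [hgraph]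
    exact IsClosed.preimage (by fun_prop) hA
  refine ⟨⟨L, hcont⟩, ext_graph fun f h => ?_⟩
  simp only [mem_graph_opMul, mem_graph_ofCLM, exists_eq_left']
  exact (hL f h).symm

theorem adjoint_apply_eq_of_opMul_ofCLM {A : H →ₗ.[ℂ] H} (hA : IsSelfAdjoint A)
    {V D : H →L[ℂ] H} (hD : opMul A (ofCLM V) = ofCLM D) {p h : H} (hp : (p, h) ∈ A.graph) :
    D.adjoint p = V.adjoint h := by
  refine ext_inner_left ℂ fun f => ?_
  rw [ContinuousLinearMap.adjoint_inner_right, ContinuousLinearMap.adjoint_inner_right]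
  refine inner_eq_of_mem_graph_adjoint hA.dense_domain hp ?_
  rw [LinearPMap.isSelfAdjoint_def.mp hA]
  exact mem_graph_of_opMul_ofCLM hD f

/-! ### Self-adjoint operators with bounded inverse -/

theorem conj_cpow_ofReal_of_nonneg {t : ℝ} (ht : 0 ≤ t) (x : ℝ) :
    starRingEnd ℂ ((t : ℂ) ^ (x : ℂ)) = (t : ℂ) ^ (x : ℂ) := by
  rw [← Complex.ofReal_cpow ht, Complex.conj_ofReal]

theorem adjoint_opPow_of_ae_nonneg {A : H →ₗ.[ℂ] H}
    (hA : ∀ f, ∀ᵐ t ∂((spectralMeasure A).scalar f), 0 ≤ t) (x : ℝ) :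
    (opPow A x)† = opPow A x := by
  rw [opPow, ProjMeasure.adjoint_integral]
  refine ProjMeasure.integral_congr _ fun f => ?_
  filter_upwards [hA f] with t ht
  exact conj_cpow_ofReal_of_nonneg ht x

section BoundedInverse

variable {T : H →ₗ.[ℂ] H} {R : H →L[ℂ] H} (hT : IsSelfAdjoint T)
  (hR : ∀ f h, (f, h) ∈ T.graph ↔ R h = f)
include hT hR

theorem isSelfAdjoint_of_mem_graph_iff : IsSelfAdjoint R := by
  rw [ContinuousLinearMap.isSelfAdjoint_iff_isSymmetric]
  intro f g
  have hf : (R f, f) ∈ T†.graph := by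
    rw [LinearPMap.isSelfAdjoint_def.mp hT]
    exact (hR _ _).mpr rfl
  exact (inner_eq_of_mem_graph_adjoint hT.dense_domain ((hR _ _).mpr rfl) hf).symm

theorem toPMap_spectralMeasure_of_mem_graph_iff : (spectralMeasure T).toPMap = T :=
  integral_spectralMeasure <| exists_projMeasure_of_resolvent
    (isSelfAdjoint_of_mem_graph_iff hT hR) 0 fun f h => by
      rw [Complex.ofReal_zero, zero_smul, add_zero, hR]

theorem hasGap_spectralMeasure : (spectralMeasure T).HasGap (1 / (‖R‖ + 1)) := by
  refine ProjMeasure.hasGap_of_norm_le (norm_nonneg R) fun f h hfh => ?_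
  rw [toPMap_spectralMeasure_of_mem_graph_iff hT hR, hR] at hfh
  rw [← hfh]
  exact R.le_opNorm h

theorem op_cutPow_gap_neg_one {δ : ℝ} (hE : (spectralMeasure T).HasGap δ) :
    (spectralMeasure T).op (cutPow (gap δ) (-1)) = R := by
  ext h
  have hmem := (hR (R h) h).mpr rfl
  rw [← toPMap_spectralMeasure_of_mem_graph_iff hT hR] at hmem
  have hne (f : H) : ∀ᵐ t : ℝ ∂((spectralMeasure T).scalar f), (t : ℂ) ≠ 0 :=
    (hE.ae_mem f).mono fun t ht => Complex.ofReal_ne_zero.mpr (ne_zero_of_mem_gap hE.pos ht)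
  have hinv := (ProjMeasure.mem_graph_integral_inv_iff hne).mpr hmem
  have hpow := hE.integral_cpow (z := -1) (by simp)
  simp only [Complex.cpow_neg_one] at hpow
  rw [← mem_graph_ofCLM, ← hpow]
  exact hinv

theorem ae_nonneg_of_isNonneg (hpos : IsNonneg T) (f : H) :
    ∀ᵐ t ∂((spectralMeasure T).scalar f), 0 ≤ t := by
  refine ProjMeasure.ae_nonneg (fun f h hfh => ?_) f
  rw [toPMap_spectralMeasure_of_mem_graph_iff hT hR] at hfh
  obtain ⟨hf, rfl⟩ := mem_graph_iff_exists.mp hfh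
  exact hpos ⟨f, hf⟩

theorem mul_eq_adjoint_mul_of_opMul_ofCLM {S : H →ₗ.[ℂ] H} (hd : Dense (S.domain : Set H))
    {A B : H →L[ℂ] H} (hA : opMul S (ofCLM R) = ofCLM A) (hB : opMul S† (ofCLM R) = ofCLM B) :
    R * A = B.adjoint * R := by
  ext f
  refine ext_inner_left ℂ fun g => ?_
  have hSS := inner_eq_of_mem_graph_adjoint hd (mem_graph_of_opMul_ofCLM hA f)
    (mem_graph_of_opMul_ofCLM hB g)
  have hRsymm := (ContinuousLinearMap.isSelfAdjoint_iff_isSymmetric.mp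
    (isSelfAdjoint_of_mem_graph_iff hT hR)) g (A f)
  rw [mul_apply_eq_comp, mul_apply_eq_comp, ContinuousLinearMap.adjoint_inner_right, hSS]
  exact hRsymm.symm

end BoundedInverse

/-! ### The factorization -/

theorem cpow_mul_cpow_one_sub (t x : ℝ) :
    (t : ℂ) ^ (x : ℂ) * (t : ℂ) ^ (1 - x : ℂ) = t := by
  rcases eq_or_ne t 0 with rfl | ht
  · rw [Complex.ofReal_zero]
    rcases eq_or_ne x 0 with rfl | hx
    · simp
    · rw [Complex.zero_cpow (Complex.ofReal_ne_zero.mpr hx), zero_mul]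
  · rw [← Complex.cpow_add _ _ (Complex.ofReal_ne_zero.mpr ht), add_sub_cancel, Complex.cpow_one]

section AbsoluteValue

variable {S : H →ₗ.[ℂ] H} (hS : S.IsClosed) (hd : Dense (S.domain : Set H))
include hS hd

theorem isSelfAdjoint_opPow_absOp (x : ℝ) : IsSelfAdjoint (opPow (absOp S) x) :=
  LinearPMap.isSelfAdjoint_def.mpr <| adjoint_opPow_of_ae_nonneg (ae_nonneg_absOp hS hd) x

theorem mem_graph_opPow_absOp_of_mem_graph {x : ℝ} {f q m : H}
    (hq : (f, q) ∈ (opPow (absOp S) (1 - x)).graph) (hm : (f, m) ∈ (absOp S).graph) :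
    (q, m) ∈ (opPow (absOp S) x).graph := by
  rw [← toPMap_spectralMeasure_absOp hS hd] at hm
  obtain ⟨hmem, rfl⟩ := (ProjMeasure.mem_graph_integral _).mp hm
  obtain ⟨hmem', rfl⟩ := (ProjMeasure.mem_graph_integral _).mp hq
  have hmul : (fun t : ℝ => (t : ℂ) ^ (x : ℂ)) * (fun t : ℝ => (t : ℂ) ^ (1 - x : ℂ))
      = fun t : ℝ => (t : ℂ) := funext fun t => cpow_mul_cpow_one_sub t x
  rw [← hmul] at hmem
  refine (ProjMeasure.mem_graph_integral _).mpr
    ⟨(ProjMeasure.memLp_scalar_integralAt _ (measurable_cpow_ofReal _) hmem').mpr hmem, ?_⟩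
  rw [ProjMeasure.integralAt_integralAt _ (measurable_cpow_ofReal _) hmem' hmem]
  congr 1

theorem mem_graph_opPow_polarFactor (hd' : Dense (S†.domain : Set H)) {x : ℝ} {u q h : H}
    (hq : (u, q) ∈ (opPow (absOp S) (1 - x)).graph) (hh : (u, h) ∈ S.graph) :
    (polarFactor S q, h) ∈ (opPow (absOp S†) x).graph := by
  obtain ⟨m, hm, rfl⟩ := (mem_graph_iff_absOp hS hd).mp hh
  exact intertwines_opPow_absOp hS hd hd' x _ _ (mem_graph_opPow_absOp_of_mem_graph hS hd hq hm)

theorem adjoint_polarFactor_apply_eq (hd' : Dense (S†.domain : Set H)) {x : ℝ}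
    {V W C D : H →L[ℂ] H} (hC : opMul (opPow (absOp S) (1 - x)) (ofCLM V) = ofCLM C)
    (hD : opMul (opPow (absOp S†) x) (ofCLM W.adjoint) = ofCLM D) {f h : H}
    (hh : (V f, h) ∈ S.graph) : D.adjoint (polarFactor S (C f)) = W h := by
  have hgraph := mem_graph_opPow_polarFactor hS hd hd' (mem_graph_of_opMul_ofCLM hC f) hh
  rw [adjoint_apply_eq_of_opMul_ofCLM
    (isSelfAdjoint_opPow_absOp (LinearPMap.adjoint_isClosed hd) hd' x) hD hgraph,
    ContinuousLinearMap.adjoint_adjoint]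

section Heinz

variable {E : ProjMeasure H} {δ : ℝ} (hE : E.HasGap δ)
  (hdom : ∀ f, E.op (cutPow (gap δ) (-1)) f ∈ S.domain) {x : ℝ} (hx0 : 0 ≤ x) (hx1 : x ≤ 1)
include hE hdom hx0 hx1

theorem op_cutPow_gap_mem_domain_opPow_absOp (f : H) :
    E.op (cutPow (gap δ) (-x)) f ∈ (opPow (absOp S) x).domain := by
  obtain ⟨C, hC⟩ := exists_opMul_eq_ofCLM isClosed_absOp
    (V := E.op (cutPow (gap δ) (-1))) fun f => by rw [domain_absOp hS hd]; exact hdom f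
  refine LinearPMap.mem_domain_of_mem_graph <| (ProjMeasure.mem_graph_integral _).mpr
    ⟨hE.memLp_cpow (C := C) (fun f => ?_) hx0 hx1 f, rfl⟩
  rw [toPMap_spectralMeasure_absOp hS hd]
  exact mem_graph_of_opMul_ofCLM hC f

theorem exists_opMul_opPow_absOp_eq_ofCLM : ∃ C : H →L[ℂ] H,
    opMul (opPow (absOp S) x) (ofCLM (E.op (cutPow (gap δ) (-x)))) = ofCLM C :=
  exists_opMul_eq_ofCLM (ProjMeasure.isClosed_integral _) <|
    op_cutPow_gap_mem_domain_opPow_absOp hS hd hE hdom hx0 hx1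

theorem exists_opMul_opPow_absOp_adjoint_eq_ofCLM : ∃ D : H →L[ℂ] H,
    opMul (opPow (absOp S) x) (ofCLM (E.op (cutPow (gap δ) (-x))).adjoint) = ofCLM D := by
  obtain ⟨V, hV⟩ := hE.adjoint_op_cutPow_gap (w := -x) (by simpa using hx0)
  rw [hV]
  exact exists_opMul_eq_ofCLM (ProjMeasure.isClosed_integral _) fun f =>
    op_cutPow_gap_mem_domain_opPow_absOp hS hd hE hdom hx0 hx1 (V f)

end Heinz

end AbsoluteValue

section Sandwich

variable {S T : H →ₗ.[ℂ] H} {δ : ℝ} (hE : (spectralMeasure T).HasGap δ) {z : ℂ}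
  (hz0 : 0 ≤ z.re) (hz1 : z.re ≤ 1)
include hE hz0 hz1

theorem mem_graph_sandwichMax_iff {f h : H} : (f, h) ∈ (sandwichMax S T z).graph ↔
    ∃ k, ((spectralMeasure T).op (cutPow (gap δ) (-1 + z)) f, k) ∈ S.graph ∧
      (spectralMeasure T).op (cutPow (gap δ) (-z)) k = h := by
  rw [sandwichMax, opPow, opPow, hE.integral_cpow (z := -z) (by simpa using hz0),
    hE.integral_cpow (z := -1 + z) (by simpa using hz1)]
  simp only [mem_graph_opMul, mem_graph_ofCLM, exists_eq_left']

theorem factorized_eq_ofCLM {C D : H →L[ℂ] H}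
    (hC : opMul (opPow (absOp S) (1 - z.re))
      (ofCLM ((spectralMeasure T).op (cutPow (gap δ) (-1 + z.re)))) = ofCLM C)
    (hD : opMul (opPow (absOp S†) z.re)
      (ofCLM ((spectralMeasure T).op (cutPow (gap δ) (-z.re))).adjoint) = ofCLM D) :
    factorized S T (opPow T (-z.re))† z
      = ofCLM ((spectralMeasure T).op (cutPow (gap δ) (-(Complex.I * z.im))) *
          (D.adjoint * (polarFactor S *
            (C * (spectralMeasure T).op (cutPow (gap δ) (Complex.I * z.im)))))) := by
  have hpow {w : ℂ} (hw : w.re ≤ 0) :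
      opPow T w = ofCLM ((spectralMeasure T).op (cutPow (gap δ) w)) := hE.integral_cpow hw
  rw [factorized, hpow (w := -(Complex.I * z.im)) (by simp),
    hpow (w := -z.re) (by simpa using hz0), hpow (w := -1 + z.re) (by simpa using hz1),
    hpow (w := Complex.I * z.im) (by simp), adjoint_ofCLM, hD, adjoint_ofCLM,
    opMul_assoc (opPow (absOp S) _), hC]
  simp only [opMul_ofCLM]

theorem mem_graph_sandwichMax_of_mem_graph (hS : S.IsClosed) (hd : Dense (S.domain : Set H))
    (hd' : Dense (S†.domain : Set H)) {C D : H →L[ℂ] H}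
    (hC : opMul (opPow (absOp S) (1 - z.re))
      (ofCLM ((spectralMeasure T).op (cutPow (gap δ) (-1 + z.re)))) = ofCLM C)
    (hD : opMul (opPow (absOp S†) z.re)
      (ofCLM ((spectralMeasure T).op (cutPow (gap δ) (-z.re))).adjoint) = ofCLM D) {f h : H}
    (hh : ((spectralMeasure T).op (cutPow (gap δ) (-1 + z)) f, h) ∈ S.graph) :
    (f, ((spectralMeasure T).op (cutPow (gap δ) (-(Complex.I * z.im))) *
        (D.adjoint * (polarFactor S *
          (C * (spectralMeasure T).op (cutPow (gap δ) (Complex.I * z.im)))))) f)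
      ∈ (sandwichMax S T z).graph := by
  have hz : (z.re : ℂ) + Complex.I * z.im = z := by rw [mul_comm, Complex.re_add_im]
  have hright := hE.op_cutPow_gap_mul (w := -1 + z.re) (z := Complex.I * z.im)
    (by simpa using hz1) (by simp)
  rw [add_assoc, hz] at hright
  have hleft := hE.op_cutPow_gap_mul (w := -(Complex.I * z.im)) (z := -z.re)
    (by simp) (by simpa using hz0)
  rw [← neg_add_rev, hz] at hleft
  rw [← hright] at hh
  refine (mem_graph_sandwichMax_iff hE hz0 hz1).mpr ⟨h, by rwa [← hright], ?_⟩
  rw [← hleft, mul_apply_eq_comp, ← adjoint_polarFactor_apply_eq hS hd hd' hC hD hh]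
  rfl

theorem mul_op_cutPow_gap_neg_one_of_mem_graph {A K : H →L[ℂ] H}
    (hA : opMul S (ofCLM ((spectralMeasure T).op (cutPow (gap δ) (-1)))) = ofCLM A)
    (hK : ∀ g, ((spectralMeasure T).op (cutPow (gap δ) (-1)) g,
      K ((spectralMeasure T).op (cutPow (gap δ) (-1)) g)) ∈ (sandwichMax S T z).graph) :
    K * (spectralMeasure T).op (cutPow (gap δ) (-1)) = (spectralMeasure T).op (cutPow (gap δ) (-z))
      * A * (spectralMeasure T).op (cutPow (gap δ) (-1 + z)) := by
  ext g
  obtain ⟨k, hk, hkK⟩ := (mem_graph_sandwichMax_iff hE hz0 hz1).mp (hK g)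
  rw [hE.op_cutPow_gap_comm (by simpa using hz1) (by simp)] at hk
  rw [mul_apply_eq_comp, ← hkK, S.mem_graph_snd_inj hk (mem_graph_of_opMul_ofCLM hA _) rfl]
  rfl

theorem exists_factorized_eq_ofCLM (hS : S.IsClosed) (hd : Dense (S.domain : Set H))
    (hd' : Dense (S†.domain : Set H))
    (hdom : ∀ f, (spectralMeasure T).op (cutPow (gap δ) (-1)) f ∈ S.domain)
    (hdom' : ∀ f, (spectralMeasure T).op (cutPow (gap δ) (-1)) f ∈ S†.domain) :
    ∃ K : H →L[ℂ] H, factorized S T (opPow T (-z.re))† z = ofCLM K ∧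
      ∀ g, ((spectralMeasure T).op (cutPow (gap δ) (-1)) g,
        K ((spectralMeasure T).op (cutPow (gap δ) (-1)) g)) ∈ (sandwichMax S T z).graph := by
  obtain ⟨C, hC⟩ := exists_opMul_opPow_absOp_eq_ofCLM hS hd hE hdom (x := 1 - z.re)
    (sub_nonneg.mpr hz1) (sub_le_self _ hz0)
  rw [Complex.ofReal_sub, Complex.ofReal_one, neg_sub', sub_neg_eq_add] at hC
  obtain ⟨D, hD⟩ := exists_opMul_opPow_absOp_adjoint_eq_ofCLM (LinearPMap.adjoint_isClosed hd) hd'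
    hE hdom' hz0 hz1
  refine ⟨_, factorized_eq_ofCLM hE hz0 hz1 hC hD, fun g => ?_⟩
  obtain ⟨h, hh⟩ := LinearPMap.mem_domain_iff.mp <|
    hdom ((spectralMeasure T).op (cutPow (gap δ) (-1 + z)) g)
  rw [hE.op_cutPow_gap_comm (by simp) (by simpa using hz1)] at hh
  exact mem_graph_sandwichMax_of_mem_graph hE hz0 hz1 hS hd hd' hC hD hh

end Sandwich

section BoundedInverse

variable {T S : H →ₗ.[ℂ] H} {R : H →L[ℂ] H} (hT : IsSelfAdjoint T)
  (hR : ∀ f h, (f, h) ∈ T.graph ↔ R h = f)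
include hT hR

theorem exists_factorization (hS : S.IsClosed) (hdom : T.domain ≤ S.domain ⊓ S†.domain)
    {A B : H →L[ℂ] H} (hA : opMul S (ofCLM R) = ofCLM A) (hB : opMul S† (ofCLM R) = ofCLM B)
    {z : ℂ} (hz0 : 0 ≤ z.re) (hz1 : z.re ≤ 1) :
    ∃ K : H →L[ℂ] H, factorized S T (opPow T (-z.re))† z = ofCLM K ∧
      (∀ f ∈ T.domain, (f, K f) ∈ (sandwichMax S T z).graph) ∧
      (∀ k : ℝ, 0 < k → ‖K‖ ≤ ‖A‖ ^ (1 - z.re) * ‖B‖ ^ z.re *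
        Real.exp (k * |z.im| ^ 2 + k * z.re * (1 - z.re) + k⁻¹ * Real.pi ^ 2)) ∧
      (IsNonneg T → ‖K‖ ≤ ‖A‖ ^ (1 - z.re) * ‖B‖ ^ z.re) := by
  have hE := hasGap_spectralMeasure hT hR
  have hER := op_cutPow_gap_neg_one hT hR hE
  have hd : Dense (S.domain : Set H) := hT.dense_domain.mono fun f hf => (hdom hf).1
  have hd' : Dense (S†.domain : Set H) := hT.dense_domain.mono fun f hf => (hdom hf).2
  have hRdom (f : H) : R f ∈ S.domain ⊓ S†.domain :=
    hdom (LinearPMap.mem_domain_of_mem_graph ((hR _ f).mpr rfl))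
  have hAB := mul_eq_adjoint_mul_of_opMul_ofCLM hT hR hd hA hB
  rw [← hER] at hRdom hA hAB
  obtain ⟨K, hfac, hK⟩ := exists_factorized_eq_ofCLM hE hz0 hz1 hS hd hd' (fun f => (hRdom f).1)
    fun f => (hRdom f).2
  have hKR := mul_op_cutPow_gap_neg_one_of_mem_graph hE hz0 hz1 hA hK
  refine ⟨K, hfac, fun f hf => ?_, fun k => hE.norm_le_interp hAB
    (fun _ => .of_forall fun t => Complex.arg_le_pi t) hz0 hz1 hKR, fun hpos =>
    hE.norm_le_interp_of_ae_nonneg hAB (ae_nonneg_of_isNonneg hT hR hpos) hz0 hz1 hKR⟩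
  obtain ⟨g, hg⟩ := LinearPMap.mem_domain_iff.mp hf
  rw [← (hR f g).mp hg, ← hER]
  exact hK g

theorem adjoint_opPow_neg_of_isNonneg (hpos : IsNonneg T) (x : ℝ) :
    (opPow T (-x))† = opPow T (-x) := by
  rw [← Complex.ofReal_neg]
  exact adjoint_opPow_of_ae_nonneg (ae_nonneg_of_isNonneg hT hR hpos) (-x)

end BoundedInverse

end

theorem theorem2p7 {H : Type*} [NormedAddCommGroup H] [InnerProductSpace ℂ H] [CompleteSpace H]
    (T S : H →ₗ.[ℂ] H) (hT : IsSelfAdjoint T) (hTinv : HasBoundedInverse T)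
    (hS : S.IsClosed) (hdom : T.domain ≤ S.domain ⊓ S†.domain) :
    ∃ A B : H →L[ℂ] H, opMul S T.inverse = ofCLM A ∧ opMul S† T.inverse = ofCLM B ∧
      (∀ z : ℂ, 0 ≤ z.re → z.re ≤ 1 →
        T.domain ≤ (sandwichMax S T z).domain ∧
        (sandwich S T z).IsClosable ∧
        ∃ K : H →L[ℂ] H, (sandwich S T z).closure = ofCLM K ∧
          factorized S T (opPow T (-z.re))† z = ofCLM K ∧
          (IsNonneg T → factorized S T (opPow T (-z.re)) z = ofCLM K) ∧
          (∀ k : ℝ, 0 < k → ‖K‖ ≤ ‖A‖ ^ (1 - z.re) * ‖B‖ ^ z.re *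
            Real.exp (k * |z.im| ^ 2 + k * z.re * (1 - z.re) + k⁻¹ * Real.pi ^ 2)) ∧
          (IsNonneg T → ‖K‖ ≤ ‖A‖ ^ (1 - z.re) * ‖B‖ ^ z.re)) ∧
      (∀ x : ℝ, 0 ≤ x → x ≤ 1 →
        ∃ K : H →L[ℂ] H, (sandwich S T x).closure = ofCLM K ∧
          ‖K‖ ≤ ‖A‖ ^ (1 - x) * ‖B‖ ^ x * Real.exp (2 * Real.pi * √(x * (1 - x))) ∧
          (IsNonneg T → ‖K‖ ≤ ‖A‖ ^ (1 - x) * ‖B‖ ^ x)) := by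
  obtain ⟨hker, R, hTR⟩ := hTinv
  have hR := mem_graph_iff_of_inverse hker hTR
  have hRT (f : H) : R f ∈ T.domain := LinearPMap.mem_domain_of_mem_graph ((hR _ f).mpr rfl)
  have hd : Dense (S.domain : Set H) := hT.dense_domain.mono fun f hf => (hdom hf).1
  obtain ⟨A, hA⟩ := exists_opMul_eq_ofCLM hS fun f => (hdom (hRT f)).1
  obtain ⟨B, hB⟩ :=
    exists_opMul_eq_ofCLM (LinearPMap.adjoint_isClosed hd) fun f => (hdom (hRT f)).2
  refine ⟨A, B, by rw [hTR, hA], by rw [hTR, hB], fun z hz0 hz1 => ?_, fun x hx0 hx1 => ?_⟩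
  · obtain ⟨K, hfac, hK, hnorm, hnorm'⟩ := exists_factorization hT hR hS hdom hA hB hz0 hz1
    refine ⟨fun f hf => LinearPMap.mem_domain_of_mem_graph (hK f hf), isClosable_domRestrict hK,
      K, closure_domRestrict hK hT.dense_domain, hfac, fun hpos => ?_, hnorm, hnorm'⟩
    rwa [adjoint_opPow_neg_of_isNonneg hT hR hpos] at hfac
  · obtain ⟨K, -, hK, hnorm, hnorm'⟩ := exists_factorization (z := x) hT hR hS hdom hA hB hx0 hx1
    refine ⟨K, closure_domRestrict hK hT.dense_domain,
      le_mul_exp_sqrt (mul_nonneg hx0 (sub_nonneg.mpr hx1)) Real.pi_pos fun k hk => ?_, hnorm'⟩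
    simpa [mul_assoc] using hnorm k hk
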